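/- Let $0\le d<N$ and let $M\subset\mathbb C^N$ be a (nonempty) connected real analytic generic submanifold of codimension $d$. That is, near each $p_0\in M$ the set $M$ is given by $\rho=0$, where $\rho=(\rho_1,\dots,\rho_d)$ is a local defining function: the $\rho_j=\rho_j(Z,\overline Z)$ are real-valued and real analytic near $p_0$, and $\partial\rho_1\wedge\dots\wedge\partial\rho_d\ne0$ at $p_0$, where $\partial f=\sum_k\frac{\partial f}{\partial Z_k}dZ_k$. Write $\rho_j(Z,\zeta)$ for the holomorphic extension of $\rho_j$ to a neighborhood of $(p_0,\overline{p_0})$ in $\mathbb C^{2N}$, with $\rho_j(Z,\overline Z)$ on $\{\zeta=\overline Z\}$ the given function. The following notions do not depend on the choice of $\rho$ or of the CR fields $L_i$. * $M$ is *holomorphically degenerate* at $p\in M$ if there is a germ at $p$ of a vector field $X=\sum_{k=1}^N a_k(Z)\frac{\partial}{\partial Z_k}$ with holomorphic coefficients that is tangent to $M$ (i.e. $X\rho_j=0$ on $M$ near $p$ for all $j$), with the $a_k$ not all vanishing identically on $M$ near $p$. $M$ is *holomorphically nondegenerate* if it is not holomorphically degenerate at some point of $M$. * Let $L_i=\sum_{k=1}^N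 a_{ik}(Z,\overline Z)\frac{\partial}{\partial\overline Z_k}$, $1\le i\le N-d$, with $a_{ik}$ real analytic near $p\in M$, be a basis near $p$ of the CR vector fields on $M$ (the sections of $T^{0,1}M$). For $\alpha\in\mathbb Z_+^{N-d}$ put $V_{j\alpha}=L_1^{\alpha_1}\cdots L_{N-d}^{\alpha_{N-d}}\,\rho_{jZ}$, where $\rho_{jZ}=(\partial\rho_j/\partial Z_1,\dots,\partial\rho_j/\partial Z_N)$. $M$ is *$k$-nondegenerate* at $p$ if the vectors $V_{j\alpha}(p,\overline p)$, $1\le j\le d$, $|\alpha|\le k$, span $\mathbb C^N$. * $M$ is *essentially finite* at $p\in M$ if the germ at $p$ of the set $\{Z:\rho(Z,\zeta)=0\text{ for all }\zeta\text{ near }\overline p\text{ with }\rho(p,\zeta)=0\}$ is $\{p\}$. * A *proper real analytic subset* of $M$ is a subset $V\subsetneq M$ that near every point of $M$ is the set of common zeros in $M$ of finitely many real analytic functions. Then the following conditions are equivalent: (i) $M$ is holomorphically nondegenerate. (ii) There exist $p_1\in M$ and an integer $k>0$ such that $M$ is $k$-nondegenerate at $p_1$. (iii) There exist a proper real analytic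 subset $V$ of $M$ and an integer $\ell$ with $1\le\ell\le N-d$ such that $M$ is $\ell$-nondegenerate at every $p\in M\setminus V$. (iv) There exists $p_1\in M$ such that $M$ is essentially finite at $p_1$. (v) $M$ is essentially finite at all points of some dense (relatively) open subset of $M$. -/

import Mathlib

open Filter Topology

namespace CRGeom

noncomputable section

/-- The Wirtinger derivative `∂f/∂Z_k = (∂f/∂x_k - i ∂f/∂y_k) / 2`. -/
def dZ {N : ℕ} (k : Fin N) (f : (Fin N → ℂ) → ℂ) (Z : Fin N → ℂ) : ℂ :=
  (fderiv ℝ f Z (Pi.single k 1) - Complex.I * fderiv ℝ f Z (Pi.single k Complex.I)) / 2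

/-- The Wirtinger derivative `∂f/∂Z̄_k = (∂f/∂x_k + i ∂f/∂y_k) / 2`. -/
def dZbar {N : ℕ} (k : Fin N) (f : (Fin N → ℂ) → ℂ) (Z : Fin N → ℂ) : ℂ :=
  (fderiv ℝ f Z (Pi.single k 1) + Complex.I * fderiv ℝ f Z (Pi.single k Complex.I)) / 2

/-- A real-valued function seen as a complex-valued one. -/
def toC {N : ℕ} (r : (Fin N → ℂ) → ℝ) : (Fin N → ℂ) → ℂ := fun Z => (r Z : ℂ)

/-- The complex gradient `r_Z = (∂r/∂Z_1, …, ∂r/∂Z_N)` of a real-valued function. -/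
def gradZ {N : ℕ} (r : (Fin N → ℂ) → ℝ) (Z : Fin N → ℂ) : Fin N → ℂ :=
  fun k => dZ k (toC r) Z

/-- `ρ = (ρ_1, …, ρ_d)` is a generic real analytic local defining function of `M` near `p`:
the `ρ_j` are real-valued and real analytic near `p`, `M` is given by `ρ = 0` near `p`, and
`∂ρ_1 ∧ … ∧ ∂ρ_d ≠ 0` at `p` (hence near `p`). -/
structure IsDefiningAt {N d : ℕ} (M : Set (Fin N → ℂ)) (ρ : Fin d → (Fin N → ℂ) → ℝ)
    (p : Fin N → ℂ) : Prop where
  analyticAt : ∀ j, AnalyticAt ℝ (ρ j) p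
  mem_iff : ∀ᶠ Z in 𝓝 p, (Z ∈ M ↔ ∀ j, ρ j Z = 0)
  generic : LinearIndependent ℂ (fun j => gradZ (ρ j) p)

/-- `M` is a real analytic generic submanifold of `ℂ^N` of (real) codimension `d`. -/
def IsGenericSubmanifold {N : ℕ} (d : ℕ) (M : Set (Fin N → ℂ)) : Prop :=
  ∀ p ∈ M, ∃ ρ : Fin d → (Fin N → ℂ) → ℝ, IsDefiningAt M ρ p

/-- `M` is holomorphically degenerate at `p`: there is a germ at `p` of a holomorphic vector
field `X = ∑ a_k(Z) ∂/∂Z_k` which is tangent to `M` near `p` (`X ρ_j = 0` on `M` for all `j`),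
and whose coefficients do not all vanish identically on `M` near `p`. -/
def HolomorphicallyDegenerateAt {N : ℕ} (d : ℕ) (M : Set (Fin N → ℂ)) (p : Fin N → ℂ) : Prop :=
  ∃ (ρ : Fin d → (Fin N → ℂ) → ℝ) (a : Fin N → (Fin N → ℂ) → ℂ),
    IsDefiningAt M ρ p ∧
    (∀ k, AnalyticAt ℂ (a k) p) ∧
    (∀ᶠ Z in 𝓝[M] p, ∀ j, ∑ k, a k Z * gradZ (ρ j) Z k = 0) ∧
    ¬ ∀ᶠ Z in 𝓝[M] p, ∀ k, a k Z = 0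

/-- `M` is holomorphically nondegenerate: it is so at some point. -/
def HolomorphicallyNondegenerate {N : ℕ} (d : ℕ) (M : Set (Fin N → ℂ)) : Prop :=
  ∃ p ∈ M, ¬ HolomorphicallyDegenerateAt d M p

/-- The antiholomorphic vector field `∑_k a_k ∂/∂Z̄_k` acting on functions. -/
def crOp {N : ℕ} (a : Fin N → (Fin N → ℂ) → ℂ) (f : (Fin N → ℂ) → ℂ) : (Fin N → ℂ) → ℂ :=
  fun Z => ∑ k, a k Z * dZbar k f Z

/-- `L^α f = L_1^{α_1} ⋯ L_n^{α_n} f`, where `L_j = ∑_k a_{jk} ∂/∂Z̄_k`. -/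
def crOpPow {N n : ℕ} (a : Fin n → Fin N → (Fin N → ℂ) → ℂ) (α : Fin n → ℕ)
    (f : (Fin N → ℂ) → ℂ) : (Fin N → ℂ) → ℂ :=
  (List.finRange n).foldr (fun j g => (crOp (a j))^[α j] g) f

/-- The fields `L_j = ∑_k a_{jk} ∂/∂Z̄_k`, `j = 1, …, N - d`, with real analytic coefficients,
form near `p` a basis of the CR vector fields (sections of `T^{0,1}M`) on `M = {ρ = 0}`. -/
structure IsCRBasisAt {N d : ℕ} (M : Set (Fin N → ℂ)) (ρ : Fin d → (Fin N → ℂ) → ℝ)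
    (a : Fin (N - d) → Fin N → (Fin N → ℂ) → ℂ) (p : Fin N → ℂ) : Prop where
  analyticAt : ∀ j k, AnalyticAt ℝ (a j k) p
  tangent : ∀ᶠ Z in 𝓝[M] p, ∀ j i, crOp (a j) (toC (ρ i)) Z = 0
  linearIndependent : LinearIndependent ℂ (fun j k => a j k p)

/-- The vector `V_{jα}(Z) = L^α ρ_{jZ}(Z) ∈ ℂ^N` for `r = ρ_j`. -/
def levVec {N n : ℕ} (r : (Fin N → ℂ) → ℝ) (a : Fin n → Fin N → (Fin N → ℂ) → ℂ)
    (α : Fin n → ℕ) (Z : Fin N → ℂ) : Fin N → ℂ :=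
  fun k => crOpPow a α (dZ k (toC r)) Z

/-- `M` is `k`-nondegenerate at `p`: the vectors `V_{jα}(p)`, `1 ≤ j ≤ d`, `|α| ≤ k`,
span `ℂ^N`. -/
def IsNondegenerateAt {N : ℕ} (d : ℕ) (M : Set (Fin N → ℂ)) (k : ℕ) (p : Fin N → ℂ) : Prop :=
  ∃ (ρ : Fin d → (Fin N → ℂ) → ℝ) (a : Fin (N - d) → Fin N → (Fin N → ℂ) → ℂ),
    IsDefiningAt M ρ p ∧ IsCRBasisAt M ρ a p ∧
    Submodule.span ℂ {v : Fin N → ℂ |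
      ∃ (j : Fin d) (α : Fin (N - d) → ℕ), ∑ i, α i ≤ k ∧ v = levVec (ρ j) a α p} = ⊤

/-- `R(Z, ζ)` is the complexification near `(p, p̄)` of `r(Z) = R(Z, Z̄)`. -/
structure IsComplexificationAt {N : ℕ} (r : (Fin N → ℂ) → ℝ)
    (R : (Fin N → ℂ) × (Fin N → ℂ) → ℂ) (p : Fin N → ℂ) : Prop where
  analyticAt : AnalyticAt ℂ R (p, star p)
  eq_on_diag : ∀ᶠ Z in 𝓝 p, R (Z, star Z) = (r Z : ℂ)

/-- `M` is essentially finite at `p`: the germ at `p` of the set of all `Z` such that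
`ρ(Z, ζ) = 0` for all `ζ` near `p̄` with `ρ(p, ζ) = 0` is `{p}`. -/
def EssentiallyFiniteAt {N : ℕ} (d : ℕ) (M : Set (Fin N → ℂ)) (p : Fin N → ℂ) : Prop :=
  ∃ (ρ : Fin d → (Fin N → ℂ) → ℝ) (R : Fin d → (Fin N → ℂ) × (Fin N → ℂ) → ℂ),
    IsDefiningAt M ρ p ∧ (∀ j, IsComplexificationAt (ρ j) (R j) p) ∧
    ∀ᶠ Z in 𝓝 p,
      (∀ᶠ ζ in 𝓝 (star p), (∀ j, R j (p, ζ) = 0) → ∀ j, R j (Z, ζ) = 0) → Z = p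

/-- `V` is a proper real analytic subset of `M`: `V ⊊ M`, and near every point of `M` it is the
common zero set in `M` of finitely many real analytic functions. -/
structure IsProperAnalyticSubset {N : ℕ} (V M : Set (Fin N → ℂ)) : Prop where
  ssubset : V ⊂ M
  locally_zeros : ∀ p ∈ M, ∃ (m : ℕ) (f : Fin m → (Fin N → ℂ) → ℝ),
    (∀ i, AnalyticAt ℝ (f i) p) ∧ ∀ᶠ Z in 𝓝[M] p, (Z ∈ V ↔ ∀ i, f i Z = 0)

end

end CRGeom

open Filter Topology
open scoped ContDiff

/-! ### Uniqueness of analytic germs. -/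

namespace CRGeom

/-! Near p ∈ M the complexification ρ(Z,ζ) = 0 of M is a graph ζ = θ(Z,χ), where χ = πζ ∈ ℂ^(N-d)
and π is a linear projection injective on ker ρ_ζ. In (Z,χ)-space M sits as χ = πZ̄, and its real
tangent spaces span the whole space over ℂ. Hence a holomorphic germ that vanishes on M vanishes
identically (`IsSegreChart.eventually_eq_zero`), and every condition of the theorem becomes a
condition on the holomorphic map θ.

Differentiating ρ(Z,θ(Z,χ)) = 0 gives ρ_Z = -ρ_ζ θ_Z, and CR fields turn into derivations in χ. As
ρ_ζ is injective on ker π, k-nondegeneracy at p says that no v ≠ 0 is killed by all ∂_χ^α θ_Z with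
|α| ≤ k at (p, πp̄) (`IsSegreChart.eq_zero_of_van`, `IsSegreChart.isNondegenerateAt`). Nondegeneracy
of some order then says that the differentials at p of the functions Z ↦ θ(Z,χ), χ in a fixed ball,
have no common kernel. Essential finiteness says that the common fibre of these functions through p
is isolated, and a holomorphic field is tangent to M when its coefficient vector is killed by θ_Z.

All conditions are compared with nondegeneracy of some order at some point. If the family of
differentials has rank N at one Z in a ball around p, some N × N minor is a nonzero holomorphic
function of Z; it cannot vanish on an open piece of M, so good points are dense in M near p. If the
rank stays below N, Cramer's rule at a point of maximal rank yields a nonzero holomorphic kernel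
field, so M is holomorphically degenerate at p. Connectedness spreads the first alternative over all
of M. Rank N at a good point gives essential finiteness there by the inverse function theorem.
Conversely, an isolated fibre with deficient rank throughout a ball would produce nonconstant
analytic curves inside compact fibres, against the maximum principle
(`exists_injective_of_isolated_fibre`).

For the order N - d, consider the rank of the ∂_χ^α θ_Z with |α| ≤ k. It is at least d for k = 0.
Where two consecutive ranks agree and are constant on an open set, differentiating a kernel field
shows that it is killed by derivatives of every order (`pdw_eq_zero_of_kernel_field`), which
nondegeneracy of some order forbids. So generically the rank grows at each step until it reaches N,
and N - d steps suffice. The exceptional set is cut out by a sum of squared minors. -/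

/-- A directionally closed family of analytic germs all vanishing at `x₀` consists of zero germs. -/
theorem eventually_eq_zero_of_fderiv_closed {E F : Type*} [NormedAddCommGroup E] [NormedSpace ℂ E]
    [NormedAddCommGroup F] [NormedSpace ℂ F] [CompleteSpace F] {x₀ : E} {S : Set (E → F)}
    (hS : ∀ f ∈ S, AnalyticAt ℂ f x₀ ∧ f x₀ = 0 ∧ ∀ e, (fun x => fderiv ℂ f x e) ∈ S)
    {f : E → F} (hf : f ∈ S) : ∀ᶠ x in 𝓝 x₀, f x = 0 := by
  -- A derivative of any order along a line is the value at x₀ of another member of the family.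
  have key : ∀ (m : ℕ) (y : E), ∀ f ∈ S, iteratedDeriv m (fun t : ℂ => f (x₀ + t • y)) 0 = 0 := by
    intro m y
    induction m with
    | zero => intro f hf; simpa using (hS f hf).2.1
    | succ m ih =>
      intro f hf
      rw [iteratedDeriv_succ']
      rw [← ih _ ((hS f hf).2.2 y)]
      apply Filter.EventuallyEq.iteratedDeriv_eq
      have h1 : ∀ᶠ x in 𝓝 x₀, DifferentiableAt ℂ f x :=
        (hS f hf).1.eventually_analyticAt.mono fun x hx => hx.differentiableAt
      have h2 : Tendsto (fun t : ℂ => x₀ + t • y) (𝓝 0) (𝓝 x₀) := by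
        have : Continuous (fun t : ℂ => x₀ + t • y) := by fun_prop
        simpa using this.tendsto 0
      filter_upwards [h2.eventually h1] with t ht
      have h3 : HasDerivAt (fun t : ℂ => x₀ + t • y) y t := by
        simpa using ((hasDerivAt_id t).smul_const y).const_add x₀
      exact (ht.hasFDerivAt.comp_hasDerivAt t h3).deriv
  obtain ⟨r, hr, hball⟩ := Metric.eventually_nhds_iff_ball.1 (hS f hf).1.eventually_analyticAt
  refine Metric.eventually_nhds_iff_ball.2 ⟨r, hr, fun x hx => ?_⟩
  -- The one-variable identity theorem is applied on the complex line through x₀ and x, where t = 1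
  -- gives x.
  set L : ℂ → E := fun t => x₀ + t • (x - x₀) with hL
  have hLa : ∀ t, AnalyticAt ℂ L t := fun t => by
    simp only [hL]; fun_prop
  have hT : Convex ℝ (L ⁻¹' Metric.ball x₀ r) := by
    have h : L ⁻¹' Metric.ball x₀ r = Metric.ball (0 : ℂ) 1 ∪ L ⁻¹' Metric.ball x₀ r := by
      symm; apply Set.union_eq_right.2
      intro t ht
      simp only [hL, Set.mem_preimage, mem_ball_iff_norm, add_sub_cancel_left, norm_smul]
      simp only [mem_ball_iff_norm, sub_zero] at ht hx
      nlinarith [norm_nonneg t, norm_nonneg (x - x₀)]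
    clear h
    intro s hs t ht a b ha hb hab
    simp only [hL, Set.mem_preimage, mem_ball_iff_norm, add_sub_cancel_left, norm_smul] at *
    have h1 : ‖a • s + b • t‖ ≤ a * ‖s‖ + b * ‖t‖ := by
      refine (norm_add_le _ _).trans ?_
      rw [norm_smul, norm_smul, Real.norm_of_nonneg ha, Real.norm_of_nonneg hb]
    rcases ha.eq_or_lt with h | h
    · have : b = 1 := by linarith
      subst this; subst h; simpa using ht
    · nlinarith [norm_nonneg (x - x₀), mul_le_mul_of_nonneg_right h1 (norm_nonneg (x - x₀)),
        mul_lt_mul_of_pos_left hs h, mul_le_mul_of_nonneg_left ht.le hb]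
  have hφ : AnalyticOnNhd ℂ (fun t => f (L t)) (L ⁻¹' Metric.ball x₀ r) := fun t ht =>
    (hball _ ht).comp (hLa t)
  have h0 : (0 : ℂ) ∈ L ⁻¹' Metric.ball x₀ r := by simp [hL, hr]
  have h1 : (1 : ℂ) ∈ L ⁻¹' Metric.ball x₀ r := by simpa [hL] using hx
  have hz : ∀ᶠ t in 𝓝 (0 : ℂ), f (L t) = 0 := by
    rw [← analyticOrderAt_eq_top, ENat.eq_top_iff_forall_ge]
    intro m
    exact (natCast_le_analyticOrderAt_iff_iteratedDeriv_eq_zero (hφ 0 h0)).2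
      fun i _ => key i _ f hf
  simpa [hL] using hφ.eqOn_zero_of_preconnected_of_eventuallyEq_zero hT.isPreconnected h0 hz h1

/-- Analytic functions vanishing on a set with enough tangent directions vanish. -/
theorem eventually_eq_zero_of_uniqueDiff {E F : Type*} [NormedAddCommGroup E] [NormedSpace ℂ E]
    [NormedAddCommGroup F] [NormedSpace ℂ F] [CompleteSpace F] {x₀ : E} {P : Set E} (hx : x₀ ∈ P)
    (hP : ∀ᶠ x in 𝓝[P] x₀, UniqueDiffWithinAt ℂ P x) {f : E → F} (hf : AnalyticAt ℂ f x₀)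
    (h0 : ∀ᶠ x in 𝓝[P] x₀, f x = 0) : ∀ᶠ x in 𝓝 x₀, f x = 0 := by
  refine eventually_eq_zero_of_fderiv_closed
    (S := {f | AnalyticAt ℂ f x₀ ∧ ∀ᶠ x in 𝓝[P] x₀, f x = 0}) ?_ ⟨hf, h0⟩
  rintro g ⟨hg, hg0⟩
  refine ⟨hg, hg0.self_of_nhdsWithin hx, fun e => ⟨?_, ?_⟩⟩
  · exact (ContinuousLinearMap.apply ℂ F e).analyticAt _ |>.comp hg.fderiv
  · have h1 : ∀ᶠ x in 𝓝[P] x₀, DifferentiableAt ℂ g x :=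
      (hg.eventually_analyticAt.filter_mono nhdsWithin_le_nhds).mono
        fun x hx => hx.differentiableAt
    have h2 := eventually_eventually_nhdsWithin.2 hg0
    filter_upwards [hP, h1, h2, self_mem_nhdsWithin] with x hx1 hx2 hx3 hx4
    -- Near x the function is zero on P, so 0 is a derivative within P; uniqueness identifies it
    -- with the full derivative, and the family of germs vanishing on P is closed under
    -- differentiation.
    have h4 : HasFDerivWithinAt g (0 : E →L[ℂ] F) P x :=
      (hasFDerivWithinAt_const (0 : F) x P).congr_of_eventuallyEq hx3 (hx3.self_of_nhdsWithin hx4)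
    rw [hx1.eq hx2.hasFDerivAt.hasFDerivWithinAt h4]; rfl

end CRGeom

/-! ### Complexification of real analytic germs; Wirtinger derivatives. -/

namespace CRGeom

section Complexification

variable {E W : Type*} [NormedAddCommGroup E] [NormedSpace ℝ E] [NormedAddCommGroup W]
  [NormedSpace ℂ W]

/-- The complex-linear extension of a real-linear map along a real structure `re, im`. -/
noncomputable def extendLinear {G : Type*} [NormedAddCommGroup G] [NormedSpace ℂ G]
    (re im : W →L[ℝ] E) (h1 : ∀ w, re (Complex.I • w) = -im w)
    (h2 : ∀ w, im (Complex.I • w) = re w) (T : E →L[ℝ] G) : W →L[ℂ] G where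
  toFun w := T (re w) + Complex.I • T (im w)
  map_add' u v := by simp only [map_add, smul_add]; abel
  map_smul' c w := by
    have hr : re (c • w) = c.re • re w - c.im • im w := by
      conv_lhs => rw [← Complex.re_add_im c, add_smul, mul_smul, map_add,
        Complex.coe_smul, Complex.coe_smul, map_smul, map_smul, h1]
      simp [sub_eq_add_neg]
    have hi : im (c • w) = c.re • im w + c.im • re w := by
      conv_lhs => rw [← Complex.re_add_im c, add_smul, mul_smul, map_add,
        Complex.coe_smul, Complex.coe_smul, map_smul, map_smul, h2]
    rw [hr, hi, RingHom.id_apply]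
    simp only [map_add, map_sub, map_smul]
    conv_rhs => rw [← Complex.re_add_im c]
    simp only [add_smul, smul_add, mul_smul, Complex.coe_smul]
    rw [smul_comm Complex.I c.re, smul_comm Complex.I c.im,
      smul_smul Complex.I Complex.I, Complex.I_mul_I]
    simp only [neg_smul, one_smul, smul_neg]
    abel
  cont := by fun_prop

theorem norm_extendLinear_le {G : Type*} [NormedAddCommGroup G] [NormedSpace ℂ G]
    (re im : W →L[ℝ] E) (h1 : ∀ w, re (Complex.I • w) = -im w)
    (h2 : ∀ w, im (Complex.I • w) = re w) (T : E →L[ℝ] G) :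
    ‖extendLinear re im h1 h2 T‖ ≤ (‖re‖ + ‖im‖) * ‖T‖ := by
  refine ContinuousLinearMap.opNorm_le_bound _ (by positivity) fun w => ?_
  calc ‖T (re w) + Complex.I • T (im w)‖ ≤ ‖T (re w)‖ + ‖Complex.I • T (im w)‖ := norm_add_le _ _
    _ = ‖T (re w)‖ + ‖T (im w)‖ := by rw [norm_smul, Complex.norm_I, one_mul]
    _ ≤ ‖T‖ * (‖re‖ * ‖w‖) + ‖T‖ * (‖im‖ * ‖w‖) := by
        gcongr
        · exact (T.le_opNorm _).trans (by gcongr; exact re.le_opNorm _)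
        · exact (T.le_opNorm _).trans (by gcongr; exact im.le_opNorm _)
    _ = _ := by ring

/-- One variable at a time is extended, by currying. Linearity of Λ in f is what the induction
needs, and the geometric bound keeps the radius of an extended power series positive. -/
theorem exists_extendMultilinear {G : Type*} [NormedAddCommGroup G] [NormedSpace ℂ G]
    (re im : W →L[ℝ] E) (h1 : ∀ w, re (Complex.I • w) = -im w)
    (h2 : ∀ w, im (Complex.I • w) = re w) (ι : E → W) (h3 : ∀ x, re (ι x) = x)
    (h4 : ∀ x, im (ι x) = 0) (n : ℕ) :
    ∃ Λ : (E [×n]→L[ℝ] G) →ₗ[ℝ] (W [×n]→L[ℂ] G),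
      (∀ f, ‖Λ f‖ ≤ (‖re‖ + ‖im‖) ^ n * ‖f‖) ∧ ∀ f x, Λ f (fun i => ι (x i)) = f x := by
  induction n with
  | zero =>
    refine ⟨{ toFun := fun f => ContinuousMultilinearMap.constOfIsEmpty ℂ _ (f 0)
              map_add' := fun f g => by ext; simp
              map_smul' := fun c f => by ext; simp }, fun f => ?_, fun f x => ?_⟩
    · simp only [LinearMap.coe_mk, AddHom.coe_mk, pow_zero, one_mul]
      refine ContinuousMultilinearMap.opNorm_le_bound (norm_nonneg _) fun m => ?_
      simp
    · simp only [LinearMap.coe_mk, AddHom.coe_mk, ContinuousMultilinearMap.constOfIsEmpty_apply]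
      congr 1; exact Subsingleton.elim _ _
  | succ n ih =>
    obtain ⟨Λ, hΛ, hx⟩ := ih
    let Λc : (E [×n]→L[ℝ] G) →L[ℝ] (W [×n]→L[ℂ] G) := Λ.mkContinuous _ hΛ
    have hext : ∀ f : E [×(n+1)]→L[ℝ] G, ∀ m : Fin (n+1) → W,
        (extendLinear re im h1 h2 (Λc.comp f.curryLeft)).uncurryLeft m =
          Λ (f.curryLeft (re (m 0))) (Fin.tail m) +
            Complex.I • Λ (f.curryLeft (im (m 0))) (Fin.tail m) := fun f m => rfl
    refine ⟨{ toFun := fun f => (extendLinear re im h1 h2 (Λc.comp f.curryLeft)).uncurryLeft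
              map_add' := fun f g => ?_
              map_smul' := fun c f => ?_ }, fun f => ?_, fun f x => ?_⟩
    · ext m
      have e : ∀ x, (f + g).curryLeft x = f.curryLeft x + g.curryLeft x := fun x => rfl
      rw [add_apply, hext, hext, hext]
      simp only [e, map_add, add_apply, smul_add]
      abel
    · ext m
      have e : ∀ x, (c • f).curryLeft x = c • f.curryLeft x := fun x => rfl
      rw [RingHom.id_apply, smul_apply, hext, hext]
      simp only [e, map_smul, smul_apply, smul_add]
      rw [smul_comm Complex.I c]
    · simp only [LinearMap.coe_mk, AddHom.coe_mk]
      rw [ContinuousLinearMap.uncurryLeft_norm]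
      refine (norm_extendLinear_le _ _ _ _ _).trans ?_
      have h5 : ‖Λc.comp f.curryLeft‖ ≤ (‖re‖ + ‖im‖) ^ n * ‖f‖ := by
        refine (ContinuousLinearMap.opNorm_comp_le _ _).trans ?_
        rw [ContinuousMultilinearMap.curryLeft_norm]
        gcongr
        exact Λ.mkContinuous_norm_le (by positivity) hΛ
      calc (‖re‖ + ‖im‖) * ‖Λc.comp f.curryLeft‖
          ≤ (‖re‖ + ‖im‖) * ((‖re‖ + ‖im‖) ^ n * ‖f‖) := by gcongr
        _ = _ := by ring
    · simp only [LinearMap.coe_mk, AddHom.coe_mk]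
      rw [hext, h3, h4, map_zero, map_zero]
      simp only [zero_apply, smul_zero, add_zero]
      have := hx (f.curryLeft (x 0)) (Fin.tail x)
      have e : (Fin.tail fun i => ι (x i)) = fun i => ι (Fin.tail x i) := rfl
      rw [e, this, ContinuousMultilinearMap.curryLeft_apply, Fin.cons_self_tail]

/-- A real analytic germ extends to a complex analytic germ on the complexified space. -/
theorem exists_complex_extension {G : Type*} [NormedAddCommGroup G] [NormedSpace ℂ G]
    [CompleteSpace G] (re im : W →L[ℝ] E) (h1 : ∀ w, re (Complex.I • w) = -im w)
    (h2 : ∀ w, im (Complex.I • w) = re w) (ι : E →L[ℝ] W) (h3 : ∀ x, re (ι x) = x)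
    (h4 : ∀ x, im (ι x) = 0) {f : E → G} {p : E} (hf : AnalyticAt ℝ f p) :
    ∃ H : W → G, AnalyticAt ℂ H (ι p) ∧ ∀ᶠ x in 𝓝 p, H (ι x) = f x := by
  obtain ⟨s, hs⟩ := hf
  obtain ⟨r, hr⟩ := hs
  choose Λ hΛ hΛx using exists_extendMultilinear (G := G) re im h1 h2 ι h3 h4
  let q : FormalMultilinearSeries ℂ W G := fun n => Λ n (s n)
  -- The extra 1 makes C positive, so that the radius can be divided by it.
  set C : ℝ := ‖re‖ + ‖im‖ + 1 with hC
  have hCpos : 0 < C := by positivity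
  obtain ⟨r', hr'0, hr'⟩ := ENNReal.lt_iff_exists_nnreal_btwn.1 hr.r_pos
  obtain ⟨K, hK, hKb⟩ := s.norm_mul_pow_le_of_lt_radius (hr'.trans_le hr.r_le)
  have hr'pos : (0 : ℝ) < r' := by exact_mod_cast hr'0
  have hrad : ((r' / ⟨C, hCpos.le⟩ : NNReal) : ENNReal) ≤ q.radius := by
    refine q.le_radius_of_bound K fun n => ?_
    have hb : ‖q n‖ ≤ C ^ n * ‖s n‖ := by
      refine (hΛ n (s n)).trans ?_
      gcongr
      rw [hC]; linarith
    calc ‖q n‖ * ((r' / ⟨C, hCpos.le⟩ : NNReal) : ℝ) ^ n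
        = ‖q n‖ * (r' / C) ^ n := rfl
      _ ≤ (C ^ n * ‖s n‖) * (r' / C) ^ n := by gcongr
      _ = ‖s n‖ * r' ^ n := by
          rw [div_pow]; field_simp
      _ ≤ K := hKb n
  have hqpos : 0 < q.radius := lt_of_lt_of_le (by
    rw [ENNReal.coe_pos, ← NNReal.coe_pos]; exact div_pos hr'pos hCpos) hrad
  have hq := q.hasFPowerSeriesOnBall hqpos
  refine ⟨fun w => q.sum (w - ι p), ?_, ?_⟩
  · have : AnalyticAt ℂ q.sum (ι p - ι p) := by rw [sub_self]; exact hq.analyticAt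
    exact AnalyticAt.fun_comp (g := q.sum) this (by fun_prop)
  · have hev : ∀ᶠ x in 𝓝 p, ι (x - p) ∈ Metric.eball (0 : W) q.radius := by
      have : Tendsto (fun x => ι (x - p)) (𝓝 p) (𝓝 0) := by
        have : Continuous fun x => ι (x - p) := by fun_prop
        simpa using this.tendsto p
      exact this.eventually (Metric.eball_mem_nhds _ hqpos)
    filter_upwards [hev, Metric.eball_mem_nhds p hr.r_pos] with x hx hx2
    have e1 := hq.hasSum hx
    have e2 := hr.hasSum_sub hx2
    have e3 : (fun n => q n fun _ => ι (x - p)) = fun n => s n fun _ => x - p := by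
      funext n; exact hΛx n (s n) fun _ => x - p
    rw [e3, zero_add, map_sub] at e1
    exact e1.unique e2

end Complexification

variable {N : ℕ}

/-- Coordinatewise conjugation as a real continuous linear map. -/
noncomputable def conjL (N : ℕ) : (Fin N → ℂ) →L[ℝ] (Fin N → ℂ) := (starL' ℝ).toContinuousLinearMap

@[simp] theorem conjL_apply (Z : Fin N → ℂ) : conjL N Z = star Z := rfl

/-- The embedding of `ℂ^N` onto the antidiagonal `ζ = Z̄`. -/
noncomputable def diagL (N : ℕ) : (Fin N → ℂ) →L[ℝ] (Fin N → ℂ) × (Fin N → ℂ) :=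
  (ContinuousLinearMap.id ℝ _).prod (conjL N)

@[simp] theorem diagL_apply (Z : Fin N → ℂ) : diagL N Z = (Z, star Z) := rfl

theorem exists_complexification {G : Type*} [NormedAddCommGroup G] [NormedSpace ℂ G]
    [CompleteSpace G] {f : (Fin N → ℂ) → G} {p : Fin N → ℂ} (hf : AnalyticAt ℝ f p) :
    ∃ H : (Fin N → ℂ) × (Fin N → ℂ) → G, AnalyticAt ℂ H (p, star p) ∧
      ∀ᶠ Z in 𝓝 p, H (Z, star Z) = f Z := by
  -- The real structure on ℂ^N × ℂ^N whose real points are ζ = Z̄: real part (Z + ζ̄)/2, imaginary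
  -- part (Z - ζ̄)/(2i).
  let re : (Fin N → ℂ) × (Fin N → ℂ) →L[ℝ] (Fin N → ℂ) :=
    (1 / 2 : ℝ) • (ContinuousLinearMap.fst ℝ _ _ + (conjL N).comp (ContinuousLinearMap.snd ℝ _ _))
  let im : (Fin N → ℂ) × (Fin N → ℂ) →L[ℝ] (Fin N → ℂ) :=
    (1 / 2 : ℝ) • ((-Complex.I) •
      (ContinuousLinearMap.fst ℝ _ _ - (conjL N).comp (ContinuousLinearMap.snd ℝ _ _)))
  have hre : ∀ w k, re w k = (1 / 2 : ℂ) * (w.1 k + star (w.2 k)) := fun w k => by simp [re]; ring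
  have him : ∀ w k, im w k = (1 / 2 : ℂ) * (-Complex.I * (w.1 k - star (w.2 k))) :=
    fun w k => by simp [im]
  refine exists_complex_extension re im (fun w => ?_) (fun w => ?_) (diagL N) (fun x => ?_)
    (fun x => ?_) hf
  · ext k
    rw [hre, Pi.neg_apply, him]
    simp
    ring
  · ext k
    rw [hre, him]
    simp
    linear_combination (-(1 : ℂ) / 2 * w.1 k - 1 / 2 * (starRingEnd ℂ) (w.2 k)) * Complex.I_mul_I
  · ext k
    rw [hre]
    simp
    ring
  · ext k
    rw [him]
    simp

theorem hasFDerivAt_comp_diag {G : Type*} [NormedAddCommGroup G] [NormedSpace ℂ G]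
    {H : (Fin N → ℂ) × (Fin N → ℂ) → G} {f : (Fin N → ℂ) → G} {p : Fin N → ℂ}
    (hH : DifferentiableAt ℂ H (p, star p)) (hf : ∀ᶠ Z in 𝓝 p, H (Z, star Z) = f Z) :
    HasFDerivAt f (((fderiv ℂ H (p, star p)).restrictScalars ℝ).comp (diagL N)) p := by
  have h1 : HasFDerivAt H ((fderiv ℂ H (p, star p)).restrictScalars ℝ) (diagL N p) :=
    hH.hasFDerivAt.restrictScalars ℝ
  refine (h1.comp p (diagL N).hasFDerivAt).congr_of_eventuallyEq ?_
  filter_upwards [hf] with Z hZ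
  simp [hZ]

/-- Along Z ↦ (Z, Z̄) the derivative in direction c·e_k has a part linear in c, from the slot Z, and
a part linear in c̄, from the slot ζ; the Wirtinger combination keeps the first. -/
theorem dZ_eq_of_complexification {H : (Fin N → ℂ) × (Fin N → ℂ) → ℂ} {f : (Fin N → ℂ) → ℂ}
    {p : Fin N → ℂ} (hH : DifferentiableAt ℂ H (p, star p))
    (hf : ∀ᶠ Z in 𝓝 p, H (Z, star Z) = f Z) (k : Fin N) :
    dZ k f p = fderiv ℂ H (p, star p) (Pi.single k 1, 0) := by
  rw [dZ, (hasFDerivAt_comp_diag hH hf).fderiv]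
  set T := fderiv ℂ H (p, star p)
  have e0 : ∀ c : ℂ, diagL N (Pi.single k c) = c • ((Pi.single k 1 : Fin N → ℂ), (0 : Fin N → ℂ)) +
      (star c) • ((0 : Fin N → ℂ), (Pi.single k 1 : Fin N → ℂ)) := by
    intro c
    rw [diagL_apply, ← Pi.single_star]
    ext i <;> by_cases h : i = k <;> simp [h]
  simp only [ContinuousLinearMap.comp_apply, ContinuousLinearMap.coe_restrictScalars', e0,
    map_add, map_smul, smul_eq_mul]
  simp
  linear_combination (-T (Pi.single k 1, 0) / 2 + T (0, Pi.single k 1) / 2) * Complex.I_mul_I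

theorem dZbar_eq_of_complexification {H : (Fin N → ℂ) × (Fin N → ℂ) → ℂ} {f : (Fin N → ℂ) → ℂ}
    {p : Fin N → ℂ} (hH : DifferentiableAt ℂ H (p, star p))
    (hf : ∀ᶠ Z in 𝓝 p, H (Z, star Z) = f Z) (k : Fin N) :
    dZbar k f p = fderiv ℂ H (p, star p) (0, Pi.single k 1) := by
  rw [dZbar, (hasFDerivAt_comp_diag hH hf).fderiv]
  set T := fderiv ℂ H (p, star p)
  have e0 : ∀ c : ℂ, diagL N (Pi.single k c) = c • ((Pi.single k 1 : Fin N → ℂ), (0 : Fin N → ℂ)) +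
      (star c) • ((0 : Fin N → ℂ), (Pi.single k 1 : Fin N → ℂ)) := by
    intro c
    rw [diagL_apply, ← Pi.single_star]
    ext i <;> by_cases h : i = k <;> simp [h]
  simp only [ContinuousLinearMap.comp_apply, ContinuousLinearMap.coe_restrictScalars', e0,
    map_add, map_smul, smul_eq_mul]
  simp
  linear_combination (T (Pi.single k 1, 0) / 2 - T (0, Pi.single k 1) / 2) * Complex.I_mul_I

/-- The antiholomorphic gradient of a real function is the conjugate of the holomorphic one. -/
theorem dZbar_toC (r : (Fin N → ℂ) → ℝ) (k : Fin N) {p : Fin N → ℂ} (hr : DifferentiableAt ℝ r p) :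
    dZbar k (toC r) p = star (gradZ r p k) := by
  have h : HasFDerivAt (toC r) (Complex.ofRealCLM.comp (fderiv ℝ r p)) p :=
    Complex.ofRealCLM.hasFDerivAt.comp p hr.hasFDerivAt
  simp only [gradZ, dZbar, dZ, h.fderiv]
  simp

theorem IsDefiningAt.exists_complexification {d : ℕ} {M : Set (Fin N → ℂ)}
    {ρ : Fin d → (Fin N → ℂ) → ℝ} {p : Fin N → ℂ} (h : IsDefiningAt M ρ p) :
    ∃ R : Fin d → (Fin N → ℂ) × (Fin N → ℂ) → ℂ, ∀ j, IsComplexificationAt (ρ j) (R j) p := by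
  have : ∀ j, ∃ R, IsComplexificationAt (ρ j) R p := fun j => by
    have hC : AnalyticAt ℝ (toC (ρ j)) p :=
      (Complex.ofRealCLM.analyticAt _).comp (h.analyticAt j)
    obtain ⟨H, h1, h2⟩ := CRGeom.exists_complexification hC
    exact ⟨H, h1, h2⟩
  choose R hR using this
  exact ⟨R, hR⟩

end CRGeom


/-! ### Linear algebra, analytic inverses, complexified defining functions. -/

namespace CRGeom

section LinearAlgebra

variable {N : ℕ}

/-- The dual form of spanning: it turns each nondegeneracy condition into the absence of a nonzero
common kernel vector. -/
theorem span_eq_top_iff_dotProduct {ι : Type*} (w : ι → Fin N → ℂ) :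
    Submodule.span ℂ (Set.range w) = ⊤ ↔ ∀ v : Fin N → ℂ, (∀ i, w i ⬝ᵥ v = 0) → v = 0 := by
  constructor
  · intro h v hv
    have h1 : ∀ u ∈ Submodule.span ℂ (Set.range w), u ⬝ᵥ v = 0 := by
      intro u hu
      induction hu using Submodule.span_induction with
      | mem x hx => obtain ⟨i, rfl⟩ := hx; exact hv i
      | zero => simp
      | add x y _ _ hx hy => rw [add_dotProduct, hx, hy, add_zero]
      | smul a x _ hx => rw [smul_dotProduct, hx, smul_zero]
    refine dotProduct_eq_zero v fun u => ?_
    rw [dotProduct_comm]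
    exact h1 u (h ▸ Submodule.mem_top)
  · intro h
    by_contra hne
    obtain ⟨f, hf0, hf⟩ := Submodule.exists_le_ker_of_lt_top _ (lt_top_iff_ne_top.2 hne)
    have hdot : ∀ u : Fin N → ℂ, f u = u ⬝ᵥ fun k => f (Pi.single k 1) := by
      intro u
      conv_lhs => rw [← (Pi.basisFun ℂ (Fin N)).sum_repr u]
      simp [dotProduct]
    apply hf0
    have := h (fun k => f (Pi.single k 1)) fun i => by
      rw [← hdot]; exact hf (Submodule.subset_span ⟨i, rfl⟩)
    ext k
    simpa using congrFun this k

theorem exists_complement_rows {d n : ℕ} (hn : d + n = N) {b : Fin d → Fin N → ℂ}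
    (hb : LinearIndependent ℂ b) :
    ∃ c : Fin n → Fin N → ℂ, ∀ u, (∀ j, b j ⬝ᵥ u = 0) → (∀ i, c i ⬝ᵥ u = 0) → u = 0 := by
  let V := Submodule.span ℂ (Set.range b)
  have h1 : Module.finrank ℂ ((Fin N → ℂ) ⧸ V) = n := by
    have h2 := V.finrank_quotient_add_finrank
    have h3 : Module.finrank ℂ V = d := by simpa using finrank_span_eq_card hb
    rw [h3, Module.finrank_fin_fun] at h2
    omega
  let B := Module.finBasisOfFinrankEq ℂ ((Fin N → ℂ) ⧸ V) h1
  choose c hc using fun i => V.mkQ_surjective (B i)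
  refine ⟨c, fun u h2 h3 => ?_⟩
  have hspan : Submodule.span ℂ (Set.range (Sum.elim b c)) = ⊤ := by
    rw [Set.Sum.elim_range, Submodule.span_union]
    have h4 : (Submodule.span ℂ (Set.range c)).map V.mkQ = ⊤ := by
      rw [Submodule.map_span, ← Set.range_comp]
      have : V.mkQ ∘ c = B := funext hc
      rw [this, B.span_eq]
    have h5 := congrArg (Submodule.comap V.mkQ) h4
    rwa [Submodule.comap_map_mkQ, Submodule.comap_top] at h5
  refine (span_eq_top_iff_dotProduct _).1 hspan u ?_
  rintro (j | i)
  · exact h2 j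
  · exact h3 i

end LinearAlgebra

/-- The analytic inverse function theorem in equal finite dimensions. -/
theorem exists_analytic_inverse {E F : Type*} [NormedAddCommGroup E] [NormedSpace ℂ E]
    [FiniteDimensional ℂ E] [NormedAddCommGroup F] [NormedSpace ℂ F] [FiniteDimensional ℂ F]
    (hdim : Module.finrank ℂ E = Module.finrank ℂ F) {f : E → F} {a : E} (hf : AnalyticAt ℂ f a)
    (hinj : ∀ v, fderiv ℂ f a v = 0 → v = 0) :
    ∃ g : F → E, AnalyticAt ℂ g (f a) ∧ g (f a) = a ∧ (∀ᶠ x in 𝓝 a, g (f x) = x) ∧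
      ∀ᶠ y in 𝓝 (f a), f (g y) = y := by
  have : CompleteSpace E := FiniteDimensional.complete ℂ E
  have : CompleteSpace F := FiniteDimensional.complete ℂ F
  have hi : Function.Injective (fderiv ℂ f a).toLinearMap :=
    (injective_iff_map_eq_zero (fderiv ℂ f a).toLinearMap).2 hinj
  let e : E ≃L[ℂ] F := (LinearEquiv.ofInjectiveOfFinrankEq _ hi hdim).toContinuousLinearEquiv
  have he : (e : E →L[ℂ] F) = fderiv ℂ f a := by ext; rfl
  have hs : HasStrictFDerivAt f (e : E →L[ℂ] F) a := he ▸ hf.hasStrictFDerivAt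
  refine ⟨hs.localInverse f e a, ?_, hs.localInverse_apply_image, hs.eventually_left_inverse,
    hs.eventually_right_inverse⟩
  -- At exponent ω, `ContDiffAt` encodes analyticity, so the regularity statement for local inverses
  -- covers the analytic case.
  have hc : ContDiffAt ℂ ω f a := hf.contDiffAt
  have ha : (hs.toOpenPartialHomeomorph f).symm (f a) = a := hs.localInverse_apply_image
  refine ContDiffAt.analyticAt (𝕜 := ℂ) ?_
  exact (hs.toOpenPartialHomeomorph f).contDiffAt_symm
    hs.image_mem_toOpenPartialHomeomorph_target (f₀' := e) (ha.symm ▸ hs.hasFDerivAt)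
    (ha.symm ▸ hc)

section Defining

variable {N d : ℕ} {M : Set (Fin N → ℂ)} {ρ : Fin d → (Fin N → ℂ) → ℝ} {p : Fin N → ℂ}

/-- The vector-valued complexified defining function. -/
def vecFun (R : Fin d → (Fin N → ℂ) × (Fin N → ℂ) → ℂ) : (Fin N → ℂ) × (Fin N → ℂ) → Fin d → ℂ :=
  fun x j => R j x

theorem IsComplexificationAt.eventually {r : (Fin N → ℂ) → ℝ}
    {R : (Fin N → ℂ) × (Fin N → ℂ) → ℂ} (h : IsComplexificationAt r R p) :
    ∀ᶠ q in 𝓝 p, IsComplexificationAt r R q := by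
  have hc : Tendsto (fun q : Fin N → ℂ => (q, star q)) (𝓝 p) (𝓝 (p, star p)) := by
    have : Continuous (fun q : Fin N → ℂ => (q, star q)) := by fun_prop
    exact this.tendsto p
  filter_upwards [hc.eventually h.analyticAt.eventually_analyticAt,
    eventually_eventually_nhds.2 h.eq_on_diag] with q h1 h2
  exact ⟨h1, h2⟩

theorem IsComplexificationAt.gradZ_eq {r : (Fin N → ℂ) → ℝ}
    {R : (Fin N → ℂ) × (Fin N → ℂ) → ℂ} (h : IsComplexificationAt r R p) (k : Fin N) :
    gradZ r p k = fderiv ℂ R (p, star p) (Pi.single k 1, 0) :=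
  dZ_eq_of_complexification h.analyticAt.differentiableAt h.eq_on_diag k

theorem IsComplexificationAt.differentiableAt {r : (Fin N → ℂ) → ℝ}
    {R : (Fin N → ℂ) × (Fin N → ℂ) → ℂ} (h : IsComplexificationAt r R p) :
    DifferentiableAt ℝ r p := by
  have h1 := hasFDerivAt_comp_diag (f := toC r) h.analyticAt.differentiableAt h.eq_on_diag
  exact (Complex.reCLM.hasFDerivAt.comp p h1).differentiableAt

theorem IsComplexificationAt.star_gradZ_eq {r : (Fin N → ℂ) → ℝ}
    {R : (Fin N → ℂ) × (Fin N → ℂ) → ℂ} (h : IsComplexificationAt r R p) (k : Fin N) :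
    star (gradZ r p k) = fderiv ℂ R (p, star p) (0, Pi.single k 1) := by
  rw [← dZbar_toC r k h.differentiableAt]
  exact dZbar_eq_of_complexification h.analyticAt.differentiableAt h.eq_on_diag k

theorem clm_prod_eq_dot (T : (Fin N → ℂ) × (Fin N → ℂ) →L[ℂ] ℂ) (v u : Fin N → ℂ) :
    T (v, u) = (fun k => T (Pi.single k 1, 0)) ⬝ᵥ v + (fun k => T (0, Pi.single k 1)) ⬝ᵥ u := by
  have h : ((v, u) : (Fin N → ℂ) × (Fin N → ℂ)) =
      ∑ k, v k • ((Pi.single k 1 : Fin N → ℂ), (0 : Fin N → ℂ)) +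
      ∑ k, u k • ((0 : Fin N → ℂ), (Pi.single k 1 : Fin N → ℂ)) := by
    ext i <;> simp [Prod.fst_sum, Prod.snd_sum, Finset.sum_apply, Pi.single_apply]
  rw [h]
  simp only [map_add, map_sum, map_smul, smul_eq_mul, dotProduct, mul_comm]

theorem IsComplexificationAt.fderiv_apply {r : (Fin N → ℂ) → ℝ}
    {R : (Fin N → ℂ) × (Fin N → ℂ) → ℂ} (h : IsComplexificationAt r R p) (v u : Fin N → ℂ) :
    fderiv ℂ R (p, star p) (v, u) = gradZ r p ⬝ᵥ v + star (gradZ r p) ⬝ᵥ u := by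
  rw [clm_prod_eq_dot]
  congr 2
  · ext k; exact (h.gradZ_eq k).symm
  · ext k; exact (h.star_gradZ_eq k).symm

theorem IsComplexificationAt.fderiv_real {r : (Fin N → ℂ) → ℝ}
    {R : (Fin N → ℂ) × (Fin N → ℂ) → ℂ} (h : IsComplexificationAt r R p) (v : Fin N → ℂ) :
    fderiv ℝ r p v = 2 * (gradZ r p ⬝ᵥ v).re := by
  have h1 := hasFDerivAt_comp_diag (f := toC r) h.analyticAt.differentiableAt h.eq_on_diag
  have h2 : HasFDerivAt (toC r) (Complex.ofRealCLM.comp (fderiv ℝ r p)) p :=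
    Complex.ofRealCLM.hasFDerivAt.comp p h.differentiableAt.hasFDerivAt
  have h3 := DFunLike.congr_fun (h1.unique h2) v
  simp only [ContinuousLinearMap.comp_apply, ContinuousLinearMap.coe_restrictScalars',
    diagL_apply, h.fderiv_apply] at h3
  have h4 : star (gradZ r p) ⬝ᵥ star v = star (gradZ r p ⬝ᵥ v) := by
    rw [Matrix.star_dotProduct_star, dotProduct_comm]
  rw [h4] at h3
  have := congrArg Complex.re h3
  simp at this
  linarith

theorem IsDefiningAt.eventually (h : IsDefiningAt M ρ p) : ∀ᶠ q in 𝓝 p, IsDefiningAt M ρ q := by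
  obtain ⟨R, hR⟩ := h.exists_complexification
  have h1 : ∀ᶠ q in 𝓝 p, ∀ j, AnalyticAt ℝ (ρ j) q :=
    eventually_all.2 fun j => (h.analyticAt j).eventually_analyticAt
  have h2 : ∀ᶠ q in 𝓝 p, ∀ j, IsComplexificationAt (ρ j) (R j) q :=
    eventually_all.2 fun j => (hR j).eventually
  -- The gradients are read off the complexification, where they are visibly continuous; linear
  -- independence is an open condition.
  have h3 : ∀ᶠ q in 𝓝 p, LinearIndependent ℂ fun j => (fun k =>
      fderiv ℂ (R j) (q, star q) (Pi.single k 1, 0) : Fin N → ℂ) := by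
    have hc : Tendsto (fun q => fun j => (fun k =>
        fderiv ℂ (R j) (q, star q) (Pi.single k 1, 0) : Fin N → ℂ)) (𝓝 p)
        (𝓝 fun j => fun k => fderiv ℂ (R j) (p, star p) (Pi.single k 1, 0)) := by
      refine tendsto_pi_nhds.2 fun j => tendsto_pi_nhds.2 fun k => ?_
      have c1 : ContinuousAt (fun x => fderiv ℂ (R j) x (Pi.single k 1, 0)) (p, star p) :=
        (hR j).analyticAt.fderiv.continuousAt.clm_apply continuousAt_const
      have c2 : Continuous (fun q : Fin N → ℂ => (q, star q)) := by fun_prop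
      exact c1.tendsto.comp (c2.tendsto p)
    refine hc.eventually (isOpen_setOfPred_linearIndependent.mem_nhds ?_)
    have e : (fun j => fun k => fderiv ℂ (R j) (p, star p) (Pi.single k 1, 0)) =
        fun j => gradZ (ρ j) p := by
      ext j k; exact ((hR j).gradZ_eq k).symm
    simpa only [Set.mem_ofPred_eq, e] using h.generic
  filter_upwards [h1, eventually_eventually_nhds.2 h.mem_iff, h2, h3] with q g1 g2 g3 g4
  refine ⟨g1, g2, ?_⟩
  have e : (fun j => fun k => fderiv ℂ (R j) (q, star q) (Pi.single k 1, 0)) =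
      fun j => gradZ (ρ j) q := by
    ext j k; exact ((g3 j).gradZ_eq k).symm
  rwa [e] at g4

end Defining

end CRGeom

/-! ### Segre charts, and M as a maximally real set in the complexification. -/

namespace CRGeom

section Chart

variable {N n d : ℕ} {M : Set (Fin N → ℂ)} {ρ : Fin d → (Fin N → ℂ) → ℝ} {p : Fin N → ℂ}

/-- The point `(Z, π Z̄)` of the complexified submanifold over `Z`. -/
noncomputable def realPt (π : (Fin N → ℂ) →L[ℂ] (Fin n → ℂ)) (Z : Fin N → ℂ) : (Fin N → ℂ) × (Fin n → ℂ) :=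
  (Z, π (star Z))

/-- `realPt` as a real-linear map. -/
noncomputable def realPtL (π : (Fin N → ℂ) →L[ℂ] (Fin n → ℂ)) :
    (Fin N → ℂ) →L[ℝ] (Fin N → ℂ) × (Fin n → ℂ) :=
  (ContinuousLinearMap.id ℝ _).prod ((π.restrictScalars ℝ).comp (conjL N))

theorem continuous_realPt (π : (Fin N → ℂ) →L[ℂ] (Fin n → ℂ)) : Continuous (realPt π) :=
  (realPtL π).continuous

/-- `(Z, χ) ↦ (Z, θ (Z, χ))` parametrizes near `(p, p̄)` the complexification of `M`. -/
structure IsSegreChart (M : Set (Fin N → ℂ)) (π : (Fin N → ℂ) →L[ℂ] (Fin n → ℂ))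
    (θ : (Fin N → ℂ) × (Fin n → ℂ) → Fin N → ℂ) (p : Fin N → ℂ) : Prop where
  analyticAt : AnalyticAt ℂ θ (realPt π p)
  proj : ∀ᶠ x in 𝓝 (realPt π p), π (θ x) = x.2
  conj : ∀ᶠ Z in 𝓝[M] p, θ (realPt π Z) = star Z
  unique : ∀ᶠ Z in 𝓝[M] p, UniqueDiffWithinAt ℂ (realPt π '' M) (realPt π Z)

theorem tendsto_realPt (π : (Fin N → ℂ) →L[ℂ] (Fin n → ℂ)) (p : Fin N → ℂ) :
    Tendsto (realPt π) (𝓝[M] p) (𝓝 (realPt π p)) :=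
  ((continuous_realPt π).tendsto p).mono_left nhdsWithin_le_nhds

variable {π : (Fin N → ℂ) →L[ℂ] (Fin n → ℂ)} {θ : (Fin N → ℂ) × (Fin n → ℂ) → Fin N → ℂ}

theorem IsSegreChart.eventually (h : IsSegreChart M π θ p) :
    ∀ᶠ q in 𝓝[M] p, IsSegreChart M π θ q := by
  filter_upwards [(tendsto_realPt π p).eventually h.analyticAt.eventually_analyticAt,
    (tendsto_realPt π p).eventually (eventually_eventually_nhds.2 h.proj),
    eventually_eventually_nhdsWithin.2 h.conj, eventually_eventually_nhdsWithin.2 h.unique]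
    with q h1 h2 h3 h4
  exact ⟨h1, h2, h3, h4⟩

theorem tendsto_fst_realPt_image (π : (Fin N → ℂ) →L[ℂ] (Fin n → ℂ)) (p : Fin N → ℂ) :
    Tendsto Prod.fst (𝓝[realPt π '' M] (realPt π p)) (𝓝[M] p) := by
  refine tendsto_nhdsWithin_iff.2 ⟨?_, ?_⟩
  · exact (continuous_fst.tendsto (realPt π p)).mono_left nhdsWithin_le_nhds
  · filter_upwards [self_mem_nhdsWithin] with x hx
    obtain ⟨Z, hZ, rfl⟩ := hx
    exact hZ

theorem eventually_realPt_image {π : (Fin N → ℂ) →L[ℂ] (Fin n → ℂ)} {p : Fin N → ℂ}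
    {P : (Fin N → ℂ) × (Fin n → ℂ) → Prop} (h : ∀ᶠ Z in 𝓝[M] p, P (realPt π Z)) :
    ∀ᶠ x in 𝓝[realPt π '' M] (realPt π p), P x := by
  filter_upwards [(tendsto_fst_realPt_image π p).eventually h, self_mem_nhdsWithin] with x hx hx2
  obtain ⟨Z, hZ, rfl⟩ := hx2
  exact hx

/-- Analytic germs vanishing on `M` vanish on its complexification. -/
theorem IsSegreChart.eventually_eq_zero (h : IsSegreChart M π θ p) (hp : p ∈ M)
    {F : Type*} [NormedAddCommGroup F] [NormedSpace ℂ F] [CompleteSpace F]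
    {g : (Fin N → ℂ) × (Fin n → ℂ) → F} (hg : AnalyticAt ℂ g (realPt π p))
    (h0 : ∀ᶠ Z in 𝓝[M] p, g (realPt π Z) = 0) : ∀ᶠ x in 𝓝 (realPt π p), g x = 0 :=
  eventually_eq_zero_of_uniqueDiff (P := realPt π '' M) ⟨p, hp, rfl⟩
    (eventually_realPt_image h.unique) hg (eventually_realPt_image h0)

theorem IsSegreChart.apply_realPt (h : IsSegreChart M π θ p) (hp : p ∈ M) :
    θ (realPt π p) = star p := h.conj.self_of_nhdsWithin hp

/-- `(Z, χ) ↦ (Z, θ (Z, χ))`. -/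
def graphMap (θ : (Fin N → ℂ) × (Fin n → ℂ) → Fin N → ℂ) (x : (Fin N → ℂ) × (Fin n → ℂ)) :
    (Fin N → ℂ) × (Fin N → ℂ) := (x.1, θ x)

theorem IsSegreChart.analyticAt_graphMap (h : IsSegreChart M π θ p) :
    AnalyticAt ℂ (graphMap θ) (realPt π p) := analyticAt_fst.prod h.analyticAt

theorem IsSegreChart.graphMap_realPt (h : IsSegreChart M π θ p) (hp : p ∈ M) :
    graphMap θ (realPt π p) = (p, star p) := by
  rw [graphMap, h.apply_realPt hp]; rfl

/-- A germ at `(p, p̄)` vanishing on the antidiagonal of `M` vanishes on the graph of `θ`. -/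
theorem IsSegreChart.eventually_graphMap_eq_zero (h : IsSegreChart M π θ p) (hp : p ∈ M)
    {F : Type*} [NormedAddCommGroup F] [NormedSpace ℂ F] [CompleteSpace F]
    {H : (Fin N → ℂ) × (Fin N → ℂ) → F} (hH : AnalyticAt ℂ H (p, star p))
    (h0 : ∀ᶠ Z in 𝓝[M] p, H (Z, star Z) = 0) :
    ∀ᶠ x in 𝓝 (realPt π p), H (graphMap θ x) = 0 := by
  refine h.eventually_eq_zero hp (g := fun x => H (graphMap θ x)) ?_ ?_
  · refine AnalyticAt.fun_comp (g := H) ?_ h.analyticAt_graphMap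
    rwa [h.graphMap_realPt hp]
  · filter_upwards [h0, h.conj] with Z h1 h2
    rw [graphMap, h2]; exact h1

theorem bijective_of_transversal (hn : d + n = N) {b : Fin d → Fin N → ℂ}
    (hπ : ∀ u, (∀ j, b j ⬝ᵥ u = 0) → π u = 0 → u = 0) (a : Fin d → ℂ) (χ : Fin n → ℂ) :
    ∃ u, (∀ j, b j ⬝ᵥ u = a j) ∧ π u = χ := by
  let L : (Fin N → ℂ) →ₗ[ℂ] (Fin d → ℂ) × (Fin n → ℂ) :=
    (Matrix.mulVecLin (Matrix.of b)).prod π.toLinearMap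
  have hL : Function.Injective L := by
    rw [injective_iff_map_eq_zero]
    intro u hu
    have h1 := congrArg Prod.fst hu
    have h2 := congrArg Prod.snd hu
    exact hπ u (fun j => congrFun h1 j) h2
  have hs : Function.Surjective L := by
    refine (LinearMap.injective_iff_surjective_of_finrank_eq_finrank ?_).1 hL
    rw [Module.finrank_prod, Module.finrank_fin_fun, Module.finrank_fin_fun,
      Module.finrank_fin_fun, hn]
  obtain ⟨u, hu⟩ := hs (a, χ)
  exact ⟨u, fun j => congrFun (congrArg Prod.fst hu) j, congrArg Prod.snd hu⟩

/-- At points of a generic submanifold the real tangent vectors span the complexification. -/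
theorem IsDefiningAt.uniqueDiffWithinAt (h : IsDefiningAt M ρ p) (hp : p ∈ M) (hn : d + n = N)
    (hπ : ∀ u, (∀ j, star (gradZ (ρ j) p) ⬝ᵥ u = 0) → π u = 0 → u = 0) :
    UniqueDiffWithinAt ℂ (realPt π '' M) (realPt π p) := by
  obtain ⟨R, hR⟩ := h.exists_complexification
  have hbij := bijective_of_transversal hn hπ
  have hbij' : ∀ a : Fin d → ℂ, ∃ z, ∀ j, gradZ (ρ j) p ⬝ᵥ z = a j := by
    intro a
    obtain ⟨u, hu, -⟩ := hbij (star a) 0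
    refine ⟨star u, fun j => ?_⟩
    have := congrArg star (hu j)
    rwa [← Matrix.star_dotProduct_star, star_star, dotProduct_comm, Pi.star_apply, star_star] at this
  let r : (Fin N → ℂ) → (Fin d → ℝ) := fun Z j => ρ j Z
  have hr : AnalyticAt ℝ r p := AnalyticAt.pi h.analyticAt
  have hr' : ∀ v j, fderiv ℝ r p v j = 2 * (gradZ (ρ j) p ⬝ᵥ v).re := by
    intro v j
    rw [fderiv_pi fun j => (h.analyticAt j).differentiableAt]
    exact (hR j).fderiv_real v
  -- dr = 2 Re(∂r), and ∂r is onto ℂ^d by genericity.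
  have hrs : (fderiv ℝ r p).range = ⊤ := by
    refine LinearMap.range_eq_top.2 fun y => ?_
    obtain ⟨z, hz⟩ := hbij' fun j => ((y j / 2 : ℝ) : ℂ)
    refine ⟨z, funext fun j => ?_⟩
    change fderiv ℝ r p z j = y j
    rw [hr', hz, Complex.ofReal_re]; ring
  have hst := hr.hasStrictFDerivAt
  -- The implicit function parametrizes M near p by the kernel of dr, with the inclusion of that
  -- kernel as derivative.
  have hker : ∀ v, fderiv ℝ r p v = 0 → v ∈ tangentConeAt ℝ M p := by
    intro v hv
    let φ : (fderiv ℝ r p).ker → Fin N → ℂ := hst.implicitFunction r _ hrs (r p)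
    have hφ0 : φ 0 = p := hst.implicitFunction_apply_image hrs
    have hφd : HasStrictFDerivAt φ (fderiv ℝ r p).ker.subtypeL 0 := hst.to_implicitFunction hrs
    have hφr : ∀ᶠ y in 𝓝 (0 : (fderiv ℝ r p).ker), r (φ y) = r p := by
      have h1 := hst.map_implicitFunction_eq hrs
      have h2 : Tendsto (fun y : (fderiv ℝ r p).ker => (r p, y)) (𝓝 0) (𝓝 (r p, 0)) :=
        (Continuous.prodMk_right (r p)).tendsto 0
      exact h2.eventually h1
    have hφM : ∀ᶠ y in 𝓝 (0 : (fderiv ℝ r p).ker), φ y ∈ M := by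
      have h3 : Tendsto φ (𝓝 0) (𝓝 p) := by
        have := hφd.continuousAt.tendsto
        rwa [hφ0] at this
      have hp0 := h.mem_iff.self_of_nhds.1 hp
      filter_upwards [hφr, h3.eventually h.mem_iff] with y h4 h5
      exact h5.2 fun j => (congrFun h4 j).trans (hp0 j)
    have h6 := (hφd.hasFDerivAt.hasFDerivWithinAt (s := {y | φ y ∈ M})).mapsTo_tangent_cone
    rw [tangentConeAt_of_mem_nhds hφM, hφ0] at h6
    have h7 := h6 (Set.mem_univ (⟨v, hv⟩ : (fderiv ℝ r p).ker))
    refine tangentConeAt_mono ?_ h7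
    rintro _ ⟨y, hy, rfl⟩
    exact hy
  set S := Submodule.span ℂ (tangentConeAt ℂ (realPt π '' M) (realPt π p)) with hS
  have hmem : ∀ v, fderiv ℝ r p v = 0 → realPt π v ∈ S := by
    intro v hv
    have h1 := ((realPtL π).hasFDerivAt (x := p)).hasFDerivWithinAt (s := M) |>.mapsTo_tangent_cone
      (hker v hv)
    exact Submodule.subset_span (tangentConeAt_mono_field h1)
  have hker0 : ∀ v, (∀ j, gradZ (ρ j) p ⬝ᵥ v = 0) → fderiv ℝ r p v = 0 := by
    intro v hv
    ext j
    rw [hr', hv]; simp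
  -- For v complex tangent, iv is tangent as well. Multiplication by i acts as i on the slot Z and
  -- as -i on the slot χ, so combining both images in S separates the slots.
  have hH : ∀ v, (∀ j, gradZ (ρ j) p ⬝ᵥ v = 0) →
      ((v, 0) : (Fin N → ℂ) × (Fin n → ℂ)) ∈ S ∧ ((0, π (star v)) : (Fin N → ℂ) × (Fin n → ℂ)) ∈ S := by
    intro v hv
    have h1 := hmem v (hker0 v hv)
    have h2 := hmem (Complex.I • v) (hker0 _ fun j => by rw [dotProduct_smul, hv, smul_zero])
    have e2 : realPt π (Complex.I • v) = (Complex.I • v, -(Complex.I • π (star v))) := by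
      simp [realPt, star_smul]
    rw [e2] at h2
    have h3 := S.smul_mem (-Complex.I) h2
    have e3 : (-Complex.I) • ((Complex.I • v, -(Complex.I • π (star v))) :
        (Fin N → ℂ) × (Fin n → ℂ)) = (v, -π (star v)) := by
      ext i <;> simp [← mul_assoc]
    rw [e3] at h3
    constructor
    · have := S.smul_mem (1 / 2 : ℂ) (S.add_mem h1 h3)
      have e : (1 / 2 : ℂ) • (realPt π v + (v, -π (star v))) = (v, 0) := by
        ext i <;> simp [realPt]
        ring
      rwa [e] at this
    · have := S.smul_mem (1 / 2 : ℂ) (S.sub_mem h1 h3)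
      have e : (1 / 2 : ℂ) • (realPt π v - (v, -π (star v))) = (0, π (star v)) := by
        ext i <;> simp [realPt]
        ring
      rwa [e] at this
  have hX : ∀ χ, ((0, χ) : (Fin N → ℂ) × (Fin n → ℂ)) ∈ S := by
    intro χ
    obtain ⟨u, hu, rfl⟩ := hbij 0 χ
    have := (hH (star u) fun j => ?_).2
    · rwa [star_star] at this
    · have := congrArg star (hu j)
      rwa [← Matrix.star_dotProduct_star, star_star, dotProduct_comm, Pi.zero_apply, star_zero]
        at this
  have hV : ∀ v, fderiv ℝ r p v = 0 → ((v, 0) : (Fin N → ℂ) × (Fin n → ℂ)) ∈ S := by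
    intro v hv
    have := S.sub_mem (hmem v hv) (hX (π (star v)))
    simpa [realPt] using this
  -- z₁ and z₂ are real tangent because ∂ρ takes imaginary values on them; these values are chosen
  -- so that z + i z₁ - z₂ is complex tangent.
  have hE : ∀ z, ((z, 0) : (Fin N → ℂ) × (Fin n → ℂ)) ∈ S := by
    intro z
    obtain ⟨z₁, h1⟩ := hbij' fun j => Complex.I * ((gradZ (ρ j) p ⬝ᵥ z).re : ℂ)
    obtain ⟨z₂, h2⟩ := hbij' fun j => Complex.I * ((gradZ (ρ j) p ⬝ᵥ z).im : ℂ)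
    have m1 := hV z₁ (by ext j; rw [hr', h1]; simp)
    have m2 := hV z₂ (by ext j; rw [hr', h2]; simp)
    have m3 := (hH (z + Complex.I • z₁ - z₂) fun j => by
      rw [dotProduct_sub, dotProduct_add, dotProduct_smul, h1, h2]
      rw [smul_eq_mul]
      linear_combination ((gradZ (ρ j) p ⬝ᵥ z).re : ℂ) * Complex.I_mul_I -
        Complex.re_add_im (gradZ (ρ j) p ⬝ᵥ z)).1
    have := S.add_mem (S.sub_mem m3 (S.smul_mem Complex.I m1)) m2
    have e : ((z + Complex.I • z₁ - z₂, 0) - Complex.I • (z₁, 0) + (z₂, 0) :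
        (Fin N → ℂ) × (Fin n → ℂ)) = (z, 0) := by
      ext i
      · simp only [Prod.smul_mk, Prod.mk_sub_mk, Prod.mk_add_mk, Pi.add_apply, Pi.sub_apply]
        ring
      · simp
    rwa [e] at this
  refine ⟨?_, subset_closure ⟨p, hp, rfl⟩⟩
  have : S = ⊤ := by
    refine eq_top_iff.2 fun x _ => ?_
    have := S.add_mem (hE x.1) (hX x.2)
    simpa using this
  rw [← hS, this]
  exact dense_univ

end Chart

end CRGeom

/-! ### Existence of Segre charts, and their relation to any defining function. -/

namespace CRGeom

section ChartProperties

variable {N n d : ℕ} {M : Set (Fin N → ℂ)} {ρ : Fin d → (Fin N → ℂ) → ℝ} {p : Fin N → ℂ}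
  {π : (Fin N → ℂ) →L[ℂ] (Fin n → ℂ)} {θ : (Fin N → ℂ) × (Fin n → ℂ) → Fin N → ℂ}
  {R : Fin d → (Fin N → ℂ) × (Fin N → ℂ) → ℂ}

theorem linearIndependent_star {b : Fin d → Fin N → ℂ} (hb : LinearIndependent ℂ b) :
    LinearIndependent ℂ fun j => star (b j) := by
  rw [Fintype.linearIndependent_iff] at hb ⊢
  intro g hg i
  have h := hb (fun j => star (g j)) (by
    have := congrArg star hg
    simpa [star_sum, star_smul] using this) i
  simpa using h

theorem clm_apply_eq_dot (π : (Fin N → ℂ) →L[ℂ] (Fin n → ℂ)) (u : Fin N → ℂ) (i : Fin n) :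
    π u i = (fun k => π (Pi.single k 1) i) ⬝ᵥ u := by
  conv_lhs => rw [← (Pi.basisFun ℂ (Fin N)).sum_repr u]
  simp [dotProduct, Finset.sum_apply, mul_comm]

theorem span_eq_top_iff_linearIndependent {ι : Type*} [Fintype ι] (hι : Fintype.card ι = N)
    (b : ι → Fin N → ℂ) :
    Submodule.span ℂ (Set.range b) = ⊤ ↔ LinearIndependent ℂ b :=
  ⟨fun h => linearIndependent_of_top_le_span_of_card_eq_finrank h.ge (by simpa using hι),
    fun h => h.span_eq_top_of_card_eq_finrank' (by simpa using hι)⟩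

/-- Transversality becomes linear independence of N rows in ℂ^N, which persists under small
perturbation. -/
theorem transversal_iff_linearIndependent (hn : d + n = N) (b : Fin d → Fin N → ℂ) :
    (∀ u, (∀ j, b j ⬝ᵥ u = 0) → π u = 0 → u = 0) ↔
      LinearIndependent ℂ (Sum.elim b fun i k => π (Pi.single k 1) i) := by
  have h1 : (∀ u, (∀ j, b j ⬝ᵥ u = 0) → π u = 0 → u = 0) ↔
      ∀ u, (∀ s, (Sum.elim b fun i k => π (Pi.single k 1) i) s ⬝ᵥ u = 0) → u = 0 := by
    refine forall_congr' fun u => ?_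
    rw [Sum.forall]
    simp only [Sum.elim_inl, Sum.elim_inr, ← clm_apply_eq_dot, and_imp]
    constructor
    · intro h h2 h3; exact h h2 (funext h3)
    · intro h h2 h3; exact h h2 (fun i => congrFun h3 i)
  rw [h1, ← span_eq_top_iff_dotProduct]
  exact span_eq_top_iff_linearIndependent (by simpa using hn) _

theorem eventually_transversal {α : Type*} {l : Filter α} {b : α → Fin d → Fin N → ℂ}
    {b₀ : Fin d → Fin N → ℂ} (hn : d + n = N) (hb : Tendsto b l (𝓝 b₀))
    (hπ : ∀ u, (∀ j, b₀ j ⬝ᵥ u = 0) → π u = 0 → u = 0) :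
    ∀ᶠ a in l, ∀ u, (∀ j, b a j ⬝ᵥ u = 0) → π u = 0 → u = 0 := by
  rw [transversal_iff_linearIndependent hn] at hπ
  have h1 : Tendsto (fun a => (Sum.elim (b a) fun i k => π (Pi.single k 1) i :
      Fin d ⊕ Fin n → Fin N → ℂ)) l (𝓝 (Sum.elim b₀ fun i k => π (Pi.single k 1) i)) := by
    refine tendsto_pi_nhds.2 ?_
    rintro (j | i)
    · exact tendsto_pi_nhds.1 hb j
    · exact tendsto_const_nhds
  filter_upwards [h1.eventually (isOpen_setOfPred_linearIndependent.mem_nhds hπ)] with a ha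
  exact (transversal_iff_linearIndependent hn _).2 ha

theorem IsDefiningAt.eventually_transversal (h : IsDefiningAt M ρ p) (hn : d + n = N)
    (hπ : ∀ u, (∀ j, star (gradZ (ρ j) p) ⬝ᵥ u = 0) → π u = 0 → u = 0) :
    ∀ᶠ q in 𝓝 p, ∀ u, (∀ j, star (gradZ (ρ j) q) ⬝ᵥ u = 0) → π u = 0 → u = 0 := by
  obtain ⟨R, hR⟩ := h.exists_complexification
  refine CRGeom.eventually_transversal (b := fun q j => star (gradZ (ρ j) q)) hn
    (tendsto_pi_nhds.2 fun j => tendsto_pi_nhds.2 fun k => ?_) hπ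
  have c1 : ContinuousAt (fun x => fderiv ℂ (R j) x (0, Pi.single k 1)) (p, star p) :=
    (hR j).analyticAt.fderiv.continuousAt.clm_apply continuousAt_const
  have c2 : Continuous (fun q : Fin N → ℂ => (q, star q)) := by fun_prop
  have c3 := c1.tendsto.comp (c2.tendsto p)
  rw [← (hR j).star_gradZ_eq] at c3
  refine c3.congr' ?_
  filter_upwards [(hR j).eventually] with q hq
  exact (hq.star_gradZ_eq k).symm

theorem analyticAt_vecFun (hR : ∀ j, IsComplexificationAt (ρ j) (R j) p) :
    AnalyticAt ℂ (vecFun R) (p, star p) := AnalyticAt.pi fun j => (hR j).analyticAt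

theorem fderiv_vecFun {x : (Fin N → ℂ) × (Fin N → ℂ)} (hR : ∀ j, DifferentiableAt ℂ (R j) x)
    (w : (Fin N → ℂ) × (Fin N → ℂ)) (j : Fin d) :
    fderiv ℂ (vecFun R) x w j = fderiv ℂ (R j) x w := by
  have : fderiv ℂ (vecFun R) x = ContinuousLinearMap.pi fun j => fderiv ℂ (R j) x :=
    fderiv_pi hR
  rw [this]; rfl

/-- Near `(p, p̄)` the map `(Z, ζ) ↦ (Z, R (Z, ζ), π ζ)` has an analytic inverse. -/
theorem exists_inverse_of_transversal (hn : d + n = N)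
    (hR : ∀ j, IsComplexificationAt (ρ j) (R j) p)
    (hπ : ∀ u, (∀ j, star (gradZ (ρ j) p) ⬝ᵥ u = 0) → π u = 0 → u = 0) :
    ∃ g : (Fin N → ℂ) × (Fin d → ℂ) × (Fin n → ℂ) → (Fin N → ℂ) × (Fin N → ℂ),
      AnalyticAt ℂ g (p, vecFun R (p, star p), π (star p)) ∧
      g (p, vecFun R (p, star p), π (star p)) = (p, star p) ∧
      (∀ᶠ x in 𝓝 (p, star p), g (x.1, vecFun R x, π x.2) = x) ∧
      ∀ᶠ y in 𝓝 (p, vecFun R (p, star p), π (star p)),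
        ((g y).1, vecFun R (g y), π (g y).2) = y := by
  have ha := analyticAt_vecFun hR
  refine exists_analytic_inverse (f := fun x : (Fin N → ℂ) × (Fin N → ℂ) =>
    (x.1, vecFun R x, π x.2)) (a := (p, star p)) ?_ ?_ ?_
  · simp only [Module.finrank_prod, Module.finrank_fin_fun, hn]
  · exact analyticAt_fst.prod (ha.prod ((π.analyticAt _).comp analyticAt_snd))
  · intro v hv
    have hd : HasFDerivAt (fun x : (Fin N → ℂ) × (Fin N → ℂ) => (x.1, vecFun R x, π x.2))
        ((ContinuousLinearMap.fst ℂ _ _).prod ((fderiv ℂ (vecFun R) (p, star p)).prod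
          (π.comp (ContinuousLinearMap.snd ℂ _ _)))) (p, star p) :=
      hasFDerivAt_fst.prodMk (ha.differentiableAt.hasFDerivAt.prodMk
        (π.hasFDerivAt.comp _ hasFDerivAt_snd))
    rw [hd.fderiv] at hv
    have h1 : v.1 = 0 := congrArg Prod.fst hv
    have h2 : fderiv ℂ (vecFun R) (p, star p) v = 0 := congrArg (fun y => y.2.1) hv
    have h3 : π v.2 = 0 := congrArg (fun y => y.2.2) hv
    have h4 : v.2 = 0 := by
      refine hπ v.2 (fun j => ?_) h3
      have h5 := congrFun h2 j
      rw [fderiv_vecFun fun j => (hR j).analyticAt.differentiableAt] at h5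
      have h6 := (hR j).fderiv_apply v.1 v.2
      rw [Prod.mk.eta, h5, h1, dotProduct_zero, zero_add] at h6
      exact h6.symm
    exact Prod.ext h1 h4

theorem vecFun_eq_zero (h : IsDefiningAt M ρ p) (hp : p ∈ M)
    (hR : ∀ j, IsComplexificationAt (ρ j) (R j) p) : vecFun R (p, star p) = 0 := by
  ext j
  have h1 := (hR j).eq_on_diag.self_of_nhds
  rw [h.mem_iff.self_of_nhds.1 hp j] at h1
  simpa [vecFun] using h1

theorem eventually_vecFun_eq_zero (h : IsDefiningAt M ρ p)
    (hR : ∀ j, IsComplexificationAt (ρ j) (R j) p) :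
    ∀ᶠ Z in 𝓝[M] p, vecFun R (Z, star Z) = 0 := by
  have h1 : ∀ᶠ Z in 𝓝 p, ∀ j, IsComplexificationAt (ρ j) (R j) Z :=
    eventually_all.2 fun j => (hR j).eventually
  filter_upwards [nhdsWithin_le_nhds h1, nhdsWithin_le_nhds h.eventually, self_mem_nhdsWithin]
    with Z h2 h3 h4
  exact vecFun_eq_zero h3 h4 h2

/-- The equations R(Z,ζ) = 0, πζ = χ are solved for ζ by the inverse function theorem, with π
completing the conjugate gradients to a coordinate system. -/
theorem IsDefiningAt.exists_chart (h : IsDefiningAt M ρ p) (hp : p ∈ M) (hn : d + n = N) :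
    ∃ (π : (Fin N → ℂ) →L[ℂ] (Fin n → ℂ)) (θ : (Fin N → ℂ) × (Fin n → ℂ) → Fin N → ℂ),
      IsSegreChart M π θ p := by
  obtain ⟨R, hR⟩ := h.exists_complexification
  obtain ⟨c, hc⟩ := exists_complement_rows hn (linearIndependent_star h.generic)
  let π : (Fin N → ℂ) →L[ℂ] (Fin n → ℂ) :=
    LinearMap.toContinuousLinearMap (Matrix.mulVecLin (Matrix.of c))
  have hπ : ∀ u, (∀ j, star (gradZ (ρ j) p) ⬝ᵥ u = 0) → π u = 0 → u = 0 :=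
    fun u h1 h2 => hc u h1 fun i => congrFun h2 i
  obtain ⟨g, hga, hg0, hgl, hgr⟩ := exists_inverse_of_transversal hn hR hπ
  rw [vecFun_eq_zero h hp hR] at hga hg0 hgr
  let e : (Fin N → ℂ) × (Fin n → ℂ) → (Fin N → ℂ) × (Fin d → ℂ) × (Fin n → ℂ) :=
    fun x => (x.1, 0, x.2)
  have he : ∀ x, AnalyticAt ℂ e x := fun x =>
    analyticAt_fst.prod (analyticAt_const.prod analyticAt_snd)
  refine ⟨π, fun x => (g (e x)).2, ?_, ?_, ?_, ?_⟩
  · exact analyticAt_snd.comp (AnalyticAt.fun_comp (g := g) hga (he _))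
  · have := (he (realPt π p)).continuousAt.tendsto.eventually hgr
    filter_upwards [this] with x hx
    exact congrArg (fun y => y.2.2) hx
  · have h1 : ∀ᶠ Z in 𝓝[M] p, g (Z, vecFun R (Z, star Z), π (star Z)) = (Z, star Z) := by
      have c2 : Continuous (fun q : Fin N → ℂ => (q, star q)) := by fun_prop
      exact nhdsWithin_le_nhds ((c2.tendsto p).eventually hgl)
    filter_upwards [h1, eventually_vecFun_eq_zero h hR] with Z h2 h3
    rw [h3] at h2
    exact congrArg Prod.snd h2
  · filter_upwards [nhdsWithin_le_nhds h.eventually,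
      nhdsWithin_le_nhds (h.eventually_transversal hn hπ), self_mem_nhdsWithin] with q h1 h2 h3
    exact h1.uniqueDiffWithinAt h3 hn h2

/-! Consequences for an arbitrary defining function. -/

theorem IsSegreChart.fderiv_proj (hθ : IsSegreChart M π θ p) :
    ∀ᶠ x in 𝓝 (realPt π p), ∀ w, π (fderiv ℂ θ x w) = w.2 := by
  filter_upwards [eventually_eventually_nhds.2 hθ.proj, hθ.analyticAt.eventually_analyticAt]
    with x h1 h2 w
  have h3 : HasFDerivAt (fun x => π (θ x)) (π.comp (fderiv ℂ θ x)) x :=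
    π.hasFDerivAt.comp x h2.differentiableAt.hasFDerivAt
  have h4 : HasFDerivAt (fun x => π (θ x)) (ContinuousLinearMap.snd ℂ _ _) x :=
    hasFDerivAt_snd.congr_of_eventuallyEq h1
  exact DFunLike.congr_fun (h3.unique h4) w

theorem IsSegreChart.eventually_analyticAt_graph (hθ : IsSegreChart M π θ p) (hp : p ∈ M)
    {F : Type*} [NormedAddCommGroup F] [NormedSpace ℂ F] [CompleteSpace F]
    {H : (Fin N → ℂ) × (Fin N → ℂ) → F} (hH : AnalyticAt ℂ H (p, star p)) :
    ∀ᶠ x in 𝓝 (realPt π p), AnalyticAt ℂ H (graphMap θ x) := by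
  have h1 := hθ.analyticAt_graphMap.continuousAt.tendsto
  rw [hθ.graphMap_realPt hp] at h1
  exact h1.eventually hH.eventually_analyticAt

theorem IsSegreChart.fderiv_comp_graph {F : Type*} [NormedAddCommGroup F] [NormedSpace ℂ F]
    {H : (Fin N → ℂ) × (Fin N → ℂ) → F} {x : (Fin N → ℂ) × (Fin n → ℂ)}
    (h1 : DifferentiableAt ℂ θ x) (h2 : DifferentiableAt ℂ H (graphMap θ x))
    (w : (Fin N → ℂ) × (Fin n → ℂ)) :
    fderiv ℂ (fun x => H (graphMap θ x)) x w =
      fderiv ℂ H (graphMap θ x) (w.1, fderiv ℂ θ x w) := by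
  have h3 : HasFDerivAt (graphMap θ) ((ContinuousLinearMap.fst ℂ _ _).prod (fderiv ℂ θ x)) x :=
    hasFDerivAt_fst.prodMk h1.hasFDerivAt
  have h4 : HasFDerivAt (fun x => H (graphMap θ x)) _ x := h2.hasFDerivAt.comp x h3
  rw [h4.fderiv]; rfl

theorem IsSegreChart.vecFun_graph (hθ : IsSegreChart M π θ p) (hp : p ∈ M)
    (h : IsDefiningAt M ρ p) (hR : ∀ j, IsComplexificationAt (ρ j) (R j) p) :
    ∀ᶠ x in 𝓝 (realPt π p), vecFun R (graphMap θ x) = 0 :=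
  hθ.eventually_graphMap_eq_zero hp (analyticAt_vecFun hR) (eventually_vecFun_eq_zero h hR)

theorem IsSegreChart.fderiv_vecFun_graph (hθ : IsSegreChart M π θ p) (hp : p ∈ M)
    (h : IsDefiningAt M ρ p) (hR : ∀ j, IsComplexificationAt (ρ j) (R j) p) :
    ∀ᶠ x in 𝓝 (realPt π p), ∀ w,
      fderiv ℂ (vecFun R) (graphMap θ x) (w.1, fderiv ℂ θ x w) = 0 := by
  filter_upwards [eventually_eventually_nhds.2 (hθ.vecFun_graph hp h hR),
    hθ.analyticAt.eventually_analyticAt,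
    hθ.eventually_analyticAt_graph hp (analyticAt_vecFun hR)] with x h1 h2 h3 w
  rw [← IsSegreChart.fderiv_comp_graph h2.differentiableAt h3.differentiableAt]
  have : (fun x => vecFun R (graphMap θ x)) =ᶠ[𝓝 x] fun _ => 0 := h1
  rw [this.fderiv_eq]; simp

/-- The `ζ`-kernel of any complexified defining function is transversal to the chart projection. -/
theorem IsSegreChart.transversal (hθ : IsSegreChart M π θ p) (hp : p ∈ M) (hn : d + n = N)
    (h : IsDefiningAt M ρ p) :
    ∀ u, (∀ j, star (gradZ (ρ j) p) ⬝ᵥ u = 0) → π u = 0 → u = 0 := by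
  obtain ⟨R, hR⟩ := h.exists_complexification
  obtain ⟨c, hc⟩ := exists_complement_rows hn (linearIndependent_star h.generic)
  have h1 := (hθ.fderiv_vecFun_graph hp h hR).self_of_nhds
  have h2 := hθ.fderiv_proj.self_of_nhds
  have hK : ∀ y : Fin n → ℂ, ∀ j,
      star (gradZ (ρ j) p) ⬝ᵥ fderiv ℂ θ (realPt π p) (0, y) = 0 := by
    intro y j
    have h3 := congrFun (h1 (0, y)) j
    rw [hθ.graphMap_realPt hp, fderiv_vecFun fun j => (hR j).analyticAt.differentiableAt,
      (hR j).fderiv_apply] at h3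
    simpa using h3
  -- The vectors θ_χ y lie in the n-dimensional kernel of ρ_ζ, and y is recovered from them by π, so
  -- they fill that kernel. An element of the kernel killed by π is then θ_χ y with y = 0.
  let L : (Fin n → ℂ) →ₗ[ℂ] (Fin n → ℂ) :=
    (Matrix.mulVecLin (Matrix.of c)).comp ((fderiv ℂ θ (realPt π p)).toLinearMap.comp
      (LinearMap.inr ℂ _ _))
  have hL : Function.Injective L := by
    rw [injective_iff_map_eq_zero]
    intro y hy
    have h3 := hc _ (hK y) fun i => congrFun hy i
    have h4 := h2 (0, y)
    rw [h3, map_zero] at h4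
    exact h4.symm
  have hLs := LinearMap.injective_iff_surjective.1 hL
  intro u hu hπu
  obtain ⟨y, hy⟩ := hLs (Matrix.mulVec (Matrix.of c) u)
  have h3 : fderiv ℂ θ (realPt π p) (0, y) - u = 0 := by
    refine hc _ (fun j => ?_) fun i => ?_
    · rw [dotProduct_sub, hK, hu, sub_zero]
    · rw [dotProduct_sub, sub_eq_zero]
      exact congrFun hy i
  have h4 : u = fderiv ℂ θ (realPt π p) (0, y) := (sub_eq_zero.1 h3).symm
  have h5 : y = 0 := by
    have := h2 (0, y)
    rw [← h4, hπu] at this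
    exact this.symm
  rw [h4, h5]
  exact map_zero _

theorem IsSegreChart.eventually_transversal (hθ : IsSegreChart M π θ p) (hp : p ∈ M)
    (hn : d + n = N) (h : IsDefiningAt M ρ p) (hR : ∀ j, IsComplexificationAt (ρ j) (R j) p) :
    ∀ᶠ x in 𝓝 (realPt π p), ∀ u, fderiv ℂ (vecFun R) (graphMap θ x) (0, u) = 0 →
      π u = 0 → u = 0 := by
  have h1 := hθ.transversal hp hn h
  have hb : Tendsto (fun x j => (fun k => fderiv ℂ (R j) (graphMap θ x) (0, Pi.single k 1) :
      Fin N → ℂ)) (𝓝 (realPt π p)) (𝓝 fun j => star (gradZ (ρ j) p)) := by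
    refine tendsto_pi_nhds.2 fun j => tendsto_pi_nhds.2 fun k => ?_
    have c1 : ContinuousAt (fun x => fderiv ℂ (R j) x (0, Pi.single k 1)) (p, star p) :=
      (hR j).analyticAt.fderiv.continuousAt.clm_apply continuousAt_const
    have c2 := hθ.analyticAt_graphMap.continuousAt.tendsto
    rw [hθ.graphMap_realPt hp] at c2
    have c3 := c1.tendsto.comp c2
    rwa [← (hR j).star_gradZ_eq] at c3
  have h2 : ∀ᶠ x in 𝓝 (realPt π p), ∀ j, AnalyticAt ℂ (R j) (graphMap θ x) :=
    eventually_all.2 fun j => hθ.eventually_analyticAt_graph hp (hR j).analyticAt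
  filter_upwards [CRGeom.eventually_transversal hn hb h1, h2] with x h3 h4 u h5 h6
  refine h3 u (fun j => ?_) h6
  have h7 := congrFun h5 j
  rw [fderiv_vecFun fun j => (h4 j).differentiableAt, clm_prod_eq_dot] at h7
  simpa using h7

/-- Holomorphic tangency in terms of the chart. -/
theorem IsSegreChart.fderiv_eq_zero_iff (hθ : IsSegreChart M π θ p) (hp : p ∈ M)
    (hn : d + n = N) (h : IsDefiningAt M ρ p) (hR : ∀ j, IsComplexificationAt (ρ j) (R j) p) :
    ∀ᶠ x in 𝓝 (realPt π p), ∀ v,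
      fderiv ℂ θ x (v, 0) = 0 ↔ fderiv ℂ (vecFun R) (graphMap θ x) (v, 0) = 0 := by
  filter_upwards [hθ.eventually_transversal hp hn h hR, hθ.fderiv_proj,
    hθ.fderiv_vecFun_graph hp h hR] with x h1 h2 h3 v
  have h4 := h3 (v, 0)
  have e : ((v, fderiv ℂ θ x (v, 0)) : (Fin N → ℂ) × (Fin N → ℂ)) =
    (v, 0) + (0, fderiv ℂ θ x (v, 0)) := by simp
  rw [e, map_add] at h4
  constructor
  · intro h5
    rw [h5, ← Prod.zero_eq_mk, map_zero, add_zero] at h4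
    exact h4
  · intro h5
    rw [h5, zero_add] at h4
    exact h1 _ h4 (h2 (v, 0))

/-- Near `(p, p̄)` the complexification of `M` is the graph of `θ`. -/
theorem IsSegreChart.eq_of_vecFun_eq_zero (hθ : IsSegreChart M π θ p) (hp : p ∈ M)
    (hn : d + n = N) (h : IsDefiningAt M ρ p) (hR : ∀ j, IsComplexificationAt (ρ j) (R j) p) :
    ∀ᶠ x in 𝓝 (p, star p), vecFun R x = 0 → x.2 = θ (x.1, π x.2) := by
  obtain ⟨g, -, -, hgl, -⟩ := exists_inverse_of_transversal hn hR (hθ.transversal hp hn h)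
  have c1 : Tendsto (fun x : (Fin N → ℂ) × (Fin N → ℂ) => (x.1, π x.2)) (𝓝 (p, star p))
      (𝓝 (realPt π p)) := by
    have : Continuous (fun x : (Fin N → ℂ) × (Fin N → ℂ) => (x.1, π x.2)) := by fun_prop
    exact this.tendsto (p, star p)
  have c2 := hθ.analyticAt_graphMap.continuousAt.tendsto
  rw [hθ.graphMap_realPt hp] at c2
  -- x and the graph point over (x.1, π x.2) have the same coordinates (Z, R, πζ), hence the same
  -- image under the local inverse.
  filter_upwards [hgl, (c2.comp c1).eventually hgl, c1.eventually (hθ.vecFun_graph hp h hR),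
    c1.eventually hθ.proj] with x h1 h2 h3 h4 h5
  simp only [Function.comp] at h2
  rw [h3] at h2
  rw [h5] at h1
  simp only [graphMap] at h2
  rw [h4, h1] at h2
  exact congrArg Prod.snd h2

end ChartProperties

end CRGeom

/-! ### Order of vanishing in the second variable. -/

namespace CRGeom

section Vanishing

variable {N n : ℕ} {F G : Type*} [NormedAddCommGroup F] [NormedSpace ℂ F] [NormedAddCommGroup G]
  [NormedSpace ℂ G] {x₀ : (Fin N → ℂ) × (Fin n → ℂ)}

/-- Derivative along the vector field `b` in the second variable. -/
noncomputable def opX (b : (Fin N → ℂ) × (Fin n → ℂ) → Fin n → ℂ)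
    (g : (Fin N → ℂ) × (Fin n → ℂ) → F) : (Fin N → ℂ) × (Fin n → ℂ) → F :=
  fun x => fderiv ℂ g x (0, b x)

/-- Partial derivative in the second variable. -/
noncomputable def pd (i : Fin n) (g : (Fin N → ℂ) × (Fin n → ℂ) → F) :
    (Fin N → ℂ) × (Fin n → ℂ) → F := opX (fun _ => Pi.single i 1) g

theorem _root_.AnalyticAt.clmApply {E : Type*} [NormedAddCommGroup E] [NormedSpace ℂ E]
    {A : E → F →L[ℂ] G} {f : E → F} {x : E} (hA : AnalyticAt ℂ A x) (hf : AnalyticAt ℂ f x) :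
    AnalyticAt ℂ (fun y => A y (f y)) x :=
  AnalyticAt.fun_comp (g := fun z : (F →L[ℂ] G) × F => z.1 z.2)
    ((ContinuousLinearMap.id ℂ (F →L[ℂ] G)).analyticAt_bilinear _) (hA.prod hf)

theorem opX_congr {b : (Fin N → ℂ) × (Fin n → ℂ) → Fin n → ℂ}
    {f g : (Fin N → ℂ) × (Fin n → ℂ) → F} (h : f =ᶠ[𝓝 x₀] g) : opX b f =ᶠ[𝓝 x₀] opX b g := by
  filter_upwards [h.fderiv (𝕜 := ℂ)] with x hx
  rw [opX, opX, hx]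

theorem pd_congr {i : Fin n} {f g : (Fin N → ℂ) × (Fin n → ℂ) → F} (h : f =ᶠ[𝓝 x₀] g) :
    pd i f =ᶠ[𝓝 x₀] pd i g := opX_congr h

theorem analyticAt_opX [CompleteSpace F] {b : (Fin N → ℂ) × (Fin n → ℂ) → Fin n → ℂ}
    {g : (Fin N → ℂ) × (Fin n → ℂ) → F} (hb : AnalyticAt ℂ b x₀) (hg : AnalyticAt ℂ g x₀) :
    AnalyticAt ℂ (opX b g) x₀ :=
  hg.fderiv.clmApply (analyticAt_const.prod hb)

theorem analyticAt_pd [CompleteSpace F] {i : Fin n} {g : (Fin N → ℂ) × (Fin n → ℂ) → F}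
    (hg : AnalyticAt ℂ g x₀) : AnalyticAt ℂ (pd i g) x₀ := analyticAt_opX analyticAt_const hg

theorem pd_clm_apply [CompleteSpace F] [CompleteSpace G] {i : Fin n}
    {A : (Fin N → ℂ) × (Fin n → ℂ) → F →L[ℂ] G}
    {f : (Fin N → ℂ) × (Fin n → ℂ) → F} (hA : AnalyticAt ℂ A x₀) (hf : AnalyticAt ℂ f x₀) :
    pd i (fun x => A x (f x)) =ᶠ[𝓝 x₀] fun x => pd i A x (f x) + A x (pd i f x) := by
  filter_upwards [hA.eventually_analyticAt, hf.eventually_analyticAt] with x h1 h2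
  rw [pd, opX, fderiv_clm_apply h1.differentiableAt h2.differentiableAt]
  simp [pd, opX, add_comm]

theorem opX_clm [CompleteSpace F] (T : F →L[ℂ] G) {b : (Fin N → ℂ) × (Fin n → ℂ) → Fin n → ℂ}
    {f : (Fin N → ℂ) × (Fin n → ℂ) → F} (hf : AnalyticAt ℂ f x₀) :
    opX b (fun x => T (f x)) =ᶠ[𝓝 x₀] fun x => T (opX b f x) := by
  filter_upwards [hf.eventually_analyticAt] with x h2
  have : HasFDerivAt (fun x => T (f x)) (T.comp (fderiv ℂ f x)) x :=
    T.hasFDerivAt.comp x h2.differentiableAt.hasFDerivAt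
  rw [opX, this.fderiv]; rfl

theorem opX_eq_sum (b : (Fin N → ℂ) × (Fin n → ℂ) → Fin n → ℂ)
    (f : (Fin N → ℂ) × (Fin n → ℂ) → F) (x : (Fin N → ℂ) × (Fin n → ℂ)) :
    opX b f x = ∑ i, b x i • pd i f x := by
  have e : ((0, b x) : (Fin N → ℂ) × (Fin n → ℂ)) =
      ∑ i, b x i • ((0 : Fin N → ℂ), (Pi.single i 1 : Fin n → ℂ)) := by
    ext j <;> simp [Prod.fst_sum, Prod.snd_sum, Finset.sum_apply, Pi.single_apply]
  rw [opX, e, map_sum]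
  simp only [pd, opX, map_smul]

theorem pd_comm [CompleteSpace F] (i j : Fin n) {f : (Fin N → ℂ) × (Fin n → ℂ) → F}
    (hf : AnalyticAt ℂ f x₀) : pd i (pd j f) =ᶠ[𝓝 x₀] pd j (pd i f) := by
  filter_upwards [hf.eventually_analyticAt] with x hx
  have h1 : ∀ e e' : (Fin N → ℂ) × (Fin n → ℂ),
      fderiv ℂ (fun y => fderiv ℂ f y e) x e' = fderiv ℂ (fderiv ℂ f) x e' e := by
    intro e e'
    rw [fderiv_clm_apply hx.fderiv.differentiableAt (differentiableAt_const e)]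
    simp
  have h2 : IsSymmSndFDerivAt ℂ f x := (hx.contDiffAt (n := ω)).isSymmSndFDerivAt (by simp)
  change fderiv ℂ (fun y => fderiv ℂ f y (0, Pi.single j 1)) x (0, Pi.single i 1) =
    fderiv ℂ (fun y => fderiv ℂ f y (0, Pi.single i 1)) x (0, Pi.single j 1)
  rw [h1, h1]
  exact h2 _ _

/-- `f` vanishes to order `m` at `x` in the directions of the second variable. -/
def Van : ℕ → ((Fin N → ℂ) × (Fin n → ℂ) → F) → (Fin N → ℂ) × (Fin n → ℂ) → Prop
  | 0, _, _ => True
  | m + 1, f, x => f x = 0 ∧ ∀ i, Van m (pd i f) x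

theorem Van.congr {m : ℕ} {f g : (Fin N → ℂ) × (Fin n → ℂ) → F} (hf : Van m f x₀)
    (h : f =ᶠ[𝓝 x₀] g) : Van m g x₀ := by
  induction m generalizing f g with
  | zero => trivial
  | succ m ih => exact ⟨h.self_of_nhds ▸ hf.1, fun i => ih (hf.2 i) (pd_congr h)⟩

theorem Van.of_succ {m : ℕ} {f : (Fin N → ℂ) × (Fin n → ℂ) → F} (hf : Van (m + 1) f x₀) :
    Van m f x₀ := by
  induction m generalizing f with
  | zero => trivial
  | succ m ih => exact ⟨hf.1, fun i => ih (hf.2 i)⟩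

theorem Van.mono {m k : ℕ} (h : k ≤ m) {f : (Fin N → ℂ) × (Fin n → ℂ) → F} (hf : Van m f x₀) :
    Van k f x₀ := by
  induction h with
  | refl => exact hf
  | step _ ih => exact ih hf.of_succ

theorem Van.zero (m : ℕ) : Van m (fun _ => (0 : F)) x₀ := by
  induction m with
  | zero => trivial
  | succ m ih =>
    refine ⟨rfl, fun i => ?_⟩
    have : pd i (fun _ : (Fin N → ℂ) × (Fin n → ℂ) => (0 : F)) = fun _ => 0 := by
      ext x; simp [pd, opX]
    rwa [this]

theorem Van.add {m : ℕ} {f g : (Fin N → ℂ) × (Fin n → ℂ) → F} [CompleteSpace F]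
    (haf : AnalyticAt ℂ f x₀) (hag : AnalyticAt ℂ g x₀) (hf : Van m f x₀) (hg : Van m g x₀) :
    Van m (fun x => f x + g x) x₀ := by
  induction m generalizing f g with
  | zero => trivial
  | succ m ih =>
    refine ⟨by simp [hf.1, hg.1], fun i => ?_⟩
    refine (ih (analyticAt_pd haf) (analyticAt_pd hag) (hf.2 i) (hg.2 i)).congr ?_
    filter_upwards [haf.eventually_analyticAt, hag.eventually_analyticAt] with x h1 h2
    simp only [pd, opX]
    rw [fderiv_fun_add h1.differentiableAt h2.differentiableAt]; rfl

/-- Leibniz rule: a derivative falling on A leaves f untouched, and f then vanishes to more than the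
needed order. -/
theorem Van.clm_apply [CompleteSpace F] [CompleteSpace G] {m : ℕ}
    {A : (Fin N → ℂ) × (Fin n → ℂ) → F →L[ℂ] G} {f : (Fin N → ℂ) × (Fin n → ℂ) → F}
    (hA : AnalyticAt ℂ A x₀) (haf : AnalyticAt ℂ f x₀) (hf : Van m f x₀) :
    Van m (fun x => A x (f x)) x₀ := by
  induction m generalizing A f with
  | zero => trivial
  | succ m ih =>
    refine ⟨by simp [hf.1], fun i => ?_⟩
    refine Van.congr ?_ (pd_clm_apply hA haf).symm
    exact Van.add ((analyticAt_pd hA).clmApply haf) (hA.clmApply (analyticAt_pd haf))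
      (ih (analyticAt_pd hA) haf hf.of_succ) (ih hA (analyticAt_pd haf) (hf.2 i))

theorem Van.sum [CompleteSpace F] {m : ℕ} {ι : Type*} (s : Finset ι)
    {f : ι → (Fin N → ℂ) × (Fin n → ℂ) → F} (haf : ∀ i, AnalyticAt ℂ (f i) x₀)
    (hf : ∀ i, Van m (f i) x₀) : Van m (fun x => ∑ i ∈ s, f i x) x₀ := by
  classical
  induction s using Finset.induction_on with
  | empty => simpa using Van.zero m
  | insert a s ha ih =>
    simp only [Finset.sum_insert ha]
    exact Van.add (haf a) (Finset.analyticAt_fun_sum _ fun i _ => haf i) (hf a) ih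

theorem Van.smul [CompleteSpace F] {m : ℕ} {c : (Fin N → ℂ) × (Fin n → ℂ) → ℂ}
    {f : (Fin N → ℂ) × (Fin n → ℂ) → F} (hc : AnalyticAt ℂ c x₀) (haf : AnalyticAt ℂ f x₀)
    (hf : Van m f x₀) : Van m (fun x => c x • f x) x₀ :=
  Van.clm_apply (A := fun x => c x • ContinuousLinearMap.id ℂ F) (hc.smul analyticAt_const) haf hf

theorem Van.opX [CompleteSpace F] {m : ℕ} {b : (Fin N → ℂ) × (Fin n → ℂ) → Fin n → ℂ}
    {f : (Fin N → ℂ) × (Fin n → ℂ) → F} (hb : AnalyticAt ℂ b x₀) (haf : AnalyticAt ℂ f x₀)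
    (hf : Van (m + 1) f x₀) : Van m (opX b f) x₀ := by
  have e : CRGeom.opX b f = fun x => ∑ i, b x i • pd i f x := funext (opX_eq_sum b f)
  rw [e]
  have hbi : ∀ i, AnalyticAt ℂ (fun x => b x i) x₀ := analyticAt_pi_iff.1 hb
  exact Van.sum _ (fun i => (hbi i).smul (analyticAt_pd haf))
    fun i => Van.smul (hbi i) (analyticAt_pd haf) (hf.2 i)

/-- Cancelling an operator which is injective on `ker T`. -/
theorem Van.of_clm_apply [CompleteSpace F] [CompleteSpace G] {H : Type*} [NormedAddCommGroup H]
    [NormedSpace ℂ H] {m : ℕ}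
    {A : (Fin N → ℂ) × (Fin n → ℂ) → F →L[ℂ] G} {T : F →L[ℂ] H}
    {u : (Fin N → ℂ) × (Fin n → ℂ) → F}
    (hA : AnalyticAt ℂ A x₀) (hu : AnalyticAt ℂ u x₀) (hT : ∀ᶠ x in 𝓝 x₀, T (u x) = 0)
    (hinj : ∀ z, A x₀ z = 0 → T z = 0 → z = 0) (h : Van m (fun x => A x (u x)) x₀) :
    Van m u x₀ := by
  induction m generalizing u with
  | zero => trivial
  | succ m ih =>
    have hVu : Van m u x₀ := ih hu hT h.of_succ
    refine ⟨hinj _ h.1 hT.self_of_nhds, fun i => ih (analyticAt_pd hu) ?_ ?_⟩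
    · have h1 := opX_clm (b := fun _ => Pi.single i 1) T hu
      have h2 : (fun x => T (u x)) =ᶠ[𝓝 x₀] fun _ => 0 := hT
      filter_upwards [h1, opX_congr (b := fun _ => Pi.single i 1) h2] with x h3 h4
      rw [pd, ← h3, h4]; simp [CRGeom.opX]
    -- By the Leibniz rule A(∂_i u) = ∂_i(A u) - (∂_i A) u, and both terms on the right vanish to
    -- order m, so the induction hypothesis applies to ∂_i u.
    · have h1 : Van m (fun x => pd i A x (u x)) x₀ := Van.clm_apply (analyticAt_pd hA) hu hVu
      have h2 := Van.smul (c := fun _ => (-1 : ℂ)) analyticAt_const ((analyticAt_pd hA).clmApply hu)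
        h1
      have h3 := Van.add (analyticAt_pd (i := i) (hA.clmApply hu))
        (analyticAt_const.smul ((analyticAt_pd hA).clmApply hu)) (h.2 i) h2
      refine h3.congr ?_
      filter_upwards [pd_clm_apply (i := i) hA hu] with x hx
      rw [hx]; simp

/-- Ordered composition `op_1^{α_1} ⋯ op_n^{α_n}`. -/
def foldOp {Φ : Type*} (op : Fin n → Φ → Φ) (L : List (Fin n)) (α : Fin n → ℕ) (g : Φ) : Φ :=
  L.foldr (fun j g => (op j)^[α j] g) g

/-- Transports a correspondence of single operators to their ordered compositions; it carries CR
derivatives on M over to derivations on the complexification. -/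
theorem foldOp_rel {Φ Ψ : Type*} {op : Fin n → Φ → Φ} {op' : Fin n → Ψ → Ψ} {r : Φ → Ψ → Prop}
    (h : ∀ j f g, r f g → r (op j f) (op' j g)) (L : List (Fin n)) (α : Fin n → ℕ) {f : Φ} {g : Ψ}
    (hfg : r f g) : r (foldOp op L α f) (foldOp op' L α g) := by
  have hit : ∀ j m f g, r f g → r ((op j)^[m] f) ((op' j)^[m] g) := by
    intro j m
    induction m with
    | zero => intro f g h; exact h
    | succ m ih => intro f g h'; exact ih _ _ (h j _ _ h')
  induction L with
  | nil => exact hfg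
  | cons j L ih => exact hit j _ _ _ ih

/-- Every field in the composition costs one order of vanishing, whatever its analytic coefficients.
-/
theorem Van.foldOp [CompleteSpace F] {b : Fin n → (Fin N → ℂ) × (Fin n → ℂ) → Fin n → ℂ}
    (hb : ∀ j, AnalyticAt ℂ (b j) x₀) (L : List (Fin n)) (α : Fin n → ℕ) {m : ℕ}
    {g : (Fin N → ℂ) × (Fin n → ℂ) → F} (hg : AnalyticAt ℂ g x₀)
    (h : Van ((L.map α).sum + m) g x₀) :
    AnalyticAt ℂ (CRGeom.foldOp (fun j => CRGeom.opX (b j)) L α g) x₀ ∧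
      Van m (CRGeom.foldOp (fun j => CRGeom.opX (b j)) L α g) x₀ := by
  have hit : ∀ j k s (g : (Fin N → ℂ) × (Fin n → ℂ) → F), AnalyticAt ℂ g x₀ → Van (k + s) g x₀ →
      AnalyticAt ℂ ((CRGeom.opX (b j))^[k] g) x₀ ∧ Van s ((CRGeom.opX (b j))^[k] g) x₀ := by
    intro j k s
    induction k with
    | zero => intro g hg h; exact ⟨hg, by simpa using h⟩
    | succ k ih =>
      intro g hg h
      refine ih _ (analyticAt_opX (hb j) hg) (Van.opX (hb j) hg ?_)
      rwa [show k + 1 + s = k + s + 1 by ring] at h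
  induction L generalizing m with
  | nil => exact ⟨hg, by simpa [CRGeom.foldOp] using h⟩
  | cons j L ih =>
    have h' : Van ((L.map α).sum + (α j + m)) g x₀ := by
      rw [List.map_cons, List.sum_cons] at h
      rwa [show α j + (L.map α).sum + m = (L.map α).sum + (α j + m) by ring] at h
    obtain ⟨h1, h2⟩ := ih h'
    exact hit j _ _ _ h1 h2

theorem pd_foldOp [CompleteSpace F] (i : Fin n) (L : List (Fin n)) (α : Fin n → ℕ)
    {g : (Fin N → ℂ) × (Fin n → ℂ) → F} (hg : AnalyticAt ℂ g x₀) :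
    pd i (foldOp pd L α g) =ᶠ[𝓝 x₀] foldOp pd L α (pd i g) := by
  refine (foldOp_rel (op := pd) (op' := pd)
    (r := fun f g => AnalyticAt ℂ f x₀ ∧ pd i f =ᶠ[𝓝 x₀] g) ?_ L α
    (f := g) (g := pd i g) ⟨hg, EventuallyEq.rfl⟩).2
  rintro j f g ⟨h1, h2⟩
  exact ⟨analyticAt_pd h1, (pd_comm i j h1).trans (pd_congr h2)⟩

theorem foldOp_congr_index {Φ : Type*} {op : Fin n → Φ → Φ} {L : List (Fin n)} {α β : Fin n → ℕ}
    (h : ∀ j ∈ L, α j = β j) (g : Φ) : foldOp op L α g = foldOp op L β g := by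
  induction L with
  | nil => rfl
  | cons j L ih =>
    change (op j)^[α j] (foldOp op L α g) = (op j)^[β j] (foldOp op L β g)
    rw [ih fun k hk => h k (List.mem_cons_of_mem _ hk), h j List.mem_cons_self]

/-- Partial derivatives commute, so the additional one can be moved innermost; `Nodup` ensures that
the index i is met only once. -/
theorem foldOp_pd_succ [CompleteSpace F] (i : Fin n) {L : List (Fin n)} (hL : L.Nodup) (hi : i ∈ L)
    (α : Fin n → ℕ) {g : (Fin N → ℂ) × (Fin n → ℂ) → F} (hg : AnalyticAt ℂ g x₀) :
    foldOp pd L (α + Pi.single i 1) g =ᶠ[𝓝 x₀] foldOp pd L α (pd i g) := by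
  have hit : ∀ (j : Fin n) m (f g : (Fin N → ℂ) × (Fin n → ℂ) → F), f =ᶠ[𝓝 x₀] g →
      (pd j)^[m] f =ᶠ[𝓝 x₀] (pd j)^[m] g := by
    intro j m
    induction m with
    | zero => intro f g h; exact h
    | succ m ih => intro f g h; exact ih _ _ (pd_congr h)
  induction L with
  | nil => simp at hi
  | cons j L ih =>
    rw [List.nodup_cons] at hL
    change (pd j)^[(α + Pi.single i 1 : Fin n → ℕ) j] (foldOp pd L (α + Pi.single i 1) g) =ᶠ[𝓝 x₀]
      (pd j)^[α j] (foldOp pd L α (pd i g))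
    by_cases hij : j = i
    · subst hij
      have e : foldOp pd L (α + Pi.single j 1) g = foldOp pd L α g := by
        refine foldOp_congr_index (fun k hk => ?_) g
        have : k ≠ j := fun h => hL.1 (h ▸ hk)
        simp [this]
      rw [e, Pi.add_apply, Pi.single_eq_same, Function.iterate_add_apply, Function.iterate_one]
      exact hit _ _ _ _ (pd_foldOp j L α hg)
    · have hiL : i ∈ L := by
        rcases List.mem_cons.1 hi with h | h
        · exact absurd h.symm hij
        · exact h
      have e : (α + Pi.single i 1 : Fin n → ℕ) j = α j := by simp [hij]
      rw [e]
      exact hit _ _ _ _ (ih hL.2 hiL)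

theorem van_of_foldOp_pd [CompleteSpace F] {k : ℕ} {g : (Fin N → ℂ) × (Fin n → ℂ) → F}
    (hg : AnalyticAt ℂ g x₀)
    (h : ∀ α : Fin n → ℕ, ∑ i, α i ≤ k → foldOp pd (List.finRange n) α g x₀ = 0) :
    Van (k + 1) g x₀ := by
  have h0 : ∀ (L : List (Fin n)) (g : (Fin N → ℂ) × (Fin n → ℂ) → F), foldOp pd L 0 g = g := by
    intro L g
    induction L with
    | nil => rfl
    | cons j L ih => exact ih
  induction k generalizing g with
  | zero =>
    refine ⟨?_, fun i => trivial⟩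
    simpa [h0] using h 0 (by simp)
  | succ k ih =>
    refine ⟨by simpa [h0] using h 0 (by simp), fun i => ih (analyticAt_pd hg) fun α hα => ?_⟩
    rw [← (foldOp_pd_succ i (List.nodup_finRange n) (List.mem_finRange i) α hg).self_of_nhds]
    refine h _ ?_
    simp only [Pi.add_apply, Finset.sum_add_distrib, Finset.sum_pi_single', Finset.mem_univ,
      if_true]
    omega

end Vanishing

end CRGeom

/-! ### The vectors L^α ρ_Z expressed through the chart. -/

namespace CRGeom

section Levels

variable {N n d : ℕ} {M : Set (Fin N → ℂ)} {ρ : Fin d → (Fin N → ℂ) → ℝ} {p : Fin N → ℂ}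
  {π : (Fin N → ℂ) →L[ℂ] (Fin n → ℂ)} {θ : (Fin N → ℂ) × (Fin n → ℂ) → Fin N → ℂ}
  {R : Fin d → (Fin N → ℂ) × (Fin N → ℂ) → ℂ}

/-- The partial derivative in the first variable, as an operator. -/
noncomputable def zDeriv {F : Type*} [NormedAddCommGroup F] [NormedSpace ℂ F]
    (θ : (Fin N → ℂ) × (Fin n → ℂ) → F) (x : (Fin N → ℂ) × (Fin n → ℂ)) : (Fin N → ℂ) →L[ℂ] F :=
  (fderiv ℂ θ x).comp (ContinuousLinearMap.inl ℂ _ _)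

theorem analyticAt_comp_clm {E₁ E₂ E₃ E₄ : Type*} [NormedAddCommGroup E₁] [NormedSpace ℂ E₁]
    [NormedAddCommGroup E₂] [NormedSpace ℂ E₂] [NormedAddCommGroup E₃] [NormedSpace ℂ E₃]
    [NormedAddCommGroup E₄] [NormedSpace ℂ E₄] {A : E₁ → E₂ →L[ℂ] E₃} {x : E₁}
    (hA : AnalyticAt ℂ A x) (T : E₄ →L[ℂ] E₂) : AnalyticAt ℂ (fun y => (A y).comp T) x :=
  (((ContinuousLinearMap.compL ℂ E₄ E₂ E₃).flip T).analyticAt _).comp hA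

theorem analyticAt_zDeriv {F : Type*} [NormedAddCommGroup F] [NormedSpace ℂ F] [CompleteSpace F]
    {θ : (Fin N → ℂ) × (Fin n → ℂ) → F} {x : (Fin N → ℂ) × (Fin n → ℂ)} (h : AnalyticAt ℂ θ x) :
    AnalyticAt ℂ (zDeriv θ) x := analyticAt_comp_clm h.fderiv _

/-- The germ `g` on the complexification of `M` represents the function `h`. -/
def Represents (θ : (Fin N → ℂ) × (Fin n → ℂ) → Fin N → ℂ)
    (π : (Fin N → ℂ) →L[ℂ] (Fin n → ℂ)) (p : Fin N → ℂ) (h : (Fin N → ℂ) → ℂ)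
    (g : (Fin N → ℂ) × (Fin n → ℂ) → ℂ) : Prop :=
  ∃ H : (Fin N → ℂ) × (Fin N → ℂ) → ℂ, AnalyticAt ℂ H (p, star p) ∧
    (∀ᶠ Z in 𝓝 p, H (Z, star Z) = h Z) ∧ g =ᶠ[𝓝 (realPt π p)] fun x => H (graphMap θ x)

theorem Represents.apply_eq {h : (Fin N → ℂ) → ℂ} {g : (Fin N → ℂ) × (Fin n → ℂ) → ℂ}
    (hr : Represents θ π p h g) (hθ : IsSegreChart M π θ p) (hp : p ∈ M) :
    h p = g (realPt π p) := by
  obtain ⟨H, -, h2, h3⟩ := hr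
  rw [h3.self_of_nhds]
  change _ = H (graphMap θ (realPt π p))
  rw [hθ.graphMap_realPt hp, h2.self_of_nhds]

theorem Represents.analyticAt {h : (Fin N → ℂ) → ℂ} {g : (Fin N → ℂ) × (Fin n → ℂ) → ℂ}
    (hr : Represents θ π p h g) (hθ : IsSegreChart M π θ p) (hp : p ∈ M) :
    AnalyticAt ℂ g (realPt π p) := by
  obtain ⟨H, h1, -, h3⟩ := hr
  refine AnalyticAt.congr ?_ h3.symm
  refine AnalyticAt.fun_comp (g := H) ?_ hθ.analyticAt_graphMap
  rwa [hθ.graphMap_realPt hp]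

/-- ∂/∂Z̄_k complexifies to ∂/∂ζ_k. The hypothesis on b says that the complexified field is tangent
to the graph of θ, so differentiating along it commutes with restriction to the graph. -/
theorem Represents.crOp {h : (Fin N → ℂ) → ℂ} {g : (Fin N → ℂ) × (Fin n → ℂ) → ℂ}
    (hr : Represents θ π p h g) (hθ : IsSegreChart M π θ p) (hp : p ∈ M)
    {a : Fin N → (Fin N → ℂ) → ℂ} {A : (Fin N → ℂ) × (Fin N → ℂ) → Fin N → ℂ}
    {b : (Fin N → ℂ) × (Fin n → ℂ) → Fin n → ℂ} (hA : AnalyticAt ℂ A (p, star p))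
    (hAa : ∀ᶠ Z in 𝓝 p, ∀ k, A (Z, star Z) k = a k Z)
    (hAb : ∀ᶠ x in 𝓝 (realPt π p), A (graphMap θ x) = fderiv ℂ θ x (0, b x)) :
    Represents θ π p (crOp a h) (opX b g) := by
  obtain ⟨H, h1, h2, h3⟩ := hr
  refine ⟨fun x => fderiv ℂ H x (0, A x), h1.fderiv.clmApply (analyticAt_const.prod hA), ?_, ?_⟩
  · have hc : Tendsto (fun q : Fin N → ℂ => (q, star q)) (𝓝 p) (𝓝 (p, star p)) := by
      have : Continuous (fun q : Fin N → ℂ => (q, star q)) := by fun_prop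
      exact this.tendsto p
    filter_upwards [hAa, hc.eventually h1.eventually_analyticAt, eventually_eventually_nhds.2 h2]
      with Z h4 h5 h6
    rw [clm_prod_eq_dot, dotProduct_zero, zero_add, CRGeom.crOp, dotProduct]
    refine Finset.sum_congr rfl fun k _ => ?_
    rw [h4, dZbar_eq_of_complexification h5.differentiableAt h6, mul_comm]
  · filter_upwards [opX_congr (b := b) h3, hAb, hθ.analyticAt.eventually_analyticAt,
      hθ.eventually_analyticAt_graph hp h1] with x h4 h5 h6 h7
    rw [h4, opX, IsSegreChart.fderiv_comp_graph h6.differentiableAt h7.differentiableAt, h5]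

theorem represents_gradZ
    (hR : ∀ j, IsComplexificationAt (ρ j) (R j) p) (j : Fin d) (k : Fin N) :
    Represents θ π p (dZ k (toC (ρ j))) fun x => fderiv ℂ (R j) (graphMap θ x) (Pi.single k 1, 0) := by
  refine ⟨fun x => fderiv ℂ (R j) x (Pi.single k 1, 0),
    (hR j).analyticAt.fderiv.clmApply analyticAt_const, ?_, EventuallyEq.rfl⟩
  filter_upwards [(hR j).eventually] with Z hZ
  exact (hZ.gradZ_eq k).symm

/-- The vectors `V_{jα}` computed on the complexification. -/
theorem levVec_dotProduct (hθ : IsSegreChart M π θ p) (hp : p ∈ M)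
    (hR : ∀ j, IsComplexificationAt (ρ j) (R j) p)
    {a : Fin n → Fin N → (Fin N → ℂ) → ℂ} {A : Fin n → (Fin N → ℂ) × (Fin N → ℂ) → Fin N → ℂ}
    {b : Fin n → (Fin N → ℂ) × (Fin n → ℂ) → Fin n → ℂ} (hA : ∀ j, AnalyticAt ℂ (A j) (p, star p))
    (hAa : ∀ j, ∀ᶠ Z in 𝓝 p, ∀ k, A j (Z, star Z) k = a j k Z)
    (hAb : ∀ j, ∀ᶠ x in 𝓝 (realPt π p), A j (graphMap θ x) = fderiv ℂ θ x (0, b j x))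
    (hb : ∀ j, AnalyticAt ℂ (b j) (realPt π p)) (j : Fin d) (α : Fin n → ℕ) (v : Fin N → ℂ) :
    levVec (ρ j) a α p ⬝ᵥ v = foldOp (fun i => opX (b i)) (List.finRange n) α
      (fun x => fderiv ℂ (R j) (graphMap θ x) (v, 0)) (realPt π p) := by
  -- An operator-valued germ makes linearity in v survive the iterated derivations.
  let D : (Fin N → ℂ) × (Fin n → ℂ) → (Fin N → ℂ) →L[ℂ] ℂ := fun x =>
    (fderiv ℂ (R j) (graphMap θ x)).comp (ContinuousLinearMap.inl ℂ _ _)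
  have hgr : AnalyticAt ℂ (fderiv ℂ (R j)) (graphMap θ (realPt π p)) := by
    rw [hθ.graphMap_realPt hp]; exact (hR j).analyticAt.fderiv
  have hD : AnalyticAt ℂ D (realPt π p) :=
    analyticAt_comp_clm (AnalyticAt.fun_comp (g := fderiv ℂ (R j)) hgr hθ.analyticAt_graphMap) _
  set Ξ := foldOp (fun i => opX (b i)) (List.finRange n) α D (realPt π p) with hΞ
  have hfold : ∀ v, foldOp (fun i => opX (b i)) (List.finRange n) α (fun x => D x v)
      (realPt π p) = Ξ v := by
    intro v
    have := foldOp_rel (op := fun i => opX (F := (Fin N → ℂ) →L[ℂ] ℂ) (b i))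
      (op' := fun i => opX (F := ℂ) (b i))
      (r := fun f g => AnalyticAt ℂ f (realPt π p) ∧ (fun x => f x v) =ᶠ[𝓝 (realPt π p)] g) ?_
      (List.finRange n) α (f := D) (g := fun x => D x v) ⟨hD, EventuallyEq.rfl⟩
    · exact this.2.self_of_nhds.symm
    · rintro i f g ⟨h1, h2⟩
      refine ⟨analyticAt_opX (hb i) h1, ?_⟩
      exact (opX_clm (ContinuousLinearMap.apply ℂ ℂ v) h1).symm.trans (opX_congr h2)
  have hk : ∀ k, levVec (ρ j) a α p k = Ξ (Pi.single k 1) := by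
    intro k
    have h1 : Represents θ π p (crOpPow a α (dZ k (toC (ρ j))))
        (foldOp (fun i => opX (b i)) (List.finRange n) α fun x => D x (Pi.single k 1)) :=
      foldOp_rel (op := fun i => crOp (a i)) (op' := fun i => opX (F := ℂ) (b i))
        (fun i f g hfg => hfg.crOp hθ hp (hA i) (hAa i) (hAb i)) _ α
        (represents_gradZ hR j k)
    rw [levVec, h1.apply_eq hθ hp, hfold]
  change _ = foldOp (fun i => opX (b i)) (List.finRange n) α (fun x => D x v) (realPt π p)
  rw [hfold]
  conv_rhs => rw [← (Pi.basisFun ℂ (Fin N)).sum_repr v]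
  simp [dotProduct, hk, mul_comm]

/-- Differentiate R(Z,θ(Z,χ)) = 0 in Z. -/
theorem IsSegreChart.gradient_identity (hθ : IsSegreChart M π θ p) (hp : p ∈ M)
    (h : IsDefiningAt M ρ p) (hR : ∀ j, IsComplexificationAt (ρ j) (R j) p) (v : Fin N → ℂ) :
    ∀ᶠ x in 𝓝 (realPt π p), ∀ j, fderiv ℂ (R j) (graphMap θ x) (v, 0) =
      -fderiv ℂ (R j) (graphMap θ x) (0, zDeriv θ x v) := by
  have h2 : ∀ᶠ x in 𝓝 (realPt π p), ∀ j, AnalyticAt ℂ (R j) (graphMap θ x) :=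
    eventually_all.2 fun j => hθ.eventually_analyticAt_graph hp (hR j).analyticAt
  filter_upwards [hθ.fderiv_vecFun_graph hp h hR, h2] with x h3 h4 j
  have h5 := congrFun (h3 (v, 0)) j
  rw [fderiv_vecFun fun j => (h4 j).differentiableAt] at h5
  have e : ((v, fderiv ℂ θ x (v, 0)) : (Fin N → ℂ) × (Fin N → ℂ)) =
    (v, 0) + (0, fderiv ℂ θ x (v, 0)) := by simp
  rw [e, map_add] at h5
  exact eq_neg_of_add_eq_zero_left h5

/-- Tangency along M propagates to the graph, where A is killed by R_ζ. Then A - θ_χ(πA) lies in ker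
R_ζ ∩ ker π = 0, so b = πA. -/
theorem exists_cr_complexification (hθ : IsSegreChart M π θ p) (hp : p ∈ M) (hn : d + n = N)
    (h : IsDefiningAt M ρ p) {a : Fin N → (Fin N → ℂ) → ℂ}
    (ha : ∀ k, AnalyticAt ℝ (a k) p)
    (htan : ∀ᶠ Z in 𝓝[M] p, ∀ i, crOp a (toC (ρ i)) Z = 0) :
    ∃ (A : (Fin N → ℂ) × (Fin N → ℂ) → Fin N → ℂ) (b : (Fin N → ℂ) × (Fin n → ℂ) → Fin n → ℂ),
      AnalyticAt ℂ A (p, star p) ∧ (∀ᶠ Z in 𝓝 p, ∀ k, A (Z, star Z) k = a k Z) ∧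
      (∀ᶠ x in 𝓝 (realPt π p), A (graphMap θ x) = fderiv ℂ θ x (0, b x)) ∧
      AnalyticAt ℂ b (realPt π p) := by
  obtain ⟨R, hR⟩ := h.exists_complexification
  have ha' : AnalyticAt ℝ (fun Z k => a k Z) p := AnalyticAt.pi ha
  obtain ⟨A, hA, hAa⟩ := exists_complexification ha'
  have hAg : AnalyticAt ℂ (fun x => A (graphMap θ x)) (realPt π p) := by
    refine AnalyticAt.fun_comp (g := A) ?_ hθ.analyticAt_graphMap
    rwa [hθ.graphMap_realPt hp]
  refine ⟨A, fun x => π (A (graphMap θ x)), hA, ?_, ?_, (π.analyticAt _).comp hAg⟩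
  · filter_upwards [hAa] with Z hZ k
    rw [hZ]
  · have h1 : ∀ᶠ x in 𝓝 (realPt π p), fderiv ℂ (vecFun R) (graphMap θ x) (0, A (graphMap θ x)) = 0 := by
      refine hθ.eventually_graphMap_eq_zero hp
        (H := fun y => fderiv ℂ (vecFun R) y (0, A y))
        ((analyticAt_vecFun hR).fderiv.clmApply (analyticAt_const.prod hA)) ?_
      have h2 : ∀ᶠ Z in 𝓝 p, ∀ j, IsComplexificationAt (ρ j) (R j) Z :=
        eventually_all.2 fun j => (hR j).eventually
      filter_upwards [htan, nhdsWithin_le_nhds h2, nhdsWithin_le_nhds hAa] with Z h3 h4 h5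
      ext j
      rw [fderiv_vecFun fun j => (h4 j).analyticAt.differentiableAt, (h4 j).fderiv_apply, h5,
        dotProduct_zero, zero_add, Pi.zero_apply, ← h3 j, CRGeom.crOp, dotProduct]
      refine Finset.sum_congr rfl fun k _ => ?_
      rw [dZbar_toC _ _ (h4 j).differentiableAt, mul_comm]; rfl
    filter_upwards [h1, hθ.fderiv_vecFun_graph hp h hR, hθ.eventually_transversal hp hn h hR,
      hθ.fderiv_proj] with x h2 h3 h4 h5
    refine sub_eq_zero.1 (h4 _ ?_ ?_)
    · have h6 := h3 (0, π (A (graphMap θ x)))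
      have e : ((0, A (graphMap θ x) - fderiv ℂ θ x (0, π (A (graphMap θ x)))) :
          (Fin N → ℂ) × (Fin N → ℂ)) = (0, A (graphMap θ x)) -
          (0, fderiv ℂ θ x (0, π (A (graphMap θ x)))) := by simp
      rw [e, map_sub, h2, h6, sub_zero]
    · rw [map_sub, h5, sub_self]

end Levels

/-! ### k-nondegeneracy as a condition on the χ-derivatives of θ_Z. -/

section NondegenerateIff

variable {N d : ℕ} {M : Set (Fin N → ℂ)} {p : Fin N → ℂ}
  {π : (Fin N → ℂ) →L[ℂ] (Fin (N - d) → ℂ)} {θ : (Fin N → ℂ) × (Fin (N - d) → ℂ) → Fin N → ℂ}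

/-- V_{jα}·v is a composition of |α| derivations applied to -R_ζ θ_Z v, which vanishes to order k +
1. The argument accepts any defining function and any CR basis, so the choice in the definition is
harmless. -/
theorem IsSegreChart.eq_zero_of_van (hθ : IsSegreChart M π θ p) (hp : p ∈ M) (hd : d ≤ N) {k : ℕ}
    (h : IsNondegenerateAt d M k p) {v : Fin N → ℂ}
    (hv : Van (k + 1) (fun x => zDeriv θ x v) (realPt π p)) : v = 0 := by
  obtain ⟨ρ, a, hρ, ha, hspan⟩ := h
  have hn : d + (N - d) = N := by omega
  obtain ⟨R, hR⟩ := hρ.exists_complexification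
  have hex := fun j => exists_cr_complexification hθ hp hn hρ (ha.analyticAt j)
    (ha.tangent.mono fun Z hZ => hZ j)
  choose A b hA hAa hAb hb using hex
  have hset : {v : Fin N → ℂ | ∃ (j : Fin d) (α : Fin (N - d) → ℕ),
      ∑ i, α i ≤ k ∧ v = levVec (ρ j) a α p} =
      Set.range fun s : {s : Fin d × (Fin (N - d) → ℕ) // ∑ i, s.2 i ≤ k} =>
        levVec (ρ s.1.1) a s.1.2 p := by
    ext w
    constructor
    · rintro ⟨j, α, h1, rfl⟩; exact ⟨⟨(j, α), h1⟩, rfl⟩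
    · rintro ⟨⟨⟨j, α⟩, h1⟩, rfl⟩; exact ⟨j, α, h1, rfl⟩
  rw [hset] at hspan
  refine (span_eq_top_iff_dotProduct _).1 hspan v ?_
  rintro ⟨⟨j, α⟩, hα⟩
  rw [levVec_dotProduct hθ hp hR hA hAa hAb hb]
  have hgr : AnalyticAt ℂ (fderiv ℂ (R j)) (graphMap θ (realPt π p)) := by
    rw [hθ.graphMap_realPt hp]; exact (hR j).analyticAt.fderiv
  have hgr' := AnalyticAt.fun_comp (g := fderiv ℂ (R j)) hgr hθ.analyticAt_graphMap
  have hz : AnalyticAt ℂ (fun x => zDeriv θ x v) (realPt π p) :=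
    (analyticAt_zDeriv hθ.analyticAt).clmApply analyticAt_const
  have h1 : Van (k + 1) (fun x => fderiv ℂ (R j) (graphMap θ x) (v, 0)) (realPt π p) := by
    have h2 : Van (k + 1) (fun x => (-((fderiv ℂ (R j) (graphMap θ x)).comp
        (ContinuousLinearMap.inr ℂ _ _))) (zDeriv θ x v)) (realPt π p) :=
      Van.clm_apply (analyticAt_comp_clm hgr' _).neg hz hv
    refine h2.congr ?_
    filter_upwards [hθ.gradient_identity hp hρ hR v] with x hx
    rw [hx j]; rfl
  have h3 : ((List.finRange (N - d)).map α).sum = ∑ i, α i := (Fin.sum_univ_def α).symm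
  refine (Van.foldOp (m := 1) hb _ α (hgr'.clmApply analyticAt_const) ?_).2.1
  rw [h3]
  exact h1.mono (by dsimp only at hα; omega)

theorem IsSegreChart.isNondegenerateAt (hθ : IsSegreChart M π θ p) (hp : p ∈ M) (hd : d ≤ N)
    {ρ : Fin d → (Fin N → ℂ) → ℝ} (hρ : IsDefiningAt M ρ p) {k : ℕ}
    (h : ∀ v, Van (k + 1) (fun x => zDeriv θ x v) (realPt π p) → v = 0) :
    IsNondegenerateAt d M k p := by
  have hn : d + (N - d) = N := by omega
  obtain ⟨R, hR⟩ := hρ.exists_complexification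
  -- The CR basis adapted to the chart: its i-th field corresponds to ∂/∂χ_i.
  let a : Fin (N - d) → Fin N → (Fin N → ℂ) → ℂ := fun i l Z =>
    fderiv ℂ θ (realPt π Z) (0, Pi.single i 1) l
  let A : Fin (N - d) → (Fin N → ℂ) × (Fin N → ℂ) → Fin N → ℂ := fun i x =>
    fderiv ℂ θ (x.1, π x.2) (0, Pi.single i 1)
  let b : Fin (N - d) → (Fin N → ℂ) × (Fin (N - d) → ℂ) → Fin (N - d) → ℂ := fun i _ => Pi.single i 1
  have hpr : ∀ x, AnalyticAt ℂ (fun x : (Fin N → ℂ) × (Fin N → ℂ) => (x.1, π x.2)) x := fun x =>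
    analyticAt_fst.prod ((π.analyticAt _).comp analyticAt_snd)
  have hA : ∀ i, AnalyticAt ℂ (A i) (p, star p) := fun i =>
    (AnalyticAt.fun_comp (g := fderiv ℂ θ) (f := fun x : (Fin N → ℂ) × (Fin N → ℂ) => (x.1, π x.2))
      (x := (p, star p)) hθ.analyticAt.fderiv (hpr (p, star p))).clmApply
      analyticAt_const
  have hAa : ∀ i, ∀ᶠ Z in 𝓝 p, ∀ l, A i (Z, star Z) l = a i l Z :=
    fun i => Eventually.of_forall fun Z l => rfl
  have hAb : ∀ i, ∀ᶠ x in 𝓝 (realPt π p), A i (graphMap θ x) = fderiv ℂ θ x (0, b i x) := by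
    intro i
    filter_upwards [hθ.proj] with x hx
    simp only [A, graphMap, hx, b]
  have hb : ∀ i, AnalyticAt ℂ (b i) (realPt π p) := fun i => analyticAt_const
  refine ⟨ρ, a, hρ, ⟨fun i l => ?_, ?_, ?_⟩, ?_⟩
  · have h1 : AnalyticAt ℝ (fun Z => A i (diagL N Z)) p :=
      AnalyticAt.fun_comp (g := A i) ((hA i).restrictScalars (𝕜 := ℝ)) ((diagL N).analyticAt p)
    exact analyticAt_pi_iff.1 h1 l
  · have h2 : ∀ᶠ Z in 𝓝 p, ∀ j, IsComplexificationAt (ρ j) (R j) Z :=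
      eventually_all.2 fun j => (hR j).eventually
    filter_upwards [nhdsWithin_le_nhds h2, self_mem_nhdsWithin, hθ.eventually,
      nhdsWithin_le_nhds hρ.eventually] with Z h3 h4 h5 h6 i j
    have h7 := congrFun ((h5.fderiv_vecFun_graph h4 h6 h3).self_of_nhds (0, Pi.single i 1)) j
    rw [h5.graphMap_realPt h4, fderiv_vecFun fun j => (h3 j).analyticAt.differentiableAt,
      (h3 j).fderiv_apply, dotProduct_zero, zero_add, Pi.zero_apply] at h7
    rw [← h7, crOp, dotProduct]
    refine Finset.sum_congr rfl fun l _ => ?_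
    rw [dZbar_toC _ _ (h3 j).differentiableAt, mul_comm]; rfl
  · have h1 : LinearIndependent ℂ fun i : Fin (N - d) =>
        π (fderiv ℂ θ (realPt π p) (0, Pi.single i 1)) := by
      have h2 := hθ.fderiv_proj.self_of_nhds
      simp only [h2]
      exact Pi.linearIndependent_single_one (Fin (N - d)) ℂ
    exact LinearIndependent.of_comp π.toLinearMap h1
  · have hset : {v : Fin N → ℂ | ∃ (j : Fin d) (α : Fin (N - d) → ℕ),
        ∑ i, α i ≤ k ∧ v = levVec (ρ j) a α p} =
        Set.range fun s : {s : Fin d × (Fin (N - d) → ℕ) // ∑ i, s.2 i ≤ k} =>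
          levVec (ρ s.1.1) a s.1.2 p := by
      ext w
      constructor
      · rintro ⟨j, α, h1, rfl⟩; exact ⟨⟨(j, α), h1⟩, rfl⟩
      · rintro ⟨⟨⟨j, α⟩, h1⟩, rfl⟩; exact ⟨j, α, h1, rfl⟩
    rw [hset, span_eq_top_iff_dotProduct]
    intro v hv
    refine h v ?_
    have hgr : AnalyticAt ℂ (fderiv ℂ (vecFun R)) (graphMap θ (realPt π p)) := by
      rw [hθ.graphMap_realPt hp]; exact (analyticAt_vecFun hR).fderiv
    have hgr' := AnalyticAt.fun_comp (g := fderiv ℂ (vecFun R)) hgr hθ.analyticAt_graphMap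
    have hz : AnalyticAt ℂ (fun x => zDeriv θ x v) (realPt π p) :=
      (analyticAt_zDeriv hθ.analyticAt).clmApply analyticAt_const
    -- Vanishing of R_ζ θ_Z v passes to θ_Z v: πθ = χ forces π θ_Z v = 0, and R_ζ is injective on
    -- ker π.
    refine Van.of_clm_apply (T := π) (A := fun x => (fderiv ℂ (vecFun R) (graphMap θ x)).comp
      (ContinuousLinearMap.inr ℂ _ _)) (analyticAt_comp_clm hgr' _) hz ?_ ?_ ?_
    · filter_upwards [hθ.fderiv_proj] with x hx
      exact hx _
    · exact (hθ.eventually_transversal hp hn hρ hR).self_of_nhds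
    · have hgj : ∀ j, AnalyticAt ℂ (fun x => fderiv ℂ (R j) (graphMap θ x) (v, 0))
          (realPt π p) := by
        intro j
        have hgr : AnalyticAt ℂ (fderiv ℂ (R j)) (graphMap θ (realPt π p)) := by
          rw [hθ.graphMap_realPt hp]; exact (hR j).analyticAt.fderiv
        exact (AnalyticAt.fun_comp (g := fderiv ℂ (R j)) hgr
          hθ.analyticAt_graphMap).clmApply analyticAt_const
      have h1 : ∀ j, Van (k + 1) (fun x => fderiv ℂ (R j) (graphMap θ x) (v, 0))
          (realPt π p) := by
        intro j
        refine van_of_foldOp_pd (hgj j) fun α hα => ?_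
        exact (levVec_dotProduct hθ hp hR hA hAa hAb hb j α v).symm.trans (hv ⟨(j, α), hα⟩)
      have h2 : Van (k + 1) (fun x => ∑ j, fderiv ℂ (R j) (graphMap θ x) (v, 0) •
          (-(Pi.single j 1 : Fin d → ℂ))) (realPt π p) := by
        refine Van.sum _ (fun j => (hgj j).smul analyticAt_const) fun j => ?_
        exact Van.clm_apply (A := fun _ => (ContinuousLinearMap.id ℂ ℂ).smulRight
          (-(Pi.single j 1 : Fin d → ℂ))) analyticAt_const (hgj j) (h1 j)
      refine h2.congr ?_
      have h3 : ∀ᶠ x in 𝓝 (realPt π p), ∀ j, AnalyticAt ℂ (R j) (graphMap θ x) :=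
        eventually_all.2 fun j => hθ.eventually_analyticAt_graph hp (hR j).analyticAt
      filter_upwards [hθ.gradient_identity hp hρ hR v, h3] with x h4 h5
      ext j
      simp only [Finset.sum_apply, Pi.smul_apply, Pi.neg_apply, smul_eq_mul, h4]
      rw [Finset.sum_eq_single j (fun i _ hij => by simp [hij.symm]) (by simp)]
      rw [ContinuousLinearMap.comp_apply, fderiv_vecFun fun j => (h5 j).differentiableAt]
      simp

end NondegenerateIff

end CRGeom

/-! ### Rank of analytic families of row vectors. -/

namespace CRGeom

section Families

variable {N : ℕ} {ι : Type*}

/-- A square matrix whose rows are members of a family completed by constant rows. -/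
def frameMat {r : ℕ} (s : Fin r → ι) (c : Fin (N - r) → Fin N → ℂ) (e : Fin N ≃ Fin r ⊕ Fin (N - r))
    (u : ι → Fin N → ℂ) : Matrix (Fin N) (Fin N) ℂ :=
  Matrix.of fun k => Sum.elim (fun j => u (s j)) c (e k)

/-- The rank of a family of row vectors. -/
noncomputable def rowRank (u : ι → Fin N → ℂ) : ℕ :=
  Module.finrank ℂ (Submodule.span ℂ (Set.range u))

theorem rowRank_le (u : ι → Fin N → ℂ) : rowRank u ≤ N := by
  simpa [rowRank] using Submodule.finrank_le (Submodule.span ℂ (Set.range u))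

theorem rowRank_eq_iff (u : ι → Fin N → ℂ) :
    rowRank u = N ↔ ∀ v, (∀ i, u i ⬝ᵥ v = 0) → v = 0 := by
  rw [← span_eq_top_iff_dotProduct]
  constructor
  · intro h; exact Submodule.eq_top_of_finrank_eq (by simpa [rowRank] using h)
  · intro h; rw [rowRank, h]; simp

theorem det_ne_zero_iff_linearIndependent (A : Matrix (Fin N) (Fin N) ℂ) :
    A.det ≠ 0 ↔ LinearIndependent ℂ A.row := by
  rw [Matrix.linearIndependent_rows_iff_isUnit, Matrix.isUnit_iff_isUnit_det, isUnit_iff_ne_zero]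

/-- A basis of the span taken from the family is completed by constant rows. The determinant then
depends analytically on the family, and where it is nonzero the rank is at least r. -/
theorem exists_frame (u : ι → Fin N → ℂ) :
    ∃ (s : Fin (rowRank u) → ι) (c : Fin (N - rowRank u) → Fin N → ℂ)
      (e : Fin N ≃ Fin (rowRank u) ⊕ Fin (N - rowRank u)), (frameMat s c e u).det ≠ 0 := by
  have hr := rowRank_le u
  obtain ⟨f, hf, -, hli⟩ := Submodule.exists_fun_fin_finrank_span_eq ℂ (Set.range u)
  choose s hs using hf
  have hb : LinearIndependent ℂ fun j => u (s j) := by simpa only [hs] using hli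
  have hn : rowRank u + (N - rowRank u) = N := by omega
  obtain ⟨c, hc⟩ := exists_complement_rows (b := fun j : Fin (rowRank u) => u (s j)) hn hb
  let e : Fin N ≃ Fin (rowRank u) ⊕ Fin (N - rowRank u) := (finCongr hn.symm).trans finSumFinEquiv.symm
  refine ⟨s, c, e, ?_⟩
  rw [det_ne_zero_iff_linearIndependent]
  have h1 : LinearIndependent ℂ (Sum.elim (fun j : Fin (rowRank u) => u (s j)) c) := by
    refine (span_eq_top_iff_linearIndependent (by simpa using hn) _).1 ?_
    rw [span_eq_top_iff_dotProduct]
    intro v hv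
    exact hc v (fun j => hv (Sum.inl j)) fun j => hv (Sum.inr j)
  exact h1.comp e e.injective

variable {r : ℕ} {s : Fin r → ι} {c : Fin (N - r) → Fin N → ℂ} {e : Fin N ≃ Fin r ⊕ Fin (N - r)}

theorem linearIndependent_of_det_ne_zero {u : ι → Fin N → ℂ} (h : (frameMat s c e u).det ≠ 0) :
    LinearIndependent ℂ fun j => u (s j) := by
  rw [det_ne_zero_iff_linearIndependent] at h
  have h1 := h.comp (fun j => e.symm (Sum.inl j))
    (e.symm.injective.comp Sum.inl_injective)
  convert h1 using 2 with j
  change _ = Sum.elim (fun j => u (s j)) c (e (e.symm (Sum.inl j)))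
  rw [Equiv.apply_symm_apply]; rfl

theorem le_rowRank_of_det_ne_zero {u : ι → Fin N → ℂ} (h : (frameMat s c e u).det ≠ 0) :
    r ≤ rowRank u := by
  have h1 := finrank_span_eq_card (linearIndependent_of_det_ne_zero h)
  rw [Fintype.card_fin] at h1
  rw [← h1]
  refine Submodule.finrank_mono (Submodule.span_mono ?_)
  rintro _ ⟨j, rfl⟩
  exact ⟨s j, rfl⟩

theorem dotProduct_eq_zero_of_det_ne_zero {u : ι → Fin N → ℂ} (h : (frameMat s c e u).det ≠ 0)
    (hr : rowRank u ≤ r) {v : Fin N → ℂ} (hv : ∀ j, u (s j) ⬝ᵥ v = 0) (i : ι) : u i ⬝ᵥ v = 0 := by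
  have h1 := finrank_span_eq_card (linearIndependent_of_det_ne_zero h)
  rw [Fintype.card_fin] at h1
  have h2 : Submodule.span ℂ (Set.range fun j => u (s j)) = Submodule.span ℂ (Set.range u) := by
    refine Submodule.eq_of_le_of_finrank_le (Submodule.span_mono ?_) (by rw [h1]; exact hr)
    rintro _ ⟨j, rfl⟩
    exact ⟨s j, rfl⟩
  have h3 : u i ∈ Submodule.span ℂ (Set.range fun j => u (s j)) := by
    rw [h2]; exact Submodule.subset_span ⟨i, rfl⟩
  generalize u i = y at h3
  induction h3 using Submodule.span_induction with
  | mem x hx => obtain ⟨j, rfl⟩ := hx; exact hv j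
  | zero => simp
  | add x y _ _ hx hy => rw [add_dotProduct, hx, hy, add_zero]
  | smul a x _ hx => rw [smul_dotProduct, hx, smul_zero]

variable {E : Type*} [NormedAddCommGroup E] [NormedSpace ℂ E]

theorem analyticAt_det {A : E → Matrix (Fin N) (Fin N) ℂ} {x : E}
    (hA : ∀ i j, AnalyticAt ℂ (fun y => A y i j) x) : AnalyticAt ℂ (fun y => (A y).det) x := by
  simp only [Matrix.det_apply']
  exact Finset.analyticAt_fun_sum _ fun σ _ => analyticAt_const.mul
    (Finset.analyticAt_fun_prod _ fun i _ => hA _ _)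

theorem analyticAt_frameMat {w : ι → E → Fin N → ℂ} {x : E} (hw : ∀ i, AnalyticAt ℂ (w i) x)
    (k l : Fin N) : AnalyticAt ℂ (fun y => frameMat s c e (fun i => w i y) k l) x := by
  simp only [frameMat, Matrix.of_apply]
  rcases e k with j | j
  · exact analyticAt_pi_iff.1 (hw (s j)) l
  · exact analyticAt_const

theorem analyticAt_adjugate {A : E → Matrix (Fin N) (Fin N) ℂ} {x : E}
    (hA : ∀ i j, AnalyticAt ℂ (fun y => A y i j) x) (i j : Fin N) :
    AnalyticAt ℂ (fun y => (A y).adjugate i j) x := by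
  simp only [Matrix.adjugate_apply]
  refine analyticAt_det fun k l => ?_
  simp only [Matrix.updateRow_apply]
  split_ifs
  · exact analyticAt_const
  · exact hA k l

theorem eventually_rowRank_le {w : ι → E → Fin N → ℂ} {x : E}
    (hw : ∀ i, AnalyticAt ℂ (w i) x) :
    ∀ᶠ y in 𝓝 x, rowRank (fun i => w i x) ≤ rowRank fun i => w i y := by
  obtain ⟨s, c, e, h⟩ := exists_frame fun i => w i x
  have h1 := (analyticAt_det (analyticAt_frameMat (s := s) (c := c) (e := e) hw)).continuousAt
  filter_upwards [h1.eventually_ne h] with y hy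
  exact le_rowRank_of_det_ne_zero hy

/-- A kernel vector at a point of maximal rank extends to an analytic kernel field. -/
theorem exists_kernel_field {w : ι → E → Fin N → ℂ} {U : Set E} (hU : IsOpen U)
    (hUc : IsPreconnected U) (hw : ∀ i, AnalyticOnNhd ℂ (w i) U) {x₁ : E} (hx₁ : x₁ ∈ U)
    (hmax : ∀ x ∈ U, rowRank (fun i => w i x) ≤ rowRank fun i => w i x₁)
    {v : Fin N → ℂ} (hv : ∀ i, w i x₁ ⬝ᵥ v = 0) :
    ∃ a : E → Fin N → ℂ, AnalyticOnNhd ℂ a U ∧ a x₁ = v ∧ ∀ x ∈ U, ∀ i, w i x ⬝ᵥ a x = 0 := by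
  obtain ⟨s, c, e, h⟩ := exists_frame fun i => w i x₁
  let Λ : E → Matrix (Fin N) (Fin N) ℂ := fun x => frameMat s c e fun i => w i x
  have hΛ : ∀ x ∈ U, ∀ k l, AnalyticAt ℂ (fun y => Λ y k l) x := fun x hx k l =>
    analyticAt_frameMat (fun i => hw i x hx) k l
  -- Cramer's rule with the adjugate instead of the inverse: no division by det Λ(x), so the field
  -- is analytic on all of U. The constant factor normalizes it to v at x₁.
  let a : E → Fin N → ℂ := fun x =>
    ((Λ x₁).det)⁻¹ • Matrix.mulVec (Λ x).adjugate (Matrix.mulVec (Λ x₁) v)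
  have ha : AnalyticOnNhd ℂ a U := by
    intro x hx
    have hm : AnalyticAt ℂ (fun y => Matrix.mulVec (Λ y).adjugate (Matrix.mulVec (Λ x₁) v)) x := by
      refine analyticAt_pi_iff.2 fun k => ?_
      simp only [Matrix.mulVec, dotProduct]
      exact Finset.analyticAt_fun_sum _ fun l _ => (analyticAt_adjugate (hΛ x hx) k l).fun_mul
        analyticAt_const
    exact analyticAt_const.fun_smul hm
  have hΛa : ∀ x, Matrix.mulVec (Λ x) (a x) =
      (((Λ x₁).det)⁻¹ * (Λ x).det) • Matrix.mulVec (Λ x₁) v := by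
    intro x
    simp only [a]
    rw [Matrix.mulVec_smul, Matrix.mulVec_mulVec, Matrix.mul_adjugate, Matrix.smul_mulVec,
      Matrix.one_mulVec, smul_smul]
  refine ⟨a, ha, ?_, ?_⟩
  · simp only [a]
    rw [Matrix.mulVec_mulVec, Matrix.adjugate_mul, Matrix.smul_mulVec, Matrix.one_mulVec, smul_smul,
      inv_mul_cancel₀ h, one_smul]
  · have hsa : ∀ x j, w (s j) x ⬝ᵥ a x = 0 := by
      intro x j
      have h1 := congrFun (hΛa x) (e.symm (Sum.inl j))
      have h2 : Matrix.mulVec (Λ x₁) v (e.symm (Sum.inl j)) = 0 := by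
        simp [Λ, frameMat, Matrix.mulVec, hv]
      rw [Pi.smul_apply, h2, smul_zero] at h1
      simpa [Λ, frameMat, Matrix.mulVec] using h1
    intro x hx i
    have hwa : AnalyticOnNhd ℂ (fun x => w i x ⬝ᵥ a x) U := by
      intro y hy
      exact Finset.analyticAt_fun_sum _ fun l _ => (analyticAt_pi_iff.1 (hw i y hy) l).mul
        (analyticAt_pi_iff.1 (ha y hy) l)
    -- Near x₁ the determinant is nonzero and maximality of the rank lets the selected rows span all
    -- rows; the identity theorem extends the vanishing to U.
    refine hwa.eqOn_zero_of_preconnected_of_eventuallyEq_zero hUc hx₁ ?_ hx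
    filter_upwards [(analyticAt_det (hΛ x₁ hx₁)).continuousAt.eventually_ne h, hU.mem_nhds hx₁]
      with y h1 h2
    exact dotProduct_eq_zero_of_det_ne_zero h1 (hmax y h2) (hsa y) i

end Families

end CRGeom

/-! ### Isolated fibres of holomorphic families. -/

namespace CRGeom

section Fibres

variable {N : ℕ} {ι : Type*} {f : ι → (Fin N → ℂ) → ℂ}

/-- The holomorphic gradients of a family of functions. -/
noncomputable def grads (f : ι → (Fin N → ℂ) → ℂ) (i : ι) (x : Fin N → ℂ) : Fin N → ℂ :=
  fun k => fderiv ℂ (f i) x (Pi.single k 1)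

theorem fderiv_eq_grads_dot (i : ι) (x v : Fin N → ℂ) :
    fderiv ℂ (f i) x v = grads f i x ⬝ᵥ v := by
  conv_lhs => rw [← (Pi.basisFun ℂ (Fin N)).sum_repr v]
  simp [dotProduct, grads, mul_comm]

theorem analyticAt_grads {i : ι} {x : Fin N → ℂ} (h : AnalyticAt ℂ (f i) x) :
    AnalyticAt ℂ (grads f i) x := by
  refine analyticAt_pi_iff.2 fun k => ?_
  exact h.fderiv.clmApply analyticAt_const

/-- At a point of locally maximal rank `< N` the fibre contains a nonconstant analytic curve. -/
theorem exists_curve_in_fibre {r : ℕ} (hr : r < N) {s : Fin r → ι} {c : Fin (N - r) → Fin N → ℂ}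
    {e : Fin N ≃ Fin r ⊕ Fin (N - r)} {z : Fin N → ℂ}
    (hf : ∀ᶠ x in 𝓝 z, ∀ i, AnalyticAt ℂ (f i) x)
    (hrank : ∀ᶠ x in 𝓝 z, rowRank (fun i => grads f i x) ≤ r)
    (hdet : (frameMat s c e fun i => grads f i z).det ≠ 0) :
    ∃ γ : ℂ → Fin N → ℂ, AnalyticAt ℂ γ 0 ∧ γ 0 = z ∧ (∀ᶠ t in 𝓝 0, ∀ i, f i (γ t) = f i z) ∧
      ¬ ∀ᶠ t in 𝓝 0, γ t = z := by
  have hfz := hf.self_of_nhds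
  -- Local coordinates: r selected functions of the family, completed by linear forms.
  let Φ : (Fin N → ℂ) → Fin N → ℂ := fun x k => Sum.elim (fun j => f (s j) x) (fun j => c j ⬝ᵥ x) (e k)
  have hdot : ∀ (u x : Fin N → ℂ), AnalyticAt ℂ (fun x : Fin N → ℂ => u ⬝ᵥ x) x := fun u x =>
    Finset.analyticAt_fun_sum _ fun l _ => analyticAt_const.fun_mul
      ((ContinuousLinearMap.proj (R := ℂ) (φ := fun _ : Fin N => ℂ) l).analyticAt x)
  have hΦk : ∀ k, AnalyticAt ℂ (fun x => Φ x k) z := by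
    intro k
    simp only [Φ]
    rcases e k with j | j
    · exact hfz (s j)
    · exact hdot _ _
  have hΦ : AnalyticAt ℂ Φ z := analyticAt_pi_iff.2 hΦk
  have hdd : ∀ u v : Fin N → ℂ, fderiv ℂ (fun x : Fin N → ℂ => u ⬝ᵥ x) z v = u ⬝ᵥ v := by
    intro u v
    let T : (Fin N → ℂ) →L[ℂ] ℂ := LinearMap.toContinuousLinearMap
      { toFun := fun x => u ⬝ᵥ x
        map_add' := fun x y => dotProduct_add _ _ _
        map_smul' := fun a x => dotProduct_smul _ _ _ }
    exact DFunLike.congr_fun (T.hasFDerivAt (x := z)).fderiv v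
  have hΦ' : ∀ v, fderiv ℂ Φ z v = Matrix.mulVec (frameMat s c e fun i => grads f i z) v := by
    intro v
    ext k
    have e1 : fderiv ℂ Φ z v k = fderiv ℂ (fun x => Φ x k) z v := by
      have : fderiv ℂ Φ z = ContinuousLinearMap.pi fun k => fderiv ℂ (fun x => Φ x k) z :=
        fderiv_pi fun k => (hΦk k).differentiableAt
      rw [this]; rfl
    rw [e1]
    simp only [Φ, Matrix.mulVec, frameMat, Matrix.of_apply]
    rcases e k with j | j
    · exact fderiv_eq_grads_dot (f := f) (s j) z v
    · exact hdd _ _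
  obtain ⟨g, hga, hg0, -, hgr⟩ := exists_analytic_inverse rfl hΦ fun v hv => by
    rw [hΦ'] at hv
    exact Matrix.eq_zero_of_mulVec_eq_zero hdet hv
  -- One of the linear-form coordinates, available since r < N; moving along it keeps the selected
  -- functions constant.
  let k₀ : Fin N := e.symm (Sum.inr ⟨0, by omega⟩)
  let L : ℂ → Fin N → ℂ := fun t => Φ z + t • Pi.single k₀ 1
  have hL : ∀ t, AnalyticAt ℂ L t := fun t => by simp only [L]; fun_prop
  have hL0 : L 0 = Φ z := by simp [L]
  let γ : ℂ → Fin N → ℂ := fun t => g (L t)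
  have hγ : AnalyticAt ℂ γ 0 := AnalyticAt.fun_comp (g := g) (hL0.symm ▸ hga) (hL 0)
  have hγ0 : γ 0 = z := by simp only [γ, hL0, hg0]
  have hγt : Tendsto γ (𝓝 0) (𝓝 z) := by
    have := hγ.continuousAt.tendsto
    rwa [hγ0] at this
  have hLt : Tendsto L (𝓝 0) (𝓝 (Φ z)) := by
    have := (hL 0).continuousAt.tendsto
    rwa [hL0] at this
  have hΦγ : ∀ᶠ t in 𝓝 (0 : ℂ), Φ (γ t) = L t := hLt.eventually hgr
  refine ⟨γ, hγ, hγ0, ?_, ?_⟩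
  · have hdet' : ∀ᶠ x in 𝓝 z, (frameMat s c e fun i => grads f i x).det ≠ 0 := by
      have hc : ContinuousAt (fun x => (frameMat s c e fun i => grads f i x).det) z := by
        have := (analyticAt_det (analyticAt_frameMat (w := fun i x => grads f (s i) x)
          (s := id) (c := c) (e := e) (x := z) fun i => analyticAt_grads (hfz (s i)))).continuousAt
        exact this
      exact hc.eventually_ne hdet
    have hall := (hγt.eventually (hf.and (hrank.and hdet'))).and
      (hγ.eventually_analyticAt.and (eventually_eventually_nhds.2 hΦγ))
    obtain ⟨τ, hτ, hball⟩ := Metric.eventually_nhds_iff_ball.1 hall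
    refine Metric.eventually_nhds_iff_ball.2 ⟨τ, hτ, fun t ht i => ?_⟩
    have hd : ∀ i, ∀ t ∈ Metric.ball (0 : ℂ) τ, HasDerivAt (fun t => f i (γ t))
        (grads f i (γ t) ⬝ᵥ deriv γ t) t := by
      intro i t ht
      obtain ⟨⟨h1, -, -⟩, h2, -⟩ := hball t ht
      rw [← fderiv_eq_grads_dot]
      exact (h1 i).differentiableAt.hasFDerivAt.comp_hasDerivAt t h2.differentiableAt.hasDerivAt
    -- The selected gradients annihilate γ', and by the rank bound they span all the gradients.
    have hzero : ∀ t ∈ Metric.ball (0 : ℂ) τ, ∀ i, grads f i (γ t) ⬝ᵥ deriv γ t = 0 := by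
      intro t ht
      obtain ⟨⟨-, h1, h2⟩, -, h3⟩ := hball t ht
      refine fun i => dotProduct_eq_zero_of_det_ne_zero h2 h1 (fun j => ?_) i
      refine (hd (s j) t ht).unique ?_
      refine (hasDerivAt_const t (f (s j) z)).congr_of_eventuallyEq ?_
      filter_upwards [h3] with t' h4
      have h5 := congrFun h4 (e.symm (Sum.inl j))
      have h6 : e.symm (Sum.inl j) ≠ k₀ := by
        simp [k₀]
      simpa [Φ, L, h6] using h5
    have h7 := Metric.isOpen_ball.is_const_of_deriv_eq_zero
      (Metric.isPreconnected_ball (x := (0 : ℂ)) (r := τ)) (f := fun t => f i (γ t))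
      (fun t ht => (hd i t ht).differentiableAt.differentiableWithinAt)
      (fun t ht => by rw [(hd i t ht).deriv, hzero t ht i]; rfl) ht (Metric.mem_ball_self hτ)
    simpa only [hγ0] using h7
  · intro hcon
    have h1 : ∀ᶠ t in 𝓝 (0 : ℂ), t = 0 := by
      filter_upwards [hΦγ, hcon] with t h2 h3
      rw [h3] at h2
      have h4 := congrFun h2 k₀
      simpa [L] using h4
    have h2 : (𝓝[≠] (0 : ℂ)).NeBot := inferInstance
    obtain ⟨t, h3, h4⟩ := ((h1.filter_mono nhdsWithin_le_nhds).and
      (self_mem_nhdsWithin (s := {(0 : ℂ)}ᶜ))).exists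
    exact h4 h3

/-- If a family of holomorphic functions has an isolated common fibre through `p`, then its
differentials are jointly injective at some nearby point. -/
theorem exists_injective_of_isolated_fibre {p : Fin N → ℂ} {δ : ℝ} (hδ : 0 < δ)
    (hf : ∀ x ∈ Metric.ball p (2 * δ), ∀ i, AnalyticAt ℂ (f i) x)
    (hiso : ∀ Z ∈ Metric.closedBall p δ, (∀ i, f i Z = f i p) → Z = p) :
    ∃ q ∈ Metric.ball p δ, ∀ v, (∀ i, fderiv ℂ (f i) q v = 0) → v = 0 := by
  by_contra hcon
  push Not at hcon
  have hsub : Metric.closedBall p δ ⊆ Metric.ball p (2 * δ) :=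
    Metric.closedBall_subset_ball (by linarith)
  have hrlt : ∀ q ∈ Metric.ball p δ, rowRank (fun i => grads f i q) < N := by
    intro q hq
    refine lt_of_le_of_ne (rowRank_le _) fun h => ?_
    obtain ⟨v, hv, hv0⟩ := hcon q hq
    exact hv0 ((rowRank_eq_iff _).1 h v fun i => by rw [← fderiv_eq_grads_dot]; exact hv i)
  -- The points of the ball whose fibre avoids the sphere. W is open, contains p, and a fibre
  -- through a point of W is compact in the open ball.
  let W : Set (Fin N → ℂ) := {q | q ∈ Metric.ball p δ ∧ ∀ Z ∈ Metric.sphere p δ, ∃ i, f i Z ≠ f i q}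
  have hpW : p ∈ W := by
    refine ⟨Metric.mem_ball_self hδ, fun Z hZ => ?_⟩
    by_contra hno
    push Not at hno
    have := hiso Z (Metric.sphere_subset_closedBall hZ) hno
    rw [this, Metric.mem_sphere, dist_self] at hZ
    exact hδ.ne hZ
  have hWopen : ∀ z ∈ W, W ∈ 𝓝 z := by
    intro z hz
    have h1 : ∀ᶠ q in 𝓝 z, ∀ Z ∈ Metric.sphere p δ, ∃ i, f i Z ≠ f i q := by
      refine (isCompact_sphere p δ).eventually_forall_of_forall_eventually fun Z hZ => ?_
      obtain ⟨i, hi⟩ := hz.2 Z hZ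
      have c1 : ContinuousAt (fun y : (Fin N → ℂ) × (Fin N → ℂ) => f i y.2) (z, Z) :=
        ContinuousAt.comp (g := f i) (f := Prod.snd) (x := (z, Z))
          (hf Z (hsub (Metric.sphere_subset_closedBall hZ)) i).continuousAt continuousAt_snd
      have c2 : ContinuousAt (fun y : (Fin N → ℂ) × (Fin N → ℂ) => f i y.1) (z, Z) :=
        ContinuousAt.comp (g := f i) (f := Prod.fst) (x := (z, Z))
          (hf z (hsub (Metric.ball_subset_closedBall hz.1)) i).continuousAt continuousAt_fst
      filter_upwards [(c1.sub c2).eventually_ne (sub_ne_zero.2 hi)] with y hy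
      exact ⟨i, sub_ne_zero.1 hy⟩
    filter_upwards [h1, Metric.isOpen_ball.mem_nhds hz.1] with q h2 h3
    exact ⟨h3, h2⟩
  obtain ⟨x₁, hx₁, hmax⟩ : ∃ x₁ ∈ W, ∀ x ∈ W,
      rowRank (fun i => grads f i x) ≤ rowRank fun i => grads f i x₁ := by
    let S : Set ℕ := (fun x => rowRank fun i => grads f i x) '' W
    have hSb : BddAbove S := ⟨N, by rintro _ ⟨x, -, rfl⟩; exact rowRank_le _⟩
    obtain ⟨x₁, h1, h2⟩ := Nat.sSup_mem (s := S) ⟨_, p, hpW, rfl⟩ hSb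
    refine ⟨x₁, h1, fun x hx => ?_⟩
    have h3 := le_csSup hSb (Set.mem_image_of_mem _ hx)
    dsimp only at h2 h3
    rwa [← h2] at h3
  have hr := hrlt x₁ hx₁.1
  obtain ⟨s, c, e, hdet⟩ := exists_frame fun i => grads f i x₁
  let Δ : (Fin N → ℂ) → ℂ := fun x => (frameMat s c e fun i => grads f i x).det
  have hΔ : ∀ x ∈ Metric.closedBall p δ, AnalyticAt ℂ Δ x := fun x hx =>
    analyticAt_det (analyticAt_frameMat (w := fun i x => grads f i x)
      fun i => analyticAt_grads (hf x (hsub hx) i))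
  let K : Set (Fin N → ℂ) := {Z | Z ∈ Metric.closedBall p δ ∧ ∀ i, f i Z = f i x₁}
  have hKc : IsCompact K := by
    have h1 : K = Metric.closedBall p δ ∩ ⋂ i, {Z | Z ∈ Metric.closedBall p δ ∧ f i Z = f i x₁} := by
      ext Z
      simp only [K, Set.mem_inter_iff, Set.mem_iInter, Set.mem_ofPred_eq]
      constructor
      · rintro ⟨h1, h2⟩; exact ⟨h1, fun i => ⟨h1, h2 i⟩⟩
      · rintro ⟨h1, h2⟩; exact ⟨h1, fun i => (h2 i).2⟩
    rw [h1]
    refine (isCompact_closedBall p δ).inter_right (isClosed_iInter fun i => ?_)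
    have hc : ContinuousOn (f i) (Metric.closedBall p δ) := fun x hx =>
      (hf x (hsub hx) i).continuousAt.continuousWithinAt
    exact hc.preimage_isClosed_of_isClosed Metric.isClosed_closedBall isClosed_singleton
  have hx₁K : x₁ ∈ K := ⟨Metric.ball_subset_closedBall hx₁.1, fun i => rfl⟩
  have hKW : K ⊆ W := by
    intro Z hZ
    have h1 : Z ∉ Metric.sphere p δ := fun h => by
      obtain ⟨i, hi⟩ := hx₁.2 Z h
      exact hi (hZ.2 i)
    refine ⟨lt_of_le_of_ne hZ.1 h1, fun Y hY => ?_⟩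
    obtain ⟨i, hi⟩ := hx₁.2 Y hY
    exact ⟨i, by rw [hZ.2 i]; exact hi⟩
  have hΔc : ContinuousOn (fun Z => ‖Δ Z‖) K := fun x hx =>
    (hΔ x hx.1).continuousAt.norm.continuousWithinAt
  obtain ⟨z₀, hz₀, hz₀max⟩ := hKc.exists_isMaxOn ⟨x₁, hx₁K⟩ hΔc
  have hmpos : 0 < ‖Δ z₀‖ := (norm_pos_iff.2 hdet).trans_le (isMaxOn_iff.1 hz₀max x₁ hx₁K)
  -- On K' the frame determinant is nonzero and of maximal modulus on the fibre K. A curve in the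
  -- fibre through a point of K' keeps it constant by the maximum principle, so it stays in K'.
  let K' : Set (Fin N → ℂ) := {Z | Z ∈ K ∧ ‖Δ Z‖ = ‖Δ z₀‖}
  have hK'c : IsCompact K' := by
    have : IsClosed K' := hΔc.preimage_isClosed_of_isClosed hKc.isClosed isClosed_singleton
    exact hKc.of_isClosed_subset this fun Z hZ => hZ.1
  -- The Euclidean norm is strictly convex, unlike the sup norm, so a local maximum of it along a
  -- holomorphic curve makes the curve itself constant.
  obtain ⟨z, hz, hzmax⟩ := hK'c.exists_isMaxOn (f := fun Z => ‖WithLp.toLp 2 Z‖) ⟨z₀, hz₀, rfl⟩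
    (by
      have : Continuous fun Z : Fin N → ℂ => ‖WithLp.toLp 2 Z‖ := by fun_prop
      exact this.continuousOn)
  have hzW := hKW hz.1
  have hzdet : Δ z ≠ 0 := by
    rw [← norm_pos_iff, hz.2]; exact hmpos
  obtain ⟨γ, hγ, hγ0, hγf, hγn⟩ := exists_curve_in_fibre (f := f) hr (s := s) (c := c) (e := e)
    (z := z) (by
      filter_upwards [Metric.isOpen_ball.mem_nhds (hsub hz.1.1)] with x hx
      exact hf x hx) (by
      filter_upwards [hWopen z hzW] with x hx
      exact hmax x hx) hzdet
  have hγt : Tendsto γ (𝓝 0) (𝓝 z) := by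
    have := hγ.continuousAt.tendsto
    rwa [hγ0] at this
  have hγK : ∀ᶠ t in 𝓝 (0 : ℂ), γ t ∈ K := by
    filter_upwards [hγt.eventually (hWopen z hzW), hγf] with t h1 h2
    exact ⟨Metric.ball_subset_closedBall h1.1, fun i => by rw [h2 i, hz.1.2 i]⟩
  have hγK' : ∀ᶠ t in 𝓝 (0 : ℂ), γ t ∈ K' := by
    have hd : ∀ᶠ t in 𝓝 (0 : ℂ), DifferentiableAt ℂ (fun t => Δ (γ t)) t := by
      have : AnalyticAt ℂ (fun t => Δ (γ t)) 0 :=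
        AnalyticAt.fun_comp (g := Δ) (hγ0.symm ▸ hΔ z hz.1.1) hγ
      exact this.eventually_analyticAt.mono fun t ht => ht.differentiableAt
    have hm : IsLocalMax (norm ∘ fun t => Δ (γ t)) 0 := by
      filter_upwards [hγK] with t ht
      change ‖Δ (γ t)‖ ≤ ‖Δ (γ 0)‖
      rw [hγ0, hz.2]
      exact hz₀max ht
    filter_upwards [hγK, Complex.eventually_eq_of_isLocalMax_norm hd hm] with t h1 h2
    refine ⟨h1, ?_⟩
    rw [h2, hγ0, hz.2]
  apply hγn
  have hd : ∀ᶠ t in 𝓝 (0 : ℂ), DifferentiableAt ℂ (fun t => WithLp.toLp 2 (γ t)) t := by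
    filter_upwards [hγ.eventually_analyticAt] with t ht
    exact ((PiLp.continuousLinearEquiv 2 ℂ fun _ : Fin N => ℂ).symm.differentiableAt).comp t
      ht.differentiableAt
  have hm : IsLocalMax (norm ∘ fun t => WithLp.toLp 2 (γ t)) 0 := by
    filter_upwards [hγK'] with t ht
    change ‖WithLp.toLp 2 (γ t)‖ ≤ ‖WithLp.toLp 2 (γ 0)‖
    rw [hγ0]
    exact hzmax ht
  filter_upwards [Complex.eventually_eq_of_isLocalMax_norm hd hm] with t ht
  rw [← hγ0]
  exact WithLp.toLp_injective 2 ht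

end Fibres

end CRGeom

/-! ### Finite nondegeneracy through the Segre family Z ↦ θ(Z,χ). -/

namespace CRGeom

section FiniteNondegeneracy

variable {N n : ℕ} {F : Type*} [NormedAddCommGroup F] [NormedSpace ℂ F]

/-- Iterated partial derivatives in the second variable along a word. -/
noncomputable def pdw (w : List (Fin n)) (f : (Fin N → ℂ) × (Fin n → ℂ) → F) :
    (Fin N → ℂ) × (Fin n → ℂ) → F := w.foldl (fun g i => pd i g) f

theorem pdw_append_singleton (w : List (Fin n)) (i : Fin n)
    (f : (Fin N → ℂ) × (Fin n → ℂ) → F) : pdw (w ++ [i]) f = pd i (pdw w f) := by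
  simp [pdw]

theorem van_iff_pdw {m : ℕ} {f : (Fin N → ℂ) × (Fin n → ℂ) → F} {x : (Fin N → ℂ) × (Fin n → ℂ)} :
    Van m f x ↔ ∀ w : List (Fin n), w.length < m → pdw w f x = 0 := by
  induction m generalizing f with
  | zero => simp [Van]
  | succ m ih =>
    simp only [Van, ih]
    constructor
    · rintro ⟨h1, h2⟩ (_ | ⟨i, w⟩) hw
      · exact h1
      · exact h2 i w (by simpa using hw)
    · intro h
      exact ⟨h [] (by simp), fun i w hw => h (i :: w) (by simpa using hw)⟩

theorem analyticAt_pdw [CompleteSpace F] (w : List (Fin n)) {f : (Fin N → ℂ) × (Fin n → ℂ) → F}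
    {x : (Fin N → ℂ) × (Fin n → ℂ)} (hf : AnalyticAt ℂ f x) : AnalyticAt ℂ (pdw w f) x := by
  induction w generalizing f with
  | nil => exact hf
  | cons i w ih => exact ih (analyticAt_pd hf)

theorem pdw_congr (w : List (Fin n)) {f g : (Fin N → ℂ) × (Fin n → ℂ) → F}
    {x : (Fin N → ℂ) × (Fin n → ℂ)} (h : f =ᶠ[𝓝 x] g) : pdw w f =ᶠ[𝓝 x] pdw w g := by
  induction w generalizing f g with
  | nil => exact h
  | cons i w ih => exact ih (pd_congr h)

theorem pdw_apply [CompleteSpace F] (w : List (Fin n))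
    {D : (Fin N → ℂ) × (Fin n → ℂ) → (Fin N → ℂ) →L[ℂ] F}
    {x : (Fin N → ℂ) × (Fin n → ℂ)} (hD : AnalyticAt ℂ D x) (v : Fin N → ℂ) :
    pdw w (fun y => D y v) =ᶠ[𝓝 x] fun y => pdw w D y v := by
  induction w generalizing D with
  | nil => rfl
  | cons i w ih =>
    have h1 : pd i (fun y => D y v) =ᶠ[𝓝 x] fun y => pd i D y v :=
      opX_clm (ContinuousLinearMap.apply ℂ F v) hD
    exact (pdw_congr w h1).trans (ih (analyticAt_pd hD))

/-- Vanishing to infinite order along the second variable is local vanishing. -/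
theorem forall_van_iff [CompleteSpace F] {f : (Fin N → ℂ) × (Fin n → ℂ) → F}
    {Z : Fin N → ℂ} {χ : Fin n → ℂ} (hf : AnalyticAt ℂ f (Z, χ)) :
    (∀ m, Van m f (Z, χ)) ↔ ∀ᶠ χ' in 𝓝 χ, f (Z, χ') = 0 := by
  have hc : Tendsto (fun χ' : Fin n → ℂ => (Z, χ')) (𝓝 χ) (𝓝 (Z, χ)) :=
    (Continuous.prodMk_right Z).tendsto χ
  have hsl : ∀ {g : (Fin N → ℂ) × (Fin n → ℂ) → F} {χ' : Fin n → ℂ}, DifferentiableAt ℂ g (Z, χ') →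
      HasFDerivAt (fun χ => g (Z, χ)) ((fderiv ℂ g (Z, χ')).comp (ContinuousLinearMap.inr ℂ _ _)) χ' :=
    fun h => h.hasFDerivAt.comp _ (hasFDerivAt_prodMk_right Z _)
  constructor
  · intro h
    refine eventually_eq_zero_of_fderiv_closed (S := {φ | ∃ g : (Fin N → ℂ) × (Fin n → ℂ) → F,
      AnalyticAt ℂ g (Z, χ) ∧ (∀ m, Van m g (Z, χ)) ∧ φ =ᶠ[𝓝 χ] fun χ' => g (Z, χ')}) ?_
      (f := fun χ' => f (Z, χ')) ⟨f, hf, h, EventuallyEq.rfl⟩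
    rintro φ ⟨g, hg, hV, hφ⟩
    have hs : AnalyticAt ℂ (fun χ' : Fin n → ℂ => (Z, χ')) χ := analyticAt_const.prod analyticAt_id
    refine ⟨(AnalyticAt.fun_comp (g := g) hg hs).congr hφ.symm, ?_, fun e => ?_⟩
    · rw [hφ.self_of_nhds]; exact (hV 1).1
    · refine ⟨opX (fun _ => e) g, analyticAt_opX analyticAt_const hg,
        fun m => Van.opX analyticAt_const hg (hV (m + 1)), ?_⟩
      filter_upwards [hφ.fderiv (𝕜 := ℂ), hc.eventually hg.eventually_analyticAt] with χ' h1 h2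
      rw [h1, (hsl h2.differentiableAt).fderiv]; rfl
  · intro h m
    induction m generalizing f with
    | zero => trivial
    | succ m ih =>
      refine ⟨h.self_of_nhds, fun i => ih (analyticAt_pd hf) ?_⟩
      have h1 : (fun χ' => f (Z, χ')) =ᶠ[𝓝 χ] fun _ => 0 := h
      filter_upwards [h1.fderiv (𝕜 := ℂ), hc.eventually hf.eventually_analyticAt] with χ' h2 h3
      rw [(hsl h3.differentiableAt).fderiv] at h2
      have := DFunLike.congr_fun h2 (Pi.single i 1)
      simpa [pd, opX] using this

end FiniteNondegeneracy

section Good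

variable {N d : ℕ} {M : Set (Fin N → ℂ)} {p : Fin N → ℂ}
  {π : (Fin N → ℂ) →L[ℂ] (Fin (N - d) → ℂ)} {θ : (Fin N → ℂ) × (Fin (N - d) → ℂ) → Fin N → ℂ}

/-- `M` is `k`-nondegenerate at `p` for some `k`. -/
def FinitelyNondegenerateAt (d : ℕ) (M : Set (Fin N → ℂ)) (p : Fin N → ℂ) : Prop :=
  ∃ k, IsNondegenerateAt d M k p

/-- The vectors surviving to order m form decreasing subspaces of ℂ^N. These stabilize, so a single
finite order detects the vectors that survive every order. -/
theorem IsSegreChart.finitelyNondegenerateAt_iff_van (hθ : IsSegreChart M π θ p) (hp : p ∈ M)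
    (hd : d ≤ N) (hM : IsGenericSubmanifold d M) :
    FinitelyNondegenerateAt d M p ↔
      ∀ v, (∀ m, Van m (fun x => zDeriv θ x v) (realPt π p)) → v = 0 := by
  constructor
  · rintro ⟨k, hk⟩ v hv
    exact hθ.eq_zero_of_van hp hd hk (hv _)
  · intro h
    have hD : ∀ v, AnalyticAt ℂ (fun x => zDeriv θ x v) (realPt π p) := fun v =>
      (analyticAt_zDeriv hθ.analyticAt).clmApply analyticAt_const
    let K : ℕ → Submodule ℂ (Fin N → ℂ) := fun m =>
      { carrier := {v | Van m (fun x => zDeriv θ x v) (realPt π p)}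
        add_mem' := fun {u v} hu hv => by
          have := Van.add (hD u) (hD v) hu hv
          simpa only [Set.mem_ofPred_eq, map_add] using this
        zero_mem' := by
          have := Van.zero (x₀ := realPt π p) (F := Fin N → ℂ) m
          simpa only [Set.mem_ofPred_eq, map_zero] using this
        smul_mem' := fun c v hv => by
          have := Van.smul (c := fun _ => c) analyticAt_const (hD v) hv
          simpa only [Set.mem_ofPred_eq, map_smul] using this }
    let Km : ℕ →o (Submodule ℂ (Fin N → ℂ))ᵒᵈ :=
      ⟨K, fun a b hab v hv => Van.mono hab hv⟩
    obtain ⟨m, hm⟩ := IsArtinian.monotone_stabilizes Km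
    obtain ⟨ρ, hρ⟩ := hM p hp
    refine ⟨m, hθ.isNondegenerateAt hp hd hρ fun v hv => h v fun k => ?_⟩
    have h1 : K m = K (max m k) := hm _ (le_max_left _ _)
    have h2 : v ∈ K (max m k) := h1 ▸ hv.of_succ
    exact Van.mono (le_max_right _ _) h2

theorem IsSegreChart.finitelyNondegenerateAt_iff (hθ : IsSegreChart M π θ p) (hp : p ∈ M)
    (hd : d ≤ N) (hM : IsGenericSubmanifold d M) :
    FinitelyNondegenerateAt d M p ↔
      ∀ v, (∀ᶠ χ in 𝓝 (π (star p)), zDeriv θ (p, χ) v = 0) → v = 0 := by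
  rw [hθ.finitelyNondegenerateAt_iff_van hp hd hM]
  refine forall_congr' fun v => ?_
  have hD : AnalyticAt ℂ (fun x => zDeriv θ x v) (p, π (star p)) :=
    (analyticAt_zDeriv hθ.analyticAt).clmApply analyticAt_const
  have := forall_van_iff hD
  exact imp_congr_left this

/-- The coordinate functions `Z ↦ θ_l (Z, χ)` of a chart, for `χ` in a ball. -/
def segreFun {n : ℕ} (θ : (Fin N → ℂ) × (Fin n → ℂ) → Fin N → ℂ) (B : Set (Fin n → ℂ)) (i : B × Fin N)
    (Z : Fin N → ℂ) : ℂ := θ (Z, i.1) i.2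

theorem IsSegreChart.exists_ball {n : ℕ} {π : (Fin N → ℂ) →L[ℂ] (Fin n → ℂ)}
    {θ : (Fin N → ℂ) × (Fin n → ℂ) → Fin N → ℂ} (hθ : IsSegreChart M π θ p) :
    ∃ ε > 0, ∀ Z ∈ Metric.ball p ε, ∀ χ ∈ Metric.ball (π (star p)) ε, AnalyticAt ℂ θ (Z, χ) := by
  obtain ⟨ε, hε, h⟩ := Metric.eventually_nhds_iff_ball.1 hθ.analyticAt.eventually_analyticAt
  refine ⟨ε, hε, fun Z hZ χ hχ => h _ ?_⟩
  rw [realPt, ← ball_prod_same]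
  exact ⟨hZ, hχ⟩

variable {n : ℕ} {θ' : (Fin N → ℂ) × (Fin n → ℂ) → Fin N → ℂ} {χ₀ : Fin n → ℂ} {ε : ℝ}
  {Z : Fin N → ℂ}

theorem analyticAt_segreFun {χ : Fin n → ℂ} (h : AnalyticAt ℂ θ' (Z, χ)) (l : Fin N) :
    AnalyticAt ℂ (fun Z => θ' (Z, χ) l) Z := by
  have h1 : AnalyticAt ℂ (fun Z : Fin N → ℂ => (Z, χ)) Z := analyticAt_id.prod analyticAt_const
  exact analyticAt_pi_iff.1 (AnalyticAt.fun_comp (g := θ') (f := fun Z => (Z, χ)) h h1) l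

theorem fderiv_segreFun {χ : Fin n → ℂ} (h : AnalyticAt ℂ θ' (Z, χ)) (l : Fin N) (v : Fin N → ℂ) :
    fderiv ℂ (fun Z => θ' (Z, χ) l) Z v = zDeriv θ' (Z, χ) v l := by
  have h1 : HasFDerivAt (fun Z => θ' (Z, χ)) (zDeriv θ' (Z, χ)) Z :=
    h.differentiableAt.hasFDerivAt.comp Z (hasFDerivAt_prodMk_left Z χ)
  have h2 := hasFDerivAt_pi'.1 h1 l
  rw [h2.fderiv]; rfl

theorem rowRank_segreFun (h : ∀ χ ∈ Metric.ball χ₀ ε, AnalyticAt ℂ θ' (Z, χ)) :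
    rowRank (fun i => grads (segreFun θ' (Metric.ball χ₀ ε)) i Z) = N ↔
      ∀ v, (∀ χ ∈ Metric.ball χ₀ ε, zDeriv θ' (Z, χ) v = 0) → v = 0 := by
  rw [rowRank_eq_iff]
  refine forall_congr' fun v => imp_congr_left ?_
  constructor
  · intro h1 χ hχ
    ext l
    have := h1 (⟨χ, hχ⟩, l)
    rw [← fderiv_eq_grads_dot] at this
    rw [← fderiv_segreFun (h χ hχ)]
    exact this
  · rintro h1 ⟨⟨χ, hχ⟩, l⟩
    rw [← fderiv_eq_grads_dot]
    have := fderiv_segreFun (h χ hχ) l v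
    rw [h1 χ hχ] at this
    exact this

/-- The identity theorem in χ makes the base point irrelevant, so one ball serves all points of M
near p although πq̄ moves with q. -/
theorem zDeriv_eventually_iff (h : ∀ χ ∈ Metric.ball χ₀ ε, AnalyticAt ℂ θ' (Z, χ)) {χ₁ : Fin n → ℂ}
    (hχ₁ : χ₁ ∈ Metric.ball χ₀ ε) (v : Fin N → ℂ) :
    (∀ᶠ χ in 𝓝 χ₁, zDeriv θ' (Z, χ) v = 0) ↔ ∀ χ ∈ Metric.ball χ₀ ε, zDeriv θ' (Z, χ) v = 0 := by
  constructor
  · intro h1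
    have ha : AnalyticOnNhd ℂ (fun χ => zDeriv θ' (Z, χ) v) (Metric.ball χ₀ ε) := by
      intro χ hχ
      have h2 : AnalyticAt ℂ (fun x => zDeriv θ' x v) (Z, χ) :=
        (analyticAt_zDeriv (h χ hχ)).clmApply analyticAt_const
      exact AnalyticAt.fun_comp (g := fun x => zDeriv θ' x v) h2 (analyticAt_const.prod analyticAt_id)
    exact fun χ hχ => ha.eqOn_zero_of_preconnected_of_eventuallyEq_zero
      Metric.isPreconnected_ball hχ₁ h1 hχ
  · intro h1
    filter_upwards [Metric.isOpen_ball.mem_nhds hχ₁] with χ hχ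
    exact h1 χ hχ

/-- Finite nondegeneracy near `p` through the rank of the Segre family on a fixed ball. -/
theorem IsSegreChart.eventually_finitelyNondegenerateAt_iff (hθ : IsSegreChart M π θ p)
    (hd : d ≤ N) (hM : IsGenericSubmanifold d M) {ε : ℝ} (hε : 0 < ε)
    (ha : ∀ Z ∈ Metric.ball p ε, ∀ χ ∈ Metric.ball (π (star p)) ε, AnalyticAt ℂ θ (Z, χ)) :
    ∀ᶠ q in 𝓝[M] p, FinitelyNondegenerateAt d M q ↔
      rowRank (fun i => grads (segreFun θ (Metric.ball (π (star p)) ε)) i q) = N := by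
  have hc : Tendsto (fun q => π (star q)) (𝓝[M] p) (𝓝 (π (star p))) := by
    have : Continuous fun q : Fin N → ℂ => π (star q) := by fun_prop
    exact (this.tendsto p).mono_left nhdsWithin_le_nhds
  filter_upwards [hθ.eventually, self_mem_nhdsWithin,
    nhdsWithin_le_nhds (Metric.ball_mem_nhds p hε), hc.eventually (Metric.ball_mem_nhds _ hε)]
    with q h1 h2 h3 h4
  rw [h1.finitelyNondegenerateAt_iff h2 hd hM, rowRank_segreFun (ha q h3)]
  exact forall_congr' fun v => imp_congr_left (zDeriv_eventually_iff (ha q h3) h4 v)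

theorem FinitelyNondegenerateAt.eventually (h : FinitelyNondegenerateAt d M p) (hp : p ∈ M)
    (hd : d ≤ N) (hM : IsGenericSubmanifold d M) :
    ∀ᶠ q in 𝓝[M] p, FinitelyNondegenerateAt d M q := by
  obtain ⟨ρ, hρ⟩ := hM p hp
  obtain ⟨π, θ, hθ⟩ := hρ.exists_chart hp (n := N - d) (by omega)
  obtain ⟨ε, hε, ha⟩ := hθ.exists_ball
  have h1 := hθ.eventually_finitelyNondegenerateAt_iff hd hM hε ha
  have h2 := (h1.self_of_nhdsWithin hp).1 h
  have h3 := eventually_rowRank_le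
    (w := fun i x => grads (segreFun θ (Metric.ball (π (star p)) ε)) i x) (x := p)
    fun i => analyticAt_grads (analyticAt_segreFun
      (ha p (Metric.mem_ball_self hε) i.1 i.1.2) i.2)
  filter_upwards [h1, nhdsWithin_le_nhds h3] with q h4 h5
  exact h4.2 (le_antisymm (rowRank_le _) (by rw [h2] at h5; exact h5))

theorem rowRank_eq_iff_exists_det {ι : Type*} (u : ι → Fin N → ℂ) :
    rowRank u = N ↔ ∃ s : Fin N → ι, (Matrix.of fun k => u (s k)).det ≠ 0 := by
  constructor
  · intro h
    obtain ⟨s, c, e, hdet⟩ := exists_frame u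
    have hem : IsEmpty (Fin (N - rowRank u)) := by rw [h, Nat.sub_self]; infer_instance
    refine ⟨fun k => Sum.elim s (fun j => hem.elim j) (e k), ?_⟩
    convert hdet using 2
    ext k l
    simp only [frameMat, Matrix.of_apply]
    rcases e k with j | j
    · rfl
    · exact hem.elim j
  · rintro ⟨s, hs⟩
    rw [det_ne_zero_iff_linearIndependent] at hs
    refine le_antisymm (rowRank_le _) ?_
    have h1 := finrank_span_eq_card hs
    rw [Fintype.card_fin] at h1
    refine h1.symm.le.trans (Submodule.finrank_mono (Submodule.span_mono ?_))
    rintro _ ⟨j, rfl⟩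
    exact ⟨s j, rfl⟩

/-- If the Segre family has full rank somewhere in a ball around `p`, then finitely
nondegenerate points are dense in `M` near `p`. -/
theorem IsSegreChart.frequently_finitelyNondegenerateAt (hθ : IsSegreChart M π θ p)
    (hd : d ≤ N) (hM : IsGenericSubmanifold d M) {ε : ℝ} (hε : 0 < ε)
    (ha : ∀ Z ∈ Metric.ball p ε, ∀ χ ∈ Metric.ball (π (star p)) ε, AnalyticAt ℂ θ (Z, χ))
    {Z : Fin N → ℂ} (hZ : Z ∈ Metric.ball p ε)
    (hr : rowRank (fun i => grads (segreFun θ (Metric.ball (π (star p)) ε)) i Z) = N) :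
    ∀ᶠ q in 𝓝[M] p, ∃ᶠ q' in 𝓝[M] q, FinitelyNondegenerateAt d M q' := by
  obtain ⟨s, hs⟩ := (rowRank_eq_iff_exists_det _).1 hr
  let Δ : (Fin N → ℂ) → ℂ := fun Z =>
    (Matrix.of fun k => grads (segreFun θ (Metric.ball (π (star p)) ε)) (s k) Z).det
  have hΔ : AnalyticOnNhd ℂ Δ (Metric.ball p ε) := fun x hx =>
    analyticAt_det fun k l => analyticAt_pi_iff.1 (analyticAt_grads (analyticAt_segreFun
      (ha x hx (s k).1 (s k).1.2) (s k).2)) l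
  filter_upwards [eventually_eventually_nhdsWithin.2
    (hθ.eventually_finitelyNondegenerateAt_iff hd hM hε ha), hθ.eventually, self_mem_nhdsWithin,
    nhdsWithin_le_nhds (Metric.ball_mem_nhds p hε)] with q h1 h2 h3 h4 hno
  have h5 : ∀ᶠ q' in 𝓝[M] q, Δ (realPt π q').1 = 0 := by
    filter_upwards [h1, hno] with q' h6 h7
    by_contra h8
    exact h7 (h6.2 ((rowRank_eq_iff_exists_det _).2 ⟨s, h8⟩))
  have h6 := h2.eventually_eq_zero h3 (g := fun x => Δ x.1)
    (AnalyticAt.fun_comp (g := Δ) (hΔ q h4) analyticAt_fst) h5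
  have h7 : ∀ᶠ Z in 𝓝 q, Δ Z = 0 := by
    have : Tendsto (fun Z : Fin N → ℂ => (Z, π (star q))) (𝓝 q) (𝓝 (realPt π q)) :=
      (Continuous.prodMk_left _).tendsto q
    exact this.eventually h6
  exact hs (hΔ.eqOn_zero_of_preconnected_of_eventuallyEq_zero
    Metric.isPreconnected_ball h4 h7 hZ)

end Good

end CRGeom

/-! ### Essential finiteness. -/

namespace CRGeom

section EssentialFiniteness

variable {N d : ℕ} {M : Set (Fin N → ℂ)} {p : Fin N → ℂ} {ρ : Fin d → (Fin N → ℂ) → ℝ}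
  {R : Fin d → (Fin N → ℂ) × (Fin N → ℂ) → ℂ}

/-- Inclusion of Segre varieties near `p` in terms of a chart. -/
theorem IsSegreChart.eventually_segre_iff {n : ℕ} {π : (Fin N → ℂ) →L[ℂ] (Fin n → ℂ)}
    {θ : (Fin N → ℂ) × (Fin n → ℂ) → Fin N → ℂ} (hθ : IsSegreChart M π θ p) (hp : p ∈ M)
    (hn : d + n = N) (h : IsDefiningAt M ρ p) (hR : ∀ j, IsComplexificationAt (ρ j) (R j) p) :
    ∀ᶠ Z in 𝓝 p, (∀ᶠ ζ in 𝓝 (star p), (∀ j, R j (p, ζ) = 0) → ∀ j, R j (Z, ζ) = 0) ↔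
      ∀ᶠ χ in 𝓝 (π (star p)), θ (Z, χ) = θ (p, χ) := by
  have ha : ∀ᶠ Z in 𝓝 p, ∀ᶠ χ in 𝓝 (π (star p)), vecFun R (Z, θ (Z, χ)) = 0 := by
    have := hθ.vecFun_graph hp h hR
    rw [realPt] at this
    exact this.curry_nhds
  have hb : ∀ᶠ Z in 𝓝 p, ∀ᶠ ζ in 𝓝 (star p), vecFun R (Z, ζ) = 0 → ζ = θ (Z, π ζ) :=
    (hθ.eq_of_vecFun_eq_zero hp hn h hR).curry_nhds
  have hpr : ∀ᶠ χ in 𝓝 (π (star p)), π (θ (p, χ)) = χ := by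
    have := hθ.proj
    rw [realPt] at this
    exact this.curry_nhds.self_of_nhds
  have hcθ : Tendsto (fun χ => θ (p, χ)) (𝓝 (π (star p))) (𝓝 (star p)) := by
    have h1 : ContinuousAt θ (p, π (star p)) := hθ.analyticAt.continuousAt
    have h2 := h1.tendsto.comp ((Continuous.prodMk_right p).tendsto (π (star p)))
    have h3 : θ (p, π (star p)) = star p := hθ.apply_realPt hp
    rwa [h3] at h2
  filter_upwards [ha, hb] with Z h1 h2
  constructor
  · intro h3
    filter_upwards [hcθ.eventually h3, hcθ.eventually h2, ha.self_of_nhds, hpr] with χ h4 h5 h6 h7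
    rw [h7] at h5
    exact (h5 (funext fun j => h4 (fun j => congrFun h6 j) j)).symm
  · intro h3
    have hπ : Tendsto π (𝓝 (star p)) (𝓝 (π (star p))) := π.continuous.tendsto _
    filter_upwards [hπ.eventually h3, hπ.eventually h1, hb.self_of_nhds] with ζ h4 h5 h6 h7 j
    have h8 := h6 (funext h7)
    rw [h4, ← h8] at h5
    exact congrFun h5 j

variable {π : (Fin N → ℂ) →L[ℂ] (Fin (N - d) → ℂ)}
  {θ : (Fin N → ℂ) × (Fin (N - d) → ℂ) → Fin N → ℂ}

theorem IsSegreChart.essentiallyFiniteAt_iff (hθ : IsSegreChart M π θ p) (hp : p ∈ M)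
    (hd : d ≤ N) (hM : IsGenericSubmanifold d M) :
    EssentiallyFiniteAt d M p ↔
      ∀ᶠ Z in 𝓝 p, (∀ᶠ χ in 𝓝 (π (star p)), θ (Z, χ) = θ (p, χ)) → Z = p := by
  have hn : d + (N - d) = N := by omega
  constructor
  · rintro ⟨ρ, R, h1, h2, h3⟩
    filter_upwards [h3, hθ.eventually_segre_iff hp hn h1 h2] with Z h4 h5 h6
    exact h4 (h5.2 h6)
  · intro h3
    obtain ⟨ρ, h1⟩ := hM p hp
    obtain ⟨R, h2⟩ := h1.exists_complexification
    refine ⟨ρ, R, h1, h2, ?_⟩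
    filter_upwards [h3, hθ.eventually_segre_iff hp hn h1 h2] with Z h4 h5 h6
    exact h4 (h5.1 h6)

theorem exists_mem_of_frequently_nhdsWithin {P : (Fin N → ℂ) → Prop} (h : ∃ᶠ q in 𝓝[M] p, P q) :
    ∃ q ∈ M, P q := by
  obtain ⟨q, h1, h2⟩ := (h.and_eventually self_mem_nhdsWithin).exists
  exact ⟨q, h2, h1⟩

/-- An isolated fibre of the Segre family forces rank N at some q near p. This q need not lie on M;
density of the good points brings the conclusion back to M. -/
theorem EssentiallyFiniteAt.exists_finitelyNondegenerateAt (h : EssentiallyFiniteAt d M p)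
    (hp : p ∈ M) (hd : d ≤ N) (hM : IsGenericSubmanifold d M) :
    ∃ q ∈ M, FinitelyNondegenerateAt d M q := by
  obtain ⟨ρ, hρ⟩ := hM p hp
  obtain ⟨π, θ, hθ⟩ := hρ.exists_chart hp (n := N - d) (by omega)
  obtain ⟨ε, hε, ha⟩ := hθ.exists_ball
  obtain ⟨δ₀, hδ₀, h1⟩ := Metric.eventually_nhds_iff_ball.1
    ((hθ.essentiallyFiniteAt_iff hp hd hM).1 h)
  have hm : 0 < min δ₀ ε := lt_min hδ₀ hε
  have hm1 := min_le_left δ₀ ε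
  have hm2 := min_le_right δ₀ ε
  -- The radius is halved because analyticity is required on the ball of radius 2δ.
  obtain ⟨q, hq, hv⟩ := exists_injective_of_isolated_fibre
    (f := segreFun θ (Metric.ball (π (star p)) ε)) (p := p) (δ := min δ₀ ε / 2) (by positivity)
    (fun x hx i => analyticAt_segreFun (ha x (Metric.ball_subset_ball (by linarith) hx)
      i.1 i.1.2) i.2) (fun Z hZ hf => h1 Z
      (Metric.closedBall_subset_ball (by linarith) hZ) (by
        filter_upwards [Metric.ball_mem_nhds _ hε] with χ hχ
        ext l
        exact hf (⟨χ, hχ⟩, l)))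
  refine exists_mem_of_frequently_nhdsWithin ((hθ.frequently_finitelyNondegenerateAt hd hM hε ha
    (Z := q) (Metric.ball_subset_ball (by linarith) hq) ?_).self_of_nhdsWithin hp)
  rw [rowRank_eq_iff]
  exact fun v h2 => hv v fun i => by rw [fderiv_eq_grads_dot]; exact h2 i

/-- N members of the Segre family with independent differentials are local coordinates at p, so the
fibre through p is a point. -/
theorem FinitelyNondegenerateAt.essentiallyFiniteAt (h : FinitelyNondegenerateAt d M p)
    (hp : p ∈ M) (hd : d ≤ N) (hM : IsGenericSubmanifold d M) : EssentiallyFiniteAt d M p := by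
  obtain ⟨ρ, hρ⟩ := hM p hp
  obtain ⟨π, θ, hθ⟩ := hρ.exists_chart hp (n := N - d) (by omega)
  obtain ⟨ε, hε, ha⟩ := hθ.exists_ball
  rw [hθ.essentiallyFiniteAt_iff hp hd hM]
  have h1 := ((hθ.eventually_finitelyNondegenerateAt_iff hd hM hε ha).self_of_nhdsWithin hp).1 h
  obtain ⟨s, hs⟩ := (rowRank_eq_iff_exists_det _).1 h1
  have hpa : ∀ i : Metric.ball (π (star p)) ε × Fin N,
      AnalyticAt ℂ (segreFun θ (Metric.ball (π (star p)) ε) i) p := fun i =>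
    analyticAt_segreFun (ha p (Metric.mem_ball_self hε) i.1 i.1.2) i.2
  let Φ : (Fin N → ℂ) → Fin N → ℂ := fun Z k => segreFun θ (Metric.ball (π (star p)) ε) (s k) Z
  have hΦ : AnalyticAt ℂ Φ p := analyticAt_pi_iff.2 fun k => hpa (s k)
  obtain ⟨g, -, hgp, hg, -⟩ := exists_analytic_inverse rfl hΦ fun v hv => by
    refine Matrix.eq_zero_of_mulVec_eq_zero hs (funext fun k => ?_)
    have e : fderiv ℂ Φ p = ContinuousLinearMap.pi fun k => fderiv ℂ (fun Z => Φ Z k) p :=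
      fderiv_pi fun k => (hpa (s k)).differentiableAt
    have h2 := congrFun hv k
    rw [e] at h2
    exact (fderiv_eq_grads_dot (s k) p v).symm.trans h2
  filter_upwards [hg, Metric.ball_mem_nhds p hε] with Z h2 h3 h4
  have h5 : Φ Z = Φ p := by
    funext k
    have han : AnalyticOnNhd ℂ (fun χ => θ (Z, χ) - θ (p, χ)) (Metric.ball (π (star p)) ε) :=
      fun χ hχ => (AnalyticAt.fun_comp (g := θ) (ha Z h3 χ hχ)
        (analyticAt_const.prod analyticAt_id)).fun_sub (AnalyticAt.fun_comp (g := θ)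
          (ha p (Metric.mem_ball_self hε) χ hχ) (analyticAt_const.prod analyticAt_id))
    have h6 := han.eqOn_zero_of_preconnected_of_eventuallyEq_zero Metric.isPreconnected_ball
      (Metric.mem_ball_self hε) (h4.mono fun χ h => sub_eq_zero.2 h) (s k).1.2
    exact congrFun (sub_eq_zero.1 h6) (s k).2
  rw [← h2, h5, hgp]

end EssentialFiniteness

/-! ### Holomorphic vector fields tangent to M. -/

section HolomorphicDegeneracy

variable {N d : ℕ} {M : Set (Fin N → ℂ)} {p : Fin N → ℂ}

/-- A tangent field satisfies θ_Z(Z,χ) A(Z) = 0 on the whole complexification. The good points form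
an open set and A is zero at each of them, so A vanishes on M near p; openness matters because A may
vanish at p alone. -/
theorem HolomorphicallyDegenerateAt.not_finitelyNondegenerateAt
    (h : HolomorphicallyDegenerateAt d M p) (hp : p ∈ M) (hd : d ≤ N)
    (hM : IsGenericSubmanifold d M) : ¬ FinitelyNondegenerateAt d M p := by
  intro hgood
  obtain ⟨ρ, a, hρ, ha, htan, hne⟩ := h
  obtain ⟨R, hR⟩ := hρ.exists_complexification
  have hn : d + (N - d) = N := by omega
  obtain ⟨π, θ, hθ⟩ := hρ.exists_chart hp hn
  let A : (Fin N → ℂ) → Fin N → ℂ := fun Z k => a k Z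
  have hA : AnalyticAt ℂ A p := analyticAt_pi_iff.2 ha
  have hH : AnalyticAt ℂ (fun y : (Fin N → ℂ) × (Fin N → ℂ) =>
      fderiv ℂ (vecFun R) y (A y.1, 0)) (p, star p) := by
    refine (analyticAt_vecFun hR).fderiv.clmApply (AnalyticAt.prod ?_ analyticAt_const)
    exact AnalyticAt.fun_comp (g := A) (f := Prod.fst) hA analyticAt_fst
  have h1 := hθ.eventually_graphMap_eq_zero hp hH (by
    have h1 : ∀ᶠ Z in 𝓝 p, ∀ j, IsComplexificationAt (ρ j) (R j) Z :=
      eventually_all.2 fun j => (hR j).eventually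
    filter_upwards [nhdsWithin_le_nhds h1, htan] with Z h2 h3
    ext j
    rw [fderiv_vecFun (fun j => (h2 j).analyticAt.differentiableAt), (h2 j).fderiv_apply]
    simp only [dotProduct_zero, add_zero, Pi.zero_apply]
    rw [dotProduct_comm]
    exact h3 j)
  have h2 : ∀ᶠ x in 𝓝 (realPt π p), zDeriv θ x (A x.1) = 0 := by
    filter_upwards [h1, hθ.fderiv_eq_zero_iff hp hn hρ hR] with x h2 h3
    exact (h3 _).2 h2
  refine hne ?_
  filter_upwards [(tendsto_realPt π p).eventually (eventually_eventually_nhds.2 h2),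
    hgood.eventually hp hd hM, hθ.eventually, self_mem_nhdsWithin] with q h3 h4 h5 h6
  refine congrFun ((h5.finitelyNondegenerateAt_iff h6 hd hM).1 h4 (A q) ?_)
  rw [realPt] at h3
  exact h3.curry_nhds.self_of_nhds

theorem exists_max_nat {α : Type*} {S : Set α} (hS : S.Nonempty) (f : α → ℕ) {B : ℕ}
    (hB : ∀ x ∈ S, f x ≤ B) : ∃ x₁ ∈ S, ∀ x ∈ S, f x ≤ f x₁ := by
  have hbd : BddAbove (f '' S) := ⟨B, by rintro _ ⟨x, hx, rfl⟩; exact hB x hx⟩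
  obtain ⟨x₁, h1, h2⟩ := Nat.sSup_mem (hS.image f) hbd
  exact ⟨x₁, h1, fun x hx => h2 ▸ le_csSup hbd ⟨x, hx, rfl⟩⟩

theorem grads_segreFun_dot {n : ℕ} {θ : (Fin N → ℂ) × (Fin n → ℂ) → Fin N → ℂ}
    {B : Set (Fin n → ℂ)} {Z : Fin N → ℂ} (i : B × Fin N) (h : AnalyticAt ℂ θ (Z, i.1))
    (v : Fin N → ℂ) : grads (segreFun θ B) i Z ⬝ᵥ v = zDeriv θ (Z, i.1) v i.2 := by
  rw [← fderiv_eq_grads_dot]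
  exact fderiv_segreFun h i.2 v

/-- With no good points near p the Segre family has rank below N on the ball. A kernel vector at a
point of maximal rank extends to a holomorphic field depending on Z alone, since the family is
indexed by χ. -/
theorem holomorphicallyDegenerateAt_of_eventually_not (hp : p ∈ M) (hd : d ≤ N)
    (hM : IsGenericSubmanifold d M) (h : ∀ᶠ q in 𝓝[M] p, ¬ FinitelyNondegenerateAt d M q) :
    HolomorphicallyDegenerateAt d M p := by
  obtain ⟨ρ, hρ⟩ := hM p hp
  obtain ⟨R, hR⟩ := hρ.exists_complexification
  have hn : d + (N - d) = N := by omega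
  obtain ⟨π, θ, hθ⟩ := hρ.exists_chart hp hn
  obtain ⟨ε, hε, ha⟩ := hθ.exists_ball
  let w : Metric.ball (π (star p)) ε × Fin N → (Fin N → ℂ) → Fin N → ℂ :=
    grads (segreFun θ (Metric.ball (π (star p)) ε))
  have hlt : ∀ Z ∈ Metric.ball p ε, rowRank (fun i => w i Z) ≠ N := fun Z hZ hr =>
    (hθ.frequently_finitelyNondegenerateAt hd hM hε ha hZ hr).self_of_nhdsWithin hp h
  obtain ⟨x₁, hx₁, hmax⟩ := exists_max_nat (Metric.nonempty_ball.2 hε)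
    (fun Z => rowRank fun i => w i Z) fun Z _ => rowRank_le _
  have hv := hlt x₁ hx₁
  rw [ne_eq, rowRank_eq_iff] at hv
  push Not at hv
  obtain ⟨v, hv, hv0⟩ := hv
  obtain ⟨A, hA, hAv, hAk⟩ := exists_kernel_field Metric.isOpen_ball Metric.isPreconnected_ball
    (w := w) (fun i x hx => analyticAt_grads (analyticAt_segreFun (ha x hx i.1 i.1.2) i.2))
    hx₁ hmax hv
  refine ⟨ρ, fun k Z => A Z k, hρ, analyticAt_pi_iff.1 (hA p (Metric.mem_ball_self hε)), ?_, ?_⟩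
  · have h1 : ∀ᶠ Z in 𝓝 p, ∀ j, IsComplexificationAt (ρ j) (R j) Z :=
      eventually_all.2 fun j => (hR j).eventually
    have hc : Tendsto (fun q => π (star q)) (𝓝[M] p) (𝓝 (π (star p))) := by
      have : Continuous fun q : Fin N → ℂ => π (star q) := by fun_prop
      exact (this.tendsto p).mono_left nhdsWithin_le_nhds
    filter_upwards [nhdsWithin_le_nhds h1, hθ.conj, hc.eventually (Metric.ball_mem_nhds _ hε),
      nhdsWithin_le_nhds (Metric.ball_mem_nhds p hε),
      (tendsto_realPt π p).eventually (hθ.fderiv_eq_zero_iff hp hn hρ hR)] with Z h2 h3 h4 h5 h6 j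
    have h7 : fderiv ℂ θ (realPt π Z) (A Z, 0) = 0 := by
      ext l
      have h4' : π (star Z) ∈ Metric.ball (π (star p)) ε := h4
      exact (grads_segreFun_dot (⟨_, h4'⟩, l) (ha Z h5 _ h4') (A Z)).symm.trans
        (hAk Z h5 (⟨_, h4'⟩, l))
    have h8 := congrFun ((h6 (A Z)).1 h7) j
    have h9 : graphMap θ (realPt π Z) = (Z, star Z) := by rw [graphMap, h3]; rfl
    rw [h9, fderiv_vecFun (fun j => (h2 j).analyticAt.differentiableAt),
      (h2 j).fderiv_apply, dotProduct_zero, add_zero, dotProduct_comm] at h8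
    exact h8
  · intro h1
    -- Vanishing on M near p would propagate to the whole ball, including x₁, where the field equals
    -- v ≠ 0.
    have h2 := hθ.eventually_eq_zero hp (g := fun x => A x.1)
      (AnalyticAt.fun_comp (g := A) (hA p (Metric.mem_ball_self hε)) analyticAt_fst)
      (h1.mono fun Z h => funext h)
    have h3 : ∀ᶠ Z in 𝓝 p, A Z = 0 :=
      ((Continuous.prodMk_left (π (star p))).tendsto p).eventually h2
    exact hv0 (hAv ▸ hA.eqOn_zero_of_preconnected_of_eventuallyEq_zero
      Metric.isPreconnected_ball (Metric.mem_ball_self hε) h3 hx₁)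

theorem holomorphicallyNondegenerate_iff (hd : d ≤ N) (hM : IsGenericSubmanifold d M) :
    HolomorphicallyNondegenerate d M ↔ ∃ q ∈ M, FinitelyNondegenerateAt d M q := by
  constructor
  · rintro ⟨p, hp, h⟩
    refine exists_mem_of_frequently_nhdsWithin (p := p) fun h1 => h ?_
    exact holomorphicallyDegenerateAt_of_eventually_not hp hd hM h1
  · rintro ⟨p, hp, h⟩
    exact ⟨p, hp, fun h1 => h1.not_finitelyNondegenerateAt hp hd hM h⟩

end HolomorphicDegeneracy

/-! ### Density and openness of the good points. -/

section Density

variable {N d : ℕ} {M : Set (Fin N → ℂ)} {p : Fin N → ℂ}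

/-- Near each point, finitely nondegenerate points are either dense or absent. -/
theorem eventually_frequently_or_eventually_not (hp : p ∈ M) (hd : d ≤ N)
    (hM : IsGenericSubmanifold d M) :
    (∀ᶠ q in 𝓝[M] p, ∃ᶠ q' in 𝓝[M] q, FinitelyNondegenerateAt d M q') ∨
      ∀ᶠ q in 𝓝[M] p, ¬ FinitelyNondegenerateAt d M q := by
  obtain ⟨ρ, hρ⟩ := hM p hp
  obtain ⟨π, θ, hθ⟩ := hρ.exists_chart hp (n := N - d) (by omega)
  obtain ⟨ε, hε, ha⟩ := hθ.exists_ball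
  by_cases h : ∃ Z ∈ Metric.ball p ε,
      rowRank (fun i => grads (segreFun θ (Metric.ball (π (star p)) ε)) i Z) = N
  · obtain ⟨Z, hZ, hr⟩ := h
    exact Or.inl (hθ.frequently_finitelyNondegenerateAt hd hM hε ha hZ hr)
  · right
    filter_upwards [hθ.eventually_finitelyNondegenerateAt_iff hd hM hε ha,
      nhdsWithin_le_nhds (Metric.ball_mem_nhds p hε)] with q h1 h2 h3
    exact h ⟨q, h2, h1.1 h3⟩

/-- The two local alternatives, dense or absent, hold on relatively open sets that are disjoint and
cover M; connectedness leaves only one. -/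
theorem frequently_finitelyNondegenerateAt_of_isPreconnected (hc : IsPreconnected M) (hd : d ≤ N)
    (hM : IsGenericSubmanifold d M) (h : ∃ q ∈ M, FinitelyNondegenerateAt d M q) :
    ∀ p ∈ M, ∃ᶠ q in 𝓝[M] p, FinitelyNondegenerateAt d M q := by
  intro p hp hno
  let u : Set (Fin N → ℂ) := {q | ∀ᶠ q' in 𝓝 q, q' ∈ M →
    ∃ᶠ q'' in 𝓝[M] q', FinitelyNondegenerateAt d M q''}
  let v : Set (Fin N → ℂ) := {q | ∀ᶠ q' in 𝓝 q, q' ∈ M → ¬ FinitelyNondegenerateAt d M q'}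
  have hu : IsOpen u := isOpen_iff_mem_nhds.2 fun q hq => eventually_eventually_nhds.2 hq
  have hv : IsOpen v := isOpen_iff_mem_nhds.2 fun q hq => eventually_eventually_nhds.2 hq
  obtain ⟨q₀, hq₀, hg⟩ := h
  have hcov : M ⊆ u ∪ v := fun q hq =>
    (eventually_frequently_or_eventually_not hq hd hM).imp eventually_nhdsWithin_iff.1
      eventually_nhdsWithin_iff.1
  have h1 : (M ∩ u).Nonempty := by
    refine ⟨q₀, hq₀, (hcov hq₀).resolve_right fun h => ?_⟩
    exact (show ∀ᶠ q' in 𝓝 q₀, q' ∈ M → ¬ FinitelyNondegenerateAt d M q' from h).self_of_nhds hq₀ hg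
  have h2 : (M ∩ v).Nonempty := ⟨p, hp, eventually_nhdsWithin_iff.1 hno⟩
  obtain ⟨q, hqM, hqu, hqv⟩ := hc u v hu hv hcov h1 h2
  have h3 : ∀ᶠ q' in 𝓝 q, q' ∈ M →
    ∃ᶠ q'' in 𝓝[M] q', FinitelyNondegenerateAt d M q'' := hqu
  exact h3.self_of_nhds hqM (eventually_nhdsWithin_iff.2 hqv)

theorem exists_isOpen_finitelyNondegenerateAt (hd : d ≤ N) (hM : IsGenericSubmanifold d M) :
    ∃ O : Set (Fin N → ℂ), IsOpen O ∧ {q ∈ M | FinitelyNondegenerateAt d M q} = O ∩ M := by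
  refine ⟨{q | ∀ᶠ q' in 𝓝 q, q' ∈ M → FinitelyNondegenerateAt d M q'},
    isOpen_iff_mem_nhds.2 fun q hq => eventually_eventually_nhds.2 hq, ?_⟩
  ext q
  constructor
  · rintro ⟨h1, h2⟩
    exact ⟨eventually_nhdsWithin_iff.1 (h2.eventually h1 hd hM), h1⟩
  · rintro ⟨h1, h2⟩
    exact ⟨h2, (show ∀ᶠ q' in 𝓝 q, q' ∈ M → FinitelyNondegenerateAt d M q' from
      h1).self_of_nhds h2⟩

end Density

end CRGeom

/-! ### Growth of the rank with the order of differentiation. -/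

namespace CRGeom

section Stabilization

variable {N n : ℕ} {θ : (Fin N → ℂ) × (Fin n → ℂ) → Fin N → ℂ} {x : (Fin N → ℂ) × (Fin n → ℂ)}

/-- Words of bounded length. -/
abbrev BddWord (n k : ℕ) : Type := {w : List (Fin n) // w.length ≤ k}

instance (k : ℕ) : Finite (BddWord n k) := (List.finite_length_le (Fin n) k).to_subtype

/-- The rows of the derivatives of order at most `k`, in the second variable, of `∂θ/∂Z`. -/
noncomputable def derivRow (θ : (Fin N → ℂ) × (Fin n → ℂ) → Fin N → ℂ) (k : ℕ)
    (i : BddWord n k × Fin N) (x : (Fin N → ℂ) × (Fin n → ℂ)) : Fin N → ℂ :=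
  fun j => pdw i.1.1 (zDeriv θ) x (Pi.single j 1) i.2

theorem derivRow_dot {k : ℕ} (i : BddWord n k × Fin N) (v : Fin N → ℂ) :
    derivRow θ k i x ⬝ᵥ v = pdw i.1.1 (zDeriv θ) x v i.2 := by
  conv_rhs => rw [← (Pi.basisFun ℂ (Fin N)).sum_repr v]
  simp [dotProduct, derivRow, mul_comm]

theorem analyticAt_derivRow (h : AnalyticAt ℂ θ x) {k : ℕ} (i : BddWord n k × Fin N) :
    AnalyticAt ℂ (derivRow θ k i) x :=
  analyticAt_pi_iff.2 fun _ => analyticAt_pi_iff.1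
    ((analyticAt_pdw i.1.1 (analyticAt_zDeriv h)).clmApply analyticAt_const) i.2

/-- The rank of the derivatives of order at most `k`, in the second variable, of `∂θ/∂Z`. -/
noncomputable def derivRank (θ : (Fin N → ℂ) × (Fin n → ℂ) → Fin N → ℂ) (k : ℕ)
    (x : (Fin N → ℂ) × (Fin n → ℂ)) : ℕ := rowRank fun i => derivRow θ k i x

theorem forall_derivRow_dot_iff {k : ℕ} (v : Fin N → ℂ) :
    (∀ i, derivRow θ k i x ⬝ᵥ v = 0) ↔
      ∀ w : List (Fin n), w.length ≤ k → pdw w (zDeriv θ) x v = 0 := by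
  simp only [derivRow_dot]
  exact ⟨fun h w hw => funext fun l => h (⟨w, hw⟩, l), fun h i => congrFun (h i.1.1 i.1.2) i.2⟩

theorem forall_derivRow_dot_iff_van (h : AnalyticAt ℂ θ x) {k : ℕ} (v : Fin N → ℂ) :
    (∀ i, derivRow θ k i x ⬝ᵥ v = 0) ↔ Van (k + 1) (fun y => zDeriv θ y v) x := by
  rw [forall_derivRow_dot_iff, van_iff_pdw]
  refine forall_congr' fun w => ?_
  rw [Nat.lt_succ_iff, (pdw_apply w (analyticAt_zDeriv h) v).self_of_nhds]

theorem derivRank_eq_iff (h : AnalyticAt ℂ θ x) {k : ℕ} :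
    derivRank θ k x = N ↔ ∀ v, Van (k + 1) (fun y => zDeriv θ y v) x → v = 0 := by
  rw [derivRank, rowRank_eq_iff]
  simp only [forall_derivRow_dot_iff_van h]

theorem range_derivRow_subset (k : ℕ) :
    Set.range (fun i => derivRow θ k i x) ⊆ Set.range fun i => derivRow θ (k + 1) i x := by
  rintro _ ⟨i, rfl⟩
  exact ⟨(⟨i.1.1, i.1.2.trans (Nat.le_succ k)⟩, i.2), rfl⟩

theorem derivRank_le_succ (k : ℕ) : derivRank θ k x ≤ derivRank θ (k + 1) x :=
  Submodule.finrank_mono (Submodule.span_mono (range_derivRow_subset k))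

/-- Equal ranks of nested spans mean equal spans, hence equal kernels. -/
theorem pdw_eq_zero_of_derivRank_eq {k : ℕ} (h : derivRank θ k x = derivRank θ (k + 1) x)
    {v : Fin N → ℂ} (hv : ∀ w : List (Fin n), w.length ≤ k → pdw w (zDeriv θ) x v = 0)
    {w : List (Fin n)} (hw : w.length ≤ k + 1) : pdw w (zDeriv θ) x v = 0 := by
  have h1 : Submodule.span ℂ (Set.range fun i => derivRow θ k i x) =
      Submodule.span ℂ (Set.range fun i => derivRow θ (k + 1) i x) :=
    Submodule.eq_of_le_of_finrank_eq (Submodule.span_mono (range_derivRow_subset k)) h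
  refine (forall_derivRow_dot_iff v).1 (fun i => ?_) w hw
  have h2 : derivRow θ (k + 1) i x ∈ Submodule.span ℂ (Set.range fun i => derivRow θ k i x) := by
    rw [h1]; exact Submodule.subset_span ⟨i, rfl⟩
  generalize derivRow θ (k + 1) i x = y at h2
  induction h2 using Submodule.span_induction with
  | mem y hy => obtain ⟨j, rfl⟩ := hy; exact (forall_derivRow_dot_iff v).2 hv j
  | zero => simp
  | add a b _ _ ha hb => rw [add_dotProduct, ha, hb, add_zero]
  | smul c a _ ha => rw [smul_dotProduct, ha, smul_zero]

/-- If the ranks of orders `k` and `k + 1` agree, kernel fields of order `k` are in the kernel of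
all derivatives. -/
theorem pdw_eq_zero_of_kernel_field {U : Set ((Fin N → ℂ) × (Fin n → ℂ))} (hU : IsOpen U)
    (hθ : ∀ x ∈ U, AnalyticAt ℂ θ x) {k : ℕ}
    (hk : ∀ x ∈ U, derivRank θ k x = derivRank θ (k + 1) x) (w : List (Fin n))
    {b : (Fin N → ℂ) × (Fin n → ℂ) → Fin N → ℂ} (hb : ∀ x ∈ U, AnalyticAt ℂ b x)
    (hkb : ∀ x ∈ U, ∀ w : List (Fin n), w.length ≤ k → pdw w (zDeriv θ) x (b x) = 0) :
    ∀ x ∈ U, pdw w (zDeriv θ) x (b x) = 0 := by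
  have leib : ∀ (i : Fin n) (w : List (Fin n)) {b : (Fin N → ℂ) × (Fin n → ℂ) → Fin N → ℂ},
      (∀ x ∈ U, AnalyticAt ℂ b x) → (∀ x ∈ U, pdw w (zDeriv θ) x (b x) = 0) → ∀ x ∈ U,
      pdw (w ++ [i]) (zDeriv θ) x (b x) + pdw w (zDeriv θ) x (pd i b x) = 0 := by
    intro i w b hb h0 x hx
    have h1 := (pd_clm_apply (i := i) (analyticAt_pdw w (analyticAt_zDeriv (hθ x hx)))
      (hb x hx)).self_of_nhds
    have h2 : (fun y => pdw w (zDeriv θ) y (b y)) =ᶠ[𝓝 x] fun _ => 0 := by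
      filter_upwards [hU.mem_nhds hx] with y hy
      exact h0 y hy
    rw [pdw_append_singleton]
    refine h1.symm.trans ((pd_congr h2).self_of_nhds.trans ?_)
    simp [pd, opX]
  -- `b` is generalized because the step uses ∂_i b, which is again a kernel field of order k: this
  -- follows from `leib` and the agreement of the ranks of orders k and k + 1.
  induction w using List.reverseRecOn generalizing b with
  | nil => exact fun x hx => hkb x hx [] (Nat.zero_le k)
  | append_singleton w i ih =>
    intro x hx
    have h1 := leib i w hb (ih hb hkb) x hx
    rwa [ih (fun x hx => analyticAt_pd (hb x hx)) (fun y hy u hu => ?_) x hx, add_zero] at h1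
    have h2 := leib i u hb (fun x hx => hkb x hx u hu) y hy
    rwa [pdw_eq_zero_of_derivRank_eq (hk y hy) (hkb y hy)
      (by rw [List.length_append]; exact Nat.succ_le_succ hu), zero_add] at h2

/-- Climbing strictly from d during n steps would reach d + n. -/
theorem exists_eq_succ_of_lt {e : ℕ → ℕ} (he : ∀ k, e k ≤ e (k + 1)) {d n : ℕ} (h0 : d ≤ e 0)
    (hn : e n < d + n) : ∃ k < n, e k = e (k + 1) := by
  by_contra! h
  have h1 : ∀ k ≤ n, d + k ≤ e k := by
    intro k
    induction k with
    | zero => exact fun _ => h0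
    | succ k ih =>
      intro hk
      have h2 := ih (by omega)
      have h3 := lt_of_le_of_ne (he k) (h k (by omega))
      omega
  exact absurd (h1 n le_rfl) (by omega)

theorem eventually_derivRank_le (h : AnalyticAt ℂ θ x) (k : ℕ) :
    ∀ᶠ y in 𝓝 x, derivRank θ k x ≤ derivRank θ k y :=
  eventually_rowRank_le (w := fun i => derivRow θ k i) fun i => analyticAt_derivRow h i

/-- Full rank is generically attained at order `n`. -/
theorem exists_derivRank_eq {d : ℕ} (hN : d + n = N) {U : Set ((Fin N → ℂ) × (Fin n → ℂ))}
    (hU : IsOpen U) (hne : U.Nonempty) (hθ : ∀ x ∈ U, AnalyticAt ℂ θ x)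
    (h0 : ∀ x ∈ U, d ≤ derivRank θ 0 x)
    (hV : ∀ x ∈ U, ∀ v, (∀ m, Van m (fun y => zDeriv θ y v) x) → v = 0) :
    ∃ x ∈ U, derivRank θ n x = N := by
  -- Each rank is lower semicontinuous, so where their sum is maximal all of them are locally
  -- constant at once.
  obtain ⟨x₁, hx₁, hmax⟩ := exists_max_nat hne
    (fun x => ∑ k ∈ Finset.range (n + 1), derivRank θ k x) (B := (n + 1) * N) fun x _ => by
      refine (Finset.sum_le_card_nsmul _ _ N fun k _ => rowRank_le _).trans ?_
      simp
  refine ⟨x₁, hx₁, le_antisymm (rowRank_le _) (not_lt.1 fun hlt => ?_)⟩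
  obtain ⟨k, hk, hkk⟩ := exists_eq_succ_of_lt (e := fun k => derivRank θ k x₁)
    (fun k => derivRank_le_succ k) (h0 x₁ hx₁) (hlt.trans_eq hN.symm)
  have hloc : ∀ᶠ x in 𝓝 x₁, x ∈ U ∧ ∀ k ∈ Finset.range (n + 1),
      derivRank θ k x = derivRank θ k x₁ := by
    have h1 : ∀ᶠ x in 𝓝 x₁, ∀ k ∈ Finset.range (n + 1), derivRank θ k x₁ ≤ derivRank θ k x :=
      (Finset.eventually_all _).2 fun k _ => eventually_derivRank_le (hθ x₁ hx₁) k
    filter_upwards [h1, hU.mem_nhds hx₁] with x h2 h3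
    exact ⟨h3, fun k hk => (((Finset.sum_eq_sum_iff_of_le h2).1
      (le_antisymm (Finset.sum_le_sum h2) (hmax x h3))) k hk).symm⟩
  obtain ⟨ε, hε, hball⟩ := Metric.eventually_nhds_iff_ball.1 hloc
  have hk1 : derivRank θ k x₁ ≠ N := by
    have h1 : Monotone fun k => derivRank θ k x₁ := monotone_nat_of_le_succ fun k =>
      derivRank_le_succ k
    exact ((h1 hk.le).trans_lt hlt).ne
  rw [derivRank, ne_eq, rowRank_eq_iff] at hk1
  push Not at hk1
  obtain ⟨v, hv, hv0⟩ := hk1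
  have hkr : k ∈ Finset.range (n + 1) := Finset.mem_range.2 (by omega)
  have hkr' : k + 1 ∈ Finset.range (n + 1) := Finset.mem_range.2 (by omega)
  obtain ⟨a, ha, hav, hak⟩ := exists_kernel_field Metric.isOpen_ball
    Metric.isPreconnected_ball (w := fun i => derivRow θ k i)
    (fun i x hx => analyticAt_derivRow (hθ x (hball x hx).1) i) (Metric.mem_ball_self hε)
    (fun x hx => ((hball x hx).2 k hkr).le) hv
  have hall := fun w => pdw_eq_zero_of_kernel_field Metric.isOpen_ball
    (fun x hx => hθ x (hball x hx).1) (k := k)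
    (fun x hx => by rw [(hball x hx).2 k hkr, (hball x hx).2 (k + 1) hkr']; exact hkk)
    w ha (fun x hx => (forall_derivRow_dot_iff _).1 (hak x hx)) x₁ (Metric.mem_ball_self hε)
  refine hv0 (hV x₁ hx₁ v fun m => van_iff_pdw.2 fun w _ => ?_)
  rw [(pdw_apply w (analyticAt_zDeriv (hθ x₁ hx₁)) v).self_of_nhds, ← hav]
  exact hall w

end Stabilization

/-! ### Nondegeneracy of order N - d off a proper analytic subset. -/

section GenericNondegeneracy

variable {N d : ℕ} {M : Set (Fin N → ℂ)} {p : Fin N → ℂ}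
  {π : (Fin N → ℂ) →L[ℂ] (Fin (N - d) → ℂ)} {θ : (Fin N → ℂ) × (Fin (N - d) → ℂ) → Fin N → ℂ}

/-- By ρ_Z = -ρ_ζ θ_Z the d independent gradients are combinations of the rows of θ_Z. -/
theorem IsSegreChart.le_derivRank_zero (hθ : IsSegreChart M π θ p) (hp : p ∈ M)
    (hM : IsGenericSubmanifold d M) : d ≤ derivRank θ 0 (realPt π p) := by
  obtain ⟨ρ, hρ⟩ := hM p hp
  obtain ⟨R, hR⟩ := hρ.exists_complexification
  have h1 := finrank_span_eq_card hρ.generic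
  rw [Fintype.card_fin] at h1
  refine h1.symm.le.trans (Submodule.finrank_mono (Submodule.span_le.2 ?_))
  rintro _ ⟨j, rfl⟩
  have h2 : gradZ (ρ j) p = ∑ l, (-star (gradZ (ρ j) p) l) •
      derivRow θ 0 (⟨[], le_rfl⟩, l) (realPt π p) := by
    refine dotProduct_eq _ _ fun v => ?_
    have h3 := (hθ.gradient_identity hp hρ hR v).self_of_nhds j
    rw [hθ.graphMap_realPt hp, (hR j).fderiv_apply, (hR j).fderiv_apply] at h3
    rw [sum_dotProduct]
    simp only [smul_dotProduct, derivRow_dot]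
    simpa [dotProduct, pdw] using h3
  change gradZ (ρ j) p ∈ _
  rw [h2]
  exact Submodule.sum_mem _ fun l _ => Submodule.smul_mem _ _ (Submodule.subset_span ⟨_, rfl⟩)

theorem IsSegreChart.isNondegenerateAt_iff (hθ : IsSegreChart M π θ p) (hp : p ∈ M) (hd : d ≤ N)
    (hM : IsGenericSubmanifold d M) {k : ℕ} :
    IsNondegenerateAt d M k p ↔ derivRank θ k (realPt π p) = N := by
  obtain ⟨ρ, hρ⟩ := hM p hp
  rw [derivRank_eq_iff hθ.analyticAt]
  exact ⟨fun h v hv => hθ.eq_zero_of_van hp hd h hv, fun h => hθ.isNondegenerateAt hp hd hρ h⟩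

/-- Rank N at order N - d occurs at a point of the complexification, possibly off M; a minor nonzero
there cannot vanish on all of M near p. -/
theorem exists_isNondegenerateAt_codim (h : FinitelyNondegenerateAt d M p) (hp : p ∈ M)
    (hd : d ≤ N) (hM : IsGenericSubmanifold d M) :
    ∃ q ∈ M, IsNondegenerateAt d M (N - d) q := by
  obtain ⟨ρ, hρ⟩ := hM p hp
  have hn : d + (N - d) = N := by omega
  obtain ⟨π, θ, hθ⟩ := hρ.exists_chart hp hn
  obtain ⟨k, hk⟩ := h
  rw [hθ.isNondegenerateAt_iff hp hd hM] at hk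
  have hU : ∀ᶠ x in 𝓝 (realPt π p), AnalyticAt ℂ θ x ∧ d ≤ derivRank θ 0 x ∧
      derivRank θ k x = N := by
    filter_upwards [hθ.analyticAt.eventually_analyticAt, eventually_derivRank_le hθ.analyticAt 0,
      eventually_derivRank_le hθ.analyticAt k] with x h1 h2 h3
    exact ⟨h1, (hθ.le_derivRank_zero hp hM).trans h2, le_antisymm (rowRank_le _) (hk.symm.le.trans h3)⟩
  obtain ⟨ε, hε, hball⟩ := Metric.eventually_nhds_iff_ball.1 hU
  obtain ⟨x₁, hx₁, hr⟩ := exists_derivRank_eq hn Metric.isOpen_ball (Metric.nonempty_ball.2 hε)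
    (fun x hx => (hball x hx).1) (fun x hx => (hball x hx).2.1)
    fun x hx v hv => (derivRank_eq_iff (hball x hx).1).1 (hball x hx).2.2 v (hv _)
  obtain ⟨s, hs⟩ := (rowRank_eq_iff_exists_det _).1 hr
  have hΔ : AnalyticOnNhd ℂ (fun x => (Matrix.of fun k => derivRow θ (N - d) (s k) x).det)
      (Metric.ball (realPt π p) ε) := fun x hx =>
    analyticAt_det fun k l => analyticAt_pi_iff.1 (analyticAt_derivRow (hball x hx).1 (s k)) l
  by_contra! hno
  refine hs (hΔ.eqOn_zero_of_preconnected_of_eventuallyEq_zero Metric.isPreconnected_ball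
    (Metric.mem_ball_self hε) (hθ.eventually_eq_zero hp (hΔ _ (Metric.mem_ball_self hε)) ?_) hx₁)
  filter_upwards [hθ.eventually, self_mem_nhdsWithin] with q h1 h2
  by_contra h3
  exact hno q h2 ((h1.isNondegenerateAt_iff h2 hd hM).2 ((rowRank_eq_iff_exists_det _).2 ⟨s, h3⟩))

theorem analyticAt_normSq_realPt {n : ℕ} {π : (Fin N → ℂ) →L[ℂ] (Fin n → ℂ)}
    {g : (Fin N → ℂ) × (Fin n → ℂ) → ℂ} (hg : AnalyticAt ℂ g (realPt π p)) :
    AnalyticAt ℝ (fun Z => Complex.normSq (g (realPt π Z))) p := by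
  have h1 : AnalyticAt ℝ (fun Z => g (realPt π Z)) p :=
    AnalyticAt.fun_comp (g := g) (f := realPt π) hg.restrictScalars ((realPtL π).analyticAt p)
  have h2 : AnalyticAt ℝ (fun Z => (g (realPt π Z)).re) p :=
    AnalyticAt.fun_comp (g := Complex.re) (Complex.reCLM.analyticAt _) h1
  have h3 : AnalyticAt ℝ (fun Z => (g (realPt π Z)).im) p :=
    AnalyticAt.fun_comp (g := Complex.im) (Complex.imCLM.analyticAt _) h1
  simp only [Complex.normSq_apply]
  exact (h2.fun_mul h2).fun_add (h3.fun_mul h3)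

/-- Full rank means that one of finitely many minors is nonzero, and the sum of their squared moduli
on M is a single real analytic function. -/
theorem exists_real_analytic_degeneracy_locus (hp : p ∈ M) (hd : d ≤ N)
    (hM : IsGenericSubmanifold d M) (k : ℕ) : ∃ f : (Fin N → ℂ) → ℝ, AnalyticAt ℝ f p ∧
      ∀ᶠ Z in 𝓝[M] p, ¬ IsNondegenerateAt d M k Z ↔ f Z = 0 := by
  obtain ⟨ρ, hρ⟩ := hM p hp
  obtain ⟨π, θ, hθ⟩ := hρ.exists_chart hp (n := N - d) (by omega)
  have := Fintype.ofFinite (Fin N → BddWord (N - d) k × Fin N)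
  refine ⟨fun Z => ∑ s : Fin N → BddWord (N - d) k × Fin N, Complex.normSq
    ((Matrix.of fun j => derivRow θ k (s j) (realPt π Z)).det), ?_, ?_⟩
  · exact Finset.analyticAt_fun_sum _ fun s _ => analyticAt_normSq_realPt
      (g := fun x => (Matrix.of fun j => derivRow θ k (s j) x).det)
      (analyticAt_det fun j l => analyticAt_pi_iff.1 (analyticAt_derivRow hθ.analyticAt (s j)) l)
  · filter_upwards [hθ.eventually, self_mem_nhdsWithin] with q h1 h2
    rw [h1.isNondegenerateAt_iff h2 hd hM, derivRank, rowRank_eq_iff_exists_det,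
      Finset.sum_eq_zero_iff_of_nonneg fun s _ => Complex.normSq_nonneg _]
    simp

theorem isProperAnalyticSubset_degeneracy_locus (h : ∃ q ∈ M, FinitelyNondegenerateAt d M q)
    (hd : d ≤ N) (hM : IsGenericSubmanifold d M) :
    IsProperAnalyticSubset {q ∈ M | ¬ IsNondegenerateAt d M (N - d) q} M := by
  refine ⟨?_, fun p hp => ?_⟩
  · obtain ⟨p, hp, h⟩ := h
    obtain ⟨q, hq, hqn⟩ := exists_isNondegenerateAt_codim h hp hd hM
    exact ⟨fun x hx => hx.1, fun hs => (hs hq).2 hqn⟩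
  · obtain ⟨f, hf, h1⟩ := exists_real_analytic_degeneracy_locus hp hd hM (N - d)
    refine ⟨1, fun _ => f, fun _ => hf, ?_⟩
    filter_upwards [h1, self_mem_nhdsWithin] with Z h2 h3
    simp only [h3, true_and, h2, forall_const]

theorem IsNondegenerateAt.succ {k : ℕ} (h : IsNondegenerateAt d M k p) :
    IsNondegenerateAt d M (k + 1) p := by
  obtain ⟨ρ, a, h1, h2, h3⟩ := h
  refine ⟨ρ, a, h1, h2, top_le_iff.1 (h3.symm.le.trans (Submodule.span_mono ?_))⟩
  rintro v ⟨j, α, hα, rfl⟩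
  exact ⟨j, α, by omega, rfl⟩

end GenericNondegeneracy

end CRGeom

/-! ### The equivalences. -/

theorem proposition1p3p1 (N d : ℕ) (hd : d < N) (M : Set (Fin N → ℂ))
    (hM : CRGeom.IsGenericSubmanifold d M) (hconn : IsConnected M) :
    List.TFAE [
      CRGeom.HolomorphicallyNondegenerate d M,
      ∃ p ∈ M, ∃ k : ℕ, 0 < k ∧ CRGeom.IsNondegenerateAt d M k p,
      ∃ (V : Set (Fin N → ℂ)) (l : ℕ), CRGeom.IsProperAnalyticSubset V M ∧
        1 ≤ l ∧ l ≤ N - d ∧ ∀ p ∈ M \ V, CRGeom.IsNondegenerateAt d M l p,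
      ∃ p ∈ M, CRGeom.EssentiallyFiniteAt d M p,
      ∃ U ⊆ M, (∃ O : Set (Fin N → ℂ), IsOpen O ∧ U = O ∩ M) ∧ M ⊆ closure U ∧
        ∀ p ∈ U, CRGeom.EssentiallyFiniteAt d M p] := by
  tfae_have 1 → 2 := fun h => by
    obtain ⟨p, hp, k, hk⟩ := (CRGeom.holomorphicallyNondegenerate_iff hd.le hM).1 h
    -- The order is raised by one to make it positive.
    exact ⟨p, hp, k + 1, k.succ_pos, hk.succ⟩
  tfae_have 2 → 1 := fun ⟨p, hp, k, _, hk⟩ =>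
    (CRGeom.holomorphicallyNondegenerate_iff hd.le hM).2 ⟨p, hp, k, hk⟩
  -- ℓ = N - d works, and it is at least 1 because d < N.
  tfae_have 2 → 3 := fun ⟨p, hp, k, _, hk⟩ =>
    ⟨_, N - d, CRGeom.isProperAnalyticSubset_degeneracy_locus ⟨p, hp, k, hk⟩ hd.le hM, by omega,
      le_rfl, fun q hq => not_not.1 fun h => hq.2 ⟨hq.1, h⟩⟩
  tfae_have 3 → 2 := fun ⟨V, l, hV, hl, _, h⟩ => by
    obtain ⟨q, hq, hqV⟩ := Set.exists_of_ssubset hV.ssubset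
    exact ⟨q, hq, l, hl, h q ⟨hq, hqV⟩⟩
  tfae_have 2 → 5 := fun ⟨p, hp, k, _, hk⟩ => by
    refine ⟨{q ∈ M | CRGeom.FinitelyNondegenerateAt d M q}, fun q hq => hq.1,
      CRGeom.exists_isOpen_finitelyNondegenerateAt hd.le hM, fun q hq => ?_,
      fun q hq => hq.2.essentiallyFiniteAt hq.1 hd.le hM⟩
    rw [mem_closure_iff_frequently]
    have h1 := CRGeom.frequently_finitelyNondegenerateAt_of_isPreconnected hconn.isPreconnected
      hd.le hM ⟨p, hp, k, hk⟩ q hq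
    exact (frequently_nhdsWithin_iff.1 h1).mono fun x hx => ⟨hx.2, hx.1⟩
  tfae_have 5 → 4 := fun ⟨U, hU, _, hcl, h⟩ => by
    obtain ⟨p, hp⟩ := hconn.nonempty
    obtain ⟨q, hq⟩ := closure_nonempty_iff.1 ⟨p, hcl hp⟩
    exact ⟨q, hU hq, h q hq⟩
  tfae_have 4 → 1 := fun ⟨p, hp, h⟩ => (CRGeom.holomorphicallyNondegenerate_iff hd.le hM).2
    (h.exists_finitelyNondegenerateAt hp hd.le hM)
  tfae_finish
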